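/- Let $d\ge 1$, $T>0$, $\lambda\in(0,2)$, $c_\lambda>0$ and $Q_T=\mathbb{R}^d\times(0,T)$. Let $f=(f_1,\dots,f_d):\mathbb{R}\to\mathbb{R}^d$ and $A:\mathbb{R}\to\mathbb{R}$ be Lipschitz continuous, $A$ non-decreasing with Lipschitz constant $L_A$ and $A(0)=0$, and let $u_0:\mathbb{R}^d\to\mathbb{R}$ be locally integrable. Consider $$\partial_t u+\nabla\cdot f(u)=-(-\Delta)^{\lambda/2}A(u)\ \text{ in } Q_T,\qquad u(\cdot,0)=u_0, \tag{1}$$ where $-(-\Delta)^{\lambda/2}\phi(x)=c_\lambda\,\mathrm{P.V.}\int_{|z|>0}\frac{\phi(x+z)-\phi(x)}{|z|^{d+\lambda}}\,dz$. *Entropy solutions.* For $r>0$ put $$g_r[\varphi](x)=c_\lambda\lim_{b\downarrow0}\int_{b<|z|<r}\frac{\varphi(x+z)-\varphi(x)}{|z|^{d+\lambda}}\,dz,\qquad g^r[\psi](x)=c_\lambda\int_{|z|>r}\frac{\psi(x+z)-\psi(x)}{|z|^{d+\lambda}}\,dz ,$$ and for $k\in\mathbb{R}$ put $\eta_k(u)=|u-k|$,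 $\eta_k'(u)=\operatorname{sgn}(u-k)$ with $\operatorname{sgn}(0)=0$, and $q_k(u)=\eta_k'(u)(f(u)-f(k))$. A function $u$ is an entropy solution of (1) if (i) $u\in L^\infty(Q_T)\cap C([0,T];L^1(\mathbb{R}^d))$; (ii) for all $k\in\mathbb{R}$, all $r>0$ and all nonnegative $\varphi\in C_c^\infty(Q_T)$, the integral below exists (its integrand is integrable) and $$\iint_{Q_T}\eta_k(u)\,\partial_t\varphi+q_k(u)\cdot\nabla\varphi+\eta_{A(k)}(A(u))\,g_r[\varphi]+\eta_k'(u)\,g^r[A(u)]\,\varphi\;dx\,dt\ge0;$$ (iii) $u(\cdot,0)=u_0$ a.e. *The scheme.* For $m\in\mathbb{N}$ let $\Delta x=\Delta x_m>0$, $\Delta t=\Delta t_m>0$ and $N=N_m\in\mathbb{N}$ with $N\Delta t=T$, and $\Delta x_m\to0$ as $m\to\infty$. For $1\le l\le d$ let $F_l=F_l^{(m)}:\mathbb{R}^2\to\mathbb{R}$ satisfy $F_l(v,v)=f_l(v)$, be non-decreasing in the first and non-increasing in the second variable, and satisfy $|F_l(a,b)-F_l(a',b')|\le L_F(|a-a'|+|b-b'|)$,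 with a constant $L_F$ independent of $l$ and $m$. With $x_\alpha=\Delta x\,\alpha$ for $\alpha\in\mathbb{Z}^d$, $R=\Delta x[0,1)^d$, $R_0=\frac{\Delta x}2[-1,1)^d$ and $G_\beta=c_\lambda\int_{x_\beta+R_0}|z|^{-d-\lambda}\,dz$ for $\beta\ne0$, let $(U^n_\alpha)_{0\le n\le N,\ \alpha\in\mathbb{Z}^d}$ solve $$U^{n+1}_\alpha=U^n_\alpha-\Delta t\sum_{l=1}^d\frac{F_l(U^n_\alpha,U^n_{\alpha+e_l})-F_l(U^n_{\alpha-e_l},U^n_\alpha)}{\Delta x}+\Delta t\sum_{\beta\neq0}G_\beta\big(A(U^n_{\alpha+\beta})-A(U^n_\alpha)\big)\quad(0\le n<N),$$ $$U^0_\alpha=\frac1{\Delta x^d}\int_{x_\alpha+R}u_0(x)\,dx,$$ and let $\bar u_m(x,t)=U^n_\alpha$ for $(x,t)\in(x_\alpha+R)\times[n\Delta t,(n+1)\Delta t)$. Assume that for every $m$ the CFL condition $$2dL_F\frac{\Delta t}{\Delta x}+\Big(c_\lambda2^\lambda L_A\int_{|z|>1}\frac{dz}{|z|^{d+\lambda}}\Big)\frac{\Delta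 t}{\Delta x^\lambda}\le1$$ holds. **Theorem.** Suppose that $(\bar u_m)$ is uniformly bounded in $L^\infty(Q_T)$ and that there is $u\in L^\infty(Q_T)\cap C([0,T];L^1(\mathbb{R}^d))$ such that $$\sup_{t\in[0,T]}\|\bar u_m(\cdot,t)-u(\cdot,t)\|_{L^1(\mathbb{R}^d)}\to0\quad\text{as } m\to\infty.$$ Then $u$ is an entropy solution of (1). -/

import Mathlib

open MeasureTheory Filter Topology Set
open scoped NNReal ENNReal ContDiff

noncomputable section

namespace FracConvDiff

/-- The Euclidean space `ℝ^d`. -/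
abbrev Space (d : ℕ) : Type := EuclideanSpace ℝ (Fin d)

/-- The space-time cylinder `Q_T = ℝ^d × (0,T)`. -/
def cylinder (d : ℕ) (T : ℝ) : Set (Space d × ℝ) := univ ×ˢ Ioo 0 T

/-! ### The nonlocal operator, split at radius `r` -/

/-- The singular kernel `|z|^{-(d+lam)}`. -/
def kernel (d : ℕ) (lam : ℝ) (z : Space d) : ℝ := 1 / ‖z‖ ^ ((d : ℝ) + lam)

/-- `g_r[φ](x) = c · P.V. ∫_{|z|<r} (φ(x+z) - φ(x)) / |z|^{d+lam} dz`, the principal value being the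
limit as `b ↓ 0` of the integral over `b < |z| < r`. It is applied to smooth functions with compact
support only, for which this limit exists. -/
def gInner {d : ℕ} (c lam r : ℝ) (φ : Space d → ℝ) (x : Space d) : ℝ :=
  c * limUnder (𝓝[>] (0 : ℝ)) fun b =>
    ∫ z in {z : Space d | b < ‖z‖ ∧ ‖z‖ < r}, (φ (x + z) - φ x) * kernel d lam z

/-- `g^r[ψ](x) = c ∫_{|z|>r} (ψ(x+z) - ψ(x)) / |z|^{d+lam} dz`. -/
def gOuter {d : ℕ} (c lam r : ℝ) (ψ : Space d → ℝ) (x : Space d) : ℝ :=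
  c * ∫ z in {z : Space d | r < ‖z‖}, (ψ (x + z) - ψ x) * kernel d lam z

/-! ### Entropy solutions -/

/-- The Kruzkov entropy `η_k(u) = |u - k|`. -/
def entropy (k u : ℝ) : ℝ := |u - k|

/-- Its derivative `η'_k(u) = sgn(u - k)`, with `sgn 0 = 0`. -/
def entropySign (k u : ℝ) : ℝ := Real.sign (u - k)

/-- The entropy flux `q_k(u) = sgn(u - k) (f(u) - f(k))`. -/
def entropyFlux {d : ℕ} (f : ℝ → Space d) (k u : ℝ) : Space d :=
  entropySign k u • (f u - f k)

/-- `u ∈ L^∞(Q_T) ∩ C([0,T]; L^1(ℝ^d))`. Only the values of `u` for times in `[0,T]` matter. -/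
structure IsBoundedContL1 {d : ℕ} (T : ℝ) (u : Space d × ℝ → ℝ) : Prop where
  memLp_top : MemLp u ∞ (volume.restrict (cylinder d T))
  integrable : ∀ t ∈ Icc 0 T, Integrable fun x : Space d => u (x, t)
  continuous : ∀ t ∈ Icc 0 T,
    Tendsto (fun s => eLpNorm (fun x : Space d => u (x, s) - u (x, t)) 1 volume)
      (𝓝[Icc 0 T] t) (𝓝 0)

/-- Nonnegative test functions in `C_c^∞(Q_T)`. -/
structure IsTestFunction {d : ℕ} (T : ℝ) (φ : Space d × ℝ → ℝ) : Prop where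
  smooth : ContDiff ℝ ∞ φ
  compact : HasCompactSupport φ
  support : tsupport φ ⊆ cylinder d T
  nonneg : ∀ p, 0 ≤ φ p

/-- The integrand
`η_k(u) ∂_tφ + q_k(u)·∇φ + η_{A(k)}(A(u)) g_r[φ] + η'_k(u) g^r[A(u)] φ`
of the entropy inequality, at the point `p = (x,t)`. -/
def entropyIntegrand {d : ℕ} (c lam : ℝ) (f : ℝ → Space d) (A : ℝ → ℝ) (k r : ℝ)
    (u φ : Space d × ℝ → ℝ) (p : Space d × ℝ) : ℝ :=
  entropy k (u p) * deriv (fun s => φ (p.1, s)) p.2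
    + inner ℝ (entropyFlux f k (u p)) (gradient (fun y => φ (y, p.2)) p.1)
    + entropy (A k) (A (u p)) * gInner c lam r (fun y => φ (y, p.2)) p.1
    + entropySign k (u p) * gOuter c lam r (fun y => A (u (y, p.2))) p.1 * φ p

/-- `u` is an entropy solution on `Q_T` of
`∂_t u + ∇·f(u) = -(-Δ)^{lam/2} A(u)`, `u(·,0) = u₀`. -/
structure IsEntropySolution {d : ℕ} (c lam T : ℝ) (f : ℝ → Space d) (A : ℝ → ℝ)
    (u₀ : Space d → ℝ) (u : Space d × ℝ → ℝ) : Prop where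
  regularity : IsBoundedContL1 T u
  entropy_ineq : ∀ k r : ℝ, 0 < r → ∀ φ : Space d × ℝ → ℝ, IsTestFunction T φ →
    IntegrableOn (entropyIntegrand c lam f A k r u φ) (cylinder d T) ∧
      0 ≤ ∫ p in cylinder d T, entropyIntegrand c lam f A k r u φ p
  initial : (fun x => u (x, 0)) =ᵐ[volume] u₀

/-! ### The difference-quadrature scheme -/

/-- Admissible numerical fluxes `F(u₁,u₂)` for a scalar flux `f`: Lipschitz with constant `LF` (in
each variable), consistent with `f`, non-decreasing in `u₁` and non-increasing in `u₂`. -/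
structure IsNumericalFlux (LF : ℝ≥0) (f : ℝ → ℝ) (F : ℝ → ℝ → ℝ) : Prop where
  lipschitz : ∀ a b a' b', |F a b - F a' b'| ≤ LF * (|a - a'| + |b - b'|)
  consistent : ∀ a, F a a = f a
  monotone_fst : ∀ b, Monotone fun a => F a b
  antitone_snd : ∀ a, Antitone fun b => F a b

/-- The cell `x_α + Δx [0,1)^d`, where `x_α = Δx α`. -/
def cell {d : ℕ} (Δx : ℝ) (α : Fin d → ℤ) : Set (Space d) :=
  {x | ∀ l, Δx * α l ≤ x l ∧ x l < Δx * α l + Δx}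

/-- The centred cell `x_α + (Δx/2) [-1,1)^d`. -/
def centredCell {d : ℕ} (Δx : ℝ) (α : Fin d → ℤ) : Set (Space d) :=
  {z | ∀ l, Δx * α l - Δx / 2 ≤ z l ∧ z l < Δx * α l + Δx / 2}

/-- The quadrature weight `G_α = c ∫_{x_α + (Δx/2)[-1,1)^d} |z|^{-(d+lam)} dz`, used for `α ≠ 0`. -/
def weight {d : ℕ} (c lam Δx : ℝ) (α : Fin d → ℤ) : ℝ :=
  c * ∫ z in centredCell Δx α, kernel d lam z

/-- `U^n_α`, `n = 0,…,N`, solves the explicit scheme with mesh sizes `Δx`, `Δt`. Here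
`Pi.single l 1` is the `l`-th unit vector `e_l` of `ℤ^d`, and the summand of the first sum is
`D_l^- F_l(U^n_α, U^n_{α+e_l})`. The sum over `β ≠ 0` converges absolutely whenever `U^n` is
bounded. -/
structure IsSchemeSolution {d : ℕ} (c lam : ℝ) (A : ℝ → ℝ) (F : Fin d → ℝ → ℝ → ℝ)
    (u₀ : Space d → ℝ) (Δx Δt : ℝ) (N : ℕ) (U : ℕ → (Fin d → ℤ) → ℝ) : Prop where
  init : ∀ α, U 0 α = 1 / Δx ^ d * ∫ x in cell Δx α, u₀ x
  step : ∀ n < N, ∀ α, U (n + 1) α = U n α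
    - Δt * ∑ l, (F l (U n α) (U n (α + Pi.single l 1))
        - F l (U n (α - Pi.single l 1)) (U n α)) / Δx
    + Δt * ∑' β : {β : Fin d → ℤ // β ≠ 0}, weight c lam Δx β.1 * (A (U n (α + β.1)) - A (U n α))

/-- The CFL condition. -/
def CFL (d : ℕ) (c lam : ℝ) (LF LA : ℝ≥0) (Δx Δt : ℝ) : Prop :=
  2 * d * LF * (Δt / Δx)
    + (c * 2 ^ lam * LA * ∫ z in {z : Space d | 1 < ‖z‖}, kernel d lam z) * (Δt / Δx ^ lam) ≤ 1

/-- The piecewise constant interpolation `ū(x,t) = U^n_α` for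
`(x,t) ∈ (x_α + Δx [0,1)^d) × [nΔt, (n+1)Δt)`; see `interp_eq`. -/
def interp {d : ℕ} (Δx Δt : ℝ) (U : ℕ → (Fin d → ℤ) → ℝ) (p : Space d × ℝ) : ℝ :=
  U ⌊p.2 / Δt⌋₊ fun l => ⌊p.1 l / Δx⌋

theorem interp_eq {d : ℕ} {Δx Δt : ℝ} (hx : 0 < Δx) (ht : 0 < Δt) (U : ℕ → (Fin d → ℤ) → ℝ)
    {n : ℕ} {α : Fin d → ℤ} {x : Space d} {t : ℝ} (hxα : x ∈ cell Δx α)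
    (htn : t ∈ Ico (n * Δt) ((n + 1) * Δt)) : interp Δx Δt U (x, t) = U n α := by
  have h1 : ⌊t / Δt⌋₊ = n := by
    rw [Nat.floor_eq_iff (div_nonneg (le_trans (by positivity) htn.1) ht.le)]
    exact ⟨(le_div_iff₀ ht).2 htn.1, (div_lt_iff₀ ht).2 htn.2⟩
  have h2 : (fun l => ⌊x l / Δx⌋) = α := by
    funext l
    rw [Int.floor_eq_iff]
    obtain ⟨h, h'⟩ := hxα l
    exact ⟨(le_div_iff₀ hx).2 (by linarith), (div_lt_iff₀ hx).2 (by linarith)⟩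
  simp only [interp, h1, h2]

end FracConvDiff

end

noncomputable section

namespace FracConvDiff

/-! ### The kernel -/

/-! Under the CFL condition the scheme is monotone, so it satisfies a discrete Kruzkov inequality,
and the assumed convergence suffices to pass to the limit in it.

Quadrature as an integral. The centred cells tile the space, so the sum of `G_β (A(U_{α+β}) -
A(U_α))` equals `c ∫ kernel(z) (A(v(x + [z])) - A(v(x))) dz`, where `[z]` (`gridRound`) is the
centre of the cell containing `z` (`tsum_weight_mul`). The interpolation thus satisfies the scheme
at every point of space-time with `0 ≤ t` and `t + τ < T` (`IsSchemeFun`), summation by parts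
becomes translation invariance of Lebesgue measure, and the quadrature can be cut exactly at `|z| =
r`, even across cells.

Cell inequality (`cell_entropy_inequality`). Let `H` be the step that keeps only the quadrature over
`|z| ≤ r`. It is monotone and fixes constants, so `|H w - k| ≤ H(max w k) - H(min w k)`, whose right
side is `|w - k|` corrected by the differences of the numerical entropy flux and the quadrature of
`|A(w) - A(k)|`. The part over `|z| > r` is added back multiplied by the sign of the new value minus
`k`; hence a sign at time `t + τ` stands next to a quadrature at time `t`.

Limit. After testing, the inner quadrature acts on `φ`. Rounding is odd almost everywhere, which
turns first differences into second differences; with `|[z]| ≤ 2|z|` they are dominated by `|z|²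
kernel(z)`, integrable near `0` because `λ < 2`, so they converge to `g_r[φ]` (`tendsto_discInner`,
`gInner_eq`). The outer quadrature converges locally in `L¹` by continuity of translations
(`tendsto_lintegral_quadOn_sub_gOuter`), and the time-shifted values converge because `u` is
continuous in time with values in `L¹`. Along a subsequence everything converges almost everywhere.
The only discontinuity, that of the sign, is harmless when `{u = k}` is null
(`entropy_inequality_of_level_null`), which holds for all but countably many `k`. For the others the
inequalities at good levels `k₁ ↓ k` and `k₂ ↑ k` are added: on `{u = k}` the two signs cancel, in
agreement with `sgn 0 = 0`.

The CFL condition forces `Δt → 0` unless `LF = LA = 0`; in that case the scheme is stationary and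
the time step can be chosen freely. The initial condition follows by comparing the weak limit `u₀`
of the cell averages with their `L¹` limit `u(·,0)`. -/

theorem kernel_nonneg {d : ℕ} {lam : ℝ} (z : Space d) : 0 ≤ kernel d lam z := by
  unfold kernel; positivity

theorem kernel_neg {d : ℕ} {lam : ℝ} (z : Space d) : kernel d lam (-z) = kernel d lam z := by
  simp [kernel]

@[fun_prop]
theorem measurable_kernel {d : ℕ} {lam : ℝ} : Measurable (kernel d lam) := by
  unfold kernel; fun_prop

theorem nontrivial_space {d : ℕ} (hd : 1 ≤ d) : Nontrivial (Space d) :=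
  Module.nontrivial_of_finrank_pos (R := ℝ) (by simp; omega)

/-- For `r ≤ |z|` one has `1 + |z| ≤ ((1 + r) / r) |z|`, so a multiple of `(1 + |z|) ^ (-(d + λ))`
dominates the kernel. -/
theorem integrableOn_kernel {d : ℕ} {lam r : ℝ} (hlam : 0 < lam) (hr : 0 < r) :
    IntegrableOn (kernel d lam) {z | r ≤ ‖z‖} := by
  have h1 : Integrable (fun z : Space d => (1 + ‖z‖) ^ (-((d : ℝ) + lam))) :=
    integrable_one_add_norm (by simp; linarith)
  have hs : MeasurableSet {z : Space d | r ≤ ‖z‖} := measurableSet_le (by fun_prop) (by fun_prop)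
  refine ((h1.const_mul (((1 + r) / r) ^ ((d : ℝ) + lam))).integrableOn).mono'
    (by fun_prop) ?_
  filter_upwards [ae_restrict_mem hs] with z hz
  have hz : r ≤ ‖z‖ := hz
  have hz0 : 0 < ‖z‖ := hr.trans_le hz
  rw [Real.norm_of_nonneg (kernel_nonneg z), Real.rpow_neg (by positivity), ← Real.inv_rpow
    (by positivity), ← Real.mul_rpow (by positivity) (by positivity), kernel, one_div,
    ← Real.inv_rpow (by positivity)]
  refine Real.rpow_le_rpow (by positivity) ?_ (by positivity)
  rw [inv_eq_one_div, ← div_eq_mul_inv, div_div, div_le_div_iff₀ (by positivity) (by positivity)]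
  nlinarith

theorem integrableOn_kernel_gt {d : ℕ} {lam r : ℝ} (hlam : 0 < lam) (hr : 0 < r) :
    IntegrableOn (kernel d lam) {z | r < ‖z‖} :=
  (integrableOn_kernel hlam hr).mono_set fun _ hz => mem_ofPred.2 (le_of_lt (mem_ofPred.1 hz))

/-- In polar coordinates the integrand becomes `y ^ (1 - λ)`, integrable at `0` because `λ < 2`.
This is the majorant for all second-difference integrals below. -/
theorem integrableOn_sq_mul_kernel {d : ℕ} (hd : 1 ≤ d) {lam : ℝ} (hlam : lam < 2) (r : ℝ) :
    IntegrableOn (fun z => ‖z‖ ^ 2 * kernel d lam z) {z | ‖z‖ ≤ r} := by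
  have := nontrivial_space hd
  have key : IntegrableOn (fun z : Space d => (fun y : ℝ => y ^ 2 * (1 / y ^ ((d : ℝ) + lam))) ‖z‖)
      (Metric.ball 0 (|r| + 1)) := by
    refine (integrableOn_fun_norm_addHaar volume (f := fun y : ℝ => y ^ 2 * (1 / y ^ ((d : ℝ) + lam)))).2 ?_
    have h2 : IntegrableOn (fun y : ℝ => y ^ (1 - lam)) (Ioo 0 (|r| + 1)) := by
      rw [← intervalIntegrable_iff_integrableOn_Ioo_of_le (by positivity)]
      exact intervalIntegral.intervalIntegrable_rpow' (by linarith)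
    refine h2.congr_fun (fun y hy => ?_) measurableSet_Ioo
    have hy0 : 0 < y := hy.1
    simp only [finrank_euclideanSpace, Fintype.card_fin, smul_eq_mul]
    rw [← Real.rpow_natCast, ← Real.rpow_natCast, one_div, ← Real.rpow_neg hy0.le,
      ← Real.rpow_add hy0, ← Real.rpow_add hy0]
    congr 1
    push_cast [Nat.cast_sub hd]
    ring
  refine key.mono_set fun z hz => ?_
  simp only [mem_ofPred_eq] at hz
  simp only [Metric.mem_ball, dist_zero_right]
  linarith [le_abs_self r]

theorem kernel_smul {d : ℕ} {lam s : ℝ} (hs : 0 < s) (z : Space d) :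
    kernel d lam (s • z) = s ^ (-((d : ℝ) + lam)) * kernel d lam z := by
  rw [kernel, kernel, norm_smul, Real.norm_of_nonneg hs.le, Real.mul_rpow hs.le (norm_nonneg _),
    Real.rpow_neg hs.le]
  field_simp

-- Substitute `z = s y`: the Jacobian `s ^ d` meets the homogeneity `s ^ (-(d + λ))`. With `s = Δx /
-- 2` this produces the factor `2 ^ λ / Δx ^ λ` of the CFL condition.
open scoped Pointwise in
theorem setIntegral_kernel_gt {d : ℕ} {lam s : ℝ} (hs : 0 < s) :
    ∫ z in {z : Space d | s < ‖z‖}, kernel d lam z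
      = s ^ (-lam) * ∫ z in {z : Space d | 1 < ‖z‖}, kernel d lam z := by
  have h := Measure.setIntegral_comp_smul_of_pos volume (kernel d lam) {z : Space d | 1 < ‖z‖} hs
  have hset : s • {z : Space d | 1 < ‖z‖} = {z : Space d | s < ‖z‖} := by
    ext z
    rw [mem_smul_set_iff_inv_smul_mem₀ hs.ne']
    simp only [mem_ofPred_eq, norm_smul, norm_inv, Real.norm_of_nonneg hs.le]
    rw [← div_eq_inv_mul, one_lt_div hs]
  rw [hset] at h
  simp_rw [kernel_smul hs] at h
  rw [integral_const_mul] at h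
  simp only [finrank_euclideanSpace, Fintype.card_fin, smul_eq_mul] at h
  have hsd : s ^ d ≠ 0 := by positivity
  have : ∫ z in {z : Space d | s < ‖z‖}, kernel d lam z =
      s ^ d * (s ^ (-((d : ℝ) + lam)) * ∫ z in {z : Space d | 1 < ‖z‖}, kernel d lam z) := by
    rw [h]; field_simp
  rw [this, ← mul_assoc, ← Real.rpow_natCast, ← Real.rpow_add hs]
  congr 2
  ring

theorem setIntegral_kernel_pos {d : ℕ} (hd : 1 ≤ d) {lam : ℝ} (hlam : 0 < lam) :
    0 < ∫ z in {z : Space d | 1 < ‖z‖}, kernel d lam z := by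
  have := nontrivial_space hd
  have ho : IsOpen {z : Space d | 1 < ‖z‖} := isOpen_lt continuous_const continuous_norm
  rw [setIntegral_pos_iff_support_of_nonneg_ae (ae_of_all _ kernel_nonneg)
    (integrableOn_kernel_gt hlam one_pos)]
  have hsub : {z : Space d | 1 < ‖z‖} ⊆ Function.support (kernel d lam) ∩ {z | 1 < ‖z‖} := by
    intro z hz
    have hz' : 0 < ‖z‖ := one_pos.trans hz
    refine ⟨?_, hz⟩
    simp only [kernel, Function.mem_support]
    positivity
  refine lt_of_lt_of_le (ho.measure_pos volume ?_) (measure_mono hsub)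
  obtain ⟨z, hz⟩ := NormedSpace.exists_lt_norm ℝ (Space d) 1
  exact ⟨z, hz⟩

/-! ### Rounding to the grid -/

/-- The grid index of the centred cell containing `z`. -/
def gridIndex {d : ℕ} (h : ℝ) (z : Space d) : Fin d → ℤ := fun l => ⌊z l / h + 1 / 2⌋

/-- The grid point `h β`. -/
def gridPoint {d : ℕ} (h : ℝ) (β : Fin d → ℤ) : Space d := WithLp.toLp 2 fun l => h * β l

/-- The centre of the centred cell containing `z`. -/
def gridRound {d : ℕ} (h : ℝ) (z : Space d) : Space d := gridPoint h (gridIndex h z)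

@[simp]
theorem gridPoint_apply {d : ℕ} (h : ℝ) (β : Fin d → ℤ) (l : Fin d) :
    gridPoint h β l = h * β l := rfl

@[simp]
theorem gridRound_apply {d : ℕ} (h : ℝ) (z : Space d) (l : Fin d) :
    gridRound h z l = h * ⌊z l / h + 1 / 2⌋ := rfl

theorem mem_centredCell_iff {d : ℕ} {h : ℝ} (hh : 0 < h) (z : Space d) (β : Fin d → ℤ) :
    z ∈ centredCell h β ↔ gridIndex h z = β := by
  simp only [centredCell, mem_ofPred_eq, gridIndex, funext_iff, Int.floor_eq_iff]
  refine forall_congr' fun l => ?_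
  have h1 : z l / h * h = z l := div_mul_cancel₀ _ hh.ne'
  constructor
  · rintro ⟨h2, h3⟩
    constructor
    · rw [← sub_le_iff_le_add, le_div_iff₀ hh]; linarith
    · rw [← lt_sub_iff_add_lt, div_lt_iff₀ hh]; linarith
  · rintro ⟨h2, h3⟩
    rw [← sub_le_iff_le_add, le_div_iff₀ hh] at h2
    rw [← lt_sub_iff_add_lt, div_lt_iff₀ hh] at h3
    constructor <;> linarith

@[fun_prop]
theorem measurable_gridRound {d : ℕ} (h : ℝ) : Measurable (gridRound h : Space d → Space d) := by
  unfold gridRound gridPoint gridIndex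
  refine (WithLp.measurable_toLp 2 _).comp (measurable_pi_lambda _ fun l => ?_)
  have h1 : Measurable fun z : Space d => z l / h + 1 / 2 := by fun_prop
  have h2 := Int.measurable_floor.comp h1
  exact (measurable_from_top (f := fun n : ℤ => (n : ℝ)).comp h2).const_mul h

theorem abs_gridRound_sub_le {d : ℕ} {h : ℝ} (hh : 0 < h) (z : Space d) (l : Fin d) :
    |gridRound h z l - z l| ≤ h / 2 := by
  have h1 := Int.floor_le (z l / h + 1 / 2)
  have h2 := Int.lt_floor_add_one (z l / h + 1 / 2)
  have h3 : z l / h * h = z l := div_mul_cancel₀ _ hh.ne'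
  rw [gridRound_apply, abs_le]
  constructor <;> nlinarith

theorem gridRound_apply_eq_zero {d : ℕ} {h : ℝ} (hh : 0 < h) {z : Space d} {l : Fin d}
    (hz : |z l| < h / 2) : gridRound h z l = 0 := by
  rw [abs_lt] at hz
  have : ⌊z l / h + 1 / 2⌋ = 0 := by
    rw [Int.floor_eq_zero_iff]
    constructor
    · rw [← sub_le_iff_le_add, le_div_iff₀ hh]; linarith
    · rw [← lt_sub_iff_add_lt, div_lt_iff₀ hh]; linarith
  rw [gridRound_apply, this]; simp

/-- Coordinatewise: if `|z l| < h / 2` the coordinate rounds to `0`, otherwise rounding moves it by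
at most `h / 2 ≤ |z l|`. -/
theorem norm_gridRound_le {d : ℕ} {h : ℝ} (hh : 0 < h) (z : Space d) :
    ‖gridRound h z‖ ≤ 2 * ‖z‖ := by
  have key : ∀ l, |gridRound h z l| ≤ 2 * |z l| := by
    intro l
    by_cases hz : |z l| < h / 2
    · rw [gridRound_apply_eq_zero hh hz]; simp
    · have h1 := abs_gridRound_sub_le hh z l
      have h2 := abs_sub_abs_le_abs_sub (gridRound h z l) (z l)
      linarith
  rw [← Real.norm_of_nonneg (zero_le_two (α := ℝ)), ← norm_smul]
  rw [EuclideanSpace.norm_eq, EuclideanSpace.norm_eq]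
  refine Real.sqrt_le_sqrt (Finset.sum_le_sum fun l _ => ?_)
  have := key l
  simp only [PiLp.smul_apply, smul_eq_mul, Real.norm_eq_abs, abs_mul, abs_two]
  gcongr

/-- Every coordinate smaller than `h / 2` rounds to `0`. Consequently, for a fixed mesh, the
quadrature never sees the singularity of the kernel. -/
theorem half_le_norm_of_gridRound_ne_zero {d : ℕ} {h : ℝ} (hh : 0 < h) {z : Space d}
    (hz : gridRound h z ≠ 0) : h / 2 ≤ ‖z‖ := by
  by_contra! hlt
  apply hz
  ext l
  rw [gridRound_apply_eq_zero hh]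
  · rfl
  · exact (Real.norm_eq_abs _ ▸ PiLp.norm_apply_le z l).trans_lt hlt

theorem tendsto_gridRound {d : ℕ} {h : ℕ → ℝ} (hh : ∀ m, 0 < h m) (hh0 : Tendsto h atTop (𝓝 0))
    (z : Space d) : Tendsto (fun m => gridRound (h m) z) atTop (𝓝 z) := by
  rw [(PiLp.homeomorph 2 _).isInducing.tendsto_nhds_iff, tendsto_pi_nhds]
  intro l
  rw [tendsto_iff_norm_sub_tendsto_zero]
  refine squeeze_zero (fun _ => norm_nonneg _) (fun m => ?_) (by simpa using hh0.div_const 2)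
  exact abs_gridRound_sub_le (hh m) z l

theorem volume_coord_eq {d : ℕ} (l : Fin d) (a : ℝ) : volume {z : Space d | z l = a} = 0 := by
  have hs : MeasurableSet {z : Space d | z l = a} :=
    measurableSet_eq_fun (by fun_prop) (by fun_prop)
  rw [← (EuclideanSpace.volume_preserving_symm_measurableEquiv_toLp (Fin d)).symm.measure_preimage
    hs.nullMeasurableSet]
  exact Measure.pi_hyperplane (fun _ => (volume : Measure ℝ)) l a

/-- The half-open cells are not symmetric, but rounding fails to be odd only on the cell walls, a
countable union of hyperplanes. -/
theorem gridRound_neg_ae {d : ℕ} {h : ℝ} (hh : 0 < h) :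
    ∀ᵐ z : Space d, gridRound h (-z) = -gridRound h z := by
  have h1 : ∀ᵐ z : Space d, ∀ l, ∀ n : ℤ, z l ≠ h * (n - 1 / 2) := by
    rw [ae_all_iff]; intro l
    rw [ae_all_iff]; intro n
    exact measure_eq_zero_iff_ae_notMem.1 (volume_coord_eq l (h * (n - 1 / 2)))
  filter_upwards [h1] with z hz
  ext l
  have h2 : ⌊(-z) l / h + 1 / 2⌋ = -⌊z l / h + 1 / 2⌋ := by
    have h3 := Int.floor_le (z l / h + 1 / 2)
    have h4 := Int.lt_floor_add_one (z l / h + 1 / 2)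
    have h5 : z l / h ≠ ⌊z l / h + 1 / 2⌋ - 1 / 2 := by
      intro h6
      refine hz l ⌊z l / h + 1 / 2⌋ ?_
      rw [← h6]; field_simp
    rw [Int.floor_eq_iff]
    -- The strict inequality is what the removed hyperplanes provide; under reflection it becomes
    -- the strict upper bound for the floor at `-z`.
    have h7 : ((⌊z l / h + 1 / 2⌋ : ℤ) : ℝ) < z l / h + 1 / 2 :=
      lt_of_le_of_ne h3 fun h8 => h5 (by linarith)
    simp only [PiLp.neg_apply, neg_div]
    push_cast
    constructor <;> linarith
  rw [gridRound_apply, h2]; simp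

/-! ### Translations in `L¹` -/

/-- Translations form a continuous family of measure-preserving maps, and composition with such a
family is continuous in `L¹`. -/
theorem tendsto_lintegral_translate {d : ℕ} {g : Space d → ℝ} (hg : Integrable g)
    {y : ℕ → Space d} {y₀ : Space d} (hy : Tendsto y atTop (𝓝 y₀)) :
    Tendsto (fun m => ∫⁻ x, ‖g (x + y m) - g (x + y₀)‖ₑ) atTop (𝓝 0) := by
  have hg1 : MemLp g 1 := memLp_one_iff_integrable.2 hg
  let T : C(Space d, C(Space d, Space d)) :=
    (ContinuousMap.mk (fun a : Space d × Space d => a.2 + a.1) (by fun_prop)).curry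
  have hT : ∀ y, MeasurePreserving (T y) (volume : Measure (Space d)) volume :=
    fun y => measurePreserving_add_right volume y
  have h1 : Tendsto (fun m => Lp.compMeasurePreserving (T (y m)) (hT _) (hg1.toLp g)) atTop
      (𝓝 (Lp.compMeasurePreserving (T y₀) (hT _) (hg1.toLp g))) :=
    tendsto_const_nhds.compMeasurePreservingLp ((T.continuous.tendsto y₀).comp hy) _ _
      ENNReal.one_ne_top
  rw [tendsto_iff_edist_tendsto_0] at h1
  refine h1.congr fun m => ?_
  rw [Lp.toLp_compMeasurePreserving, Lp.toLp_compMeasurePreserving, Lp.edist_toLp_toLp,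
    eLpNorm_one_eq_lintegral_enorm]
  rfl

/-- Translation invariance removes the shift from `v m - g`; what remains is continuity of
translations for the fixed function `g`. -/
theorem tendsto_lintegral_translate_sub {d : ℕ} {v : ℕ → Space d → ℝ} {g : Space d → ℝ}
    (hv : ∀ m, Measurable (v m)) (hg : Integrable g)
    (hvg : Tendsto (fun m => ∫⁻ x, ‖v m x - g x‖ₑ) atTop (𝓝 0))
    {y : ℕ → Space d} {y₀ : Space d} (hy : Tendsto y atTop (𝓝 y₀)) :
    Tendsto (fun m => ∫⁻ x, ‖v m (x + y m) - g (x + y₀)‖ₑ) atTop (𝓝 0) := by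
  have h1 := hvg.add (tendsto_lintegral_translate hg hy)
  rw [add_zero] at h1
  refine tendsto_of_tendsto_of_tendsto_of_le_of_le tendsto_const_nhds h1 (fun _ => zero_le) ?_
  intro m
  have h2 : ∫⁻ x, ‖v m x - g x‖ₑ = ∫⁻ x, ‖v m (x + y m) - g (x + y m)‖ₑ :=
    (lintegral_add_right_eq_self (fun x => ‖v m x - g x‖ₑ) (y m)).symm
  simp only [h2]
  have hm : AEMeasurable fun x => ‖v m (x + y m) - g (x + y m)‖ₑ := by
    have hq : AEMeasurable (fun x => g (x + y m)) :=
      hg.1.aemeasurable.comp_quasiMeasurePreserving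
        (measurePreserving_add_right volume (y m)).quasiMeasurePreserving
    exact (((hv m).comp (measurable_add_const _)).aemeasurable.sub hq).enorm
  rw [← lintegral_add_left' hm]
  refine lintegral_mono fun x => ?_
  have : v m (x + y m) - g (x + y₀) = (v m (x + y m) - g (x + y m)) + (g (x + y m) - g (x + y₀)) := by
    ring
  rw [this]
  exact enorm_add_le _ _

/-! ### Second differences -/

/-- The symmetric second difference of `φ` at `p` in the direction `w`. -/
def secondDiff {E : Type*} [AddCommGroup E] (φ : E → ℝ) (p w : E) : ℝ :=
  φ (p + w) + φ (p - w) - 2 * φ p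

/-- The map `y ↦ φ (p + y) + φ (p - y)` has derivative `Dφ (p + y) - Dφ (p - y)`, of size at most `2
C ‖y‖` since `Dφ` is Lipschitz; the mean value inequality on the ball of radius `‖w‖` concludes. -/
theorem exists_secondDiff_le {E : Type*} [NormedAddCommGroup E] [NormedSpace ℝ E] {φ : E → ℝ}
    (hφ : ContDiff ℝ ∞ φ) (hc : HasCompactSupport φ) :
    ∃ C, 0 ≤ C ∧ ∀ p w, |secondDiff φ p w| ≤ C * ‖w‖ ^ 2 := by
  obtain ⟨C, hC⟩ := ContDiff.lipschitzWith_of_hasCompactSupport (hc.fderiv ℝ)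
    (hφ.fderiv_right (m := ∞) (by simp)) (by simp)
  refine ⟨2 * C, by positivity, fun p w => ?_⟩
  have hd : Differentiable ℝ φ := hφ.differentiable (by simp)
  have hder : ∀ x ∈ Metric.closedBall (0 : E) ‖w‖,
      HasFDerivWithinAt (fun y => φ (p + y) + φ (p - y)) (fderiv ℝ φ (p + x) - fderiv ℝ φ (p - x))
        (Metric.closedBall 0 ‖w‖) x := by
    intro x _
    have h1 : HasFDerivAt (fun y => φ (p + y)) (fderiv ℝ φ (p + x)) x := by
      simpa using! (hd (p + x)).hasFDerivAt.comp x ((hasFDerivAt_id x).const_add p)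
    have h2 : HasFDerivAt (fun y => φ (p - y)) (-fderiv ℝ φ (p - x)) x := by
      simpa using! (hd (p - x)).hasFDerivAt.comp x ((hasFDerivAt_id x).const_sub p)
    exact (by simpa [sub_eq_add_neg] using! h1.add h2 : HasFDerivAt _ _ x).hasFDerivWithinAt
  have hb : ∀ x ∈ Metric.closedBall (0 : E) ‖w‖,
      ‖fderiv ℝ φ (p + x) - fderiv ℝ φ (p - x)‖ ≤ 2 * C * ‖w‖ := by
    intro x hx
    rw [mem_closedBall_zero_iff] at hx
    have h3 := hC.dist_le_mul (p + x) (p - x)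
    rw [dist_eq_norm, dist_eq_norm] at h3
    have h4 : (p + x) - (p - x) = x + x := by abel
    rw [h4] at h3
    refine h3.trans ?_
    have h5 : ‖x + x‖ ≤ 2 * ‖w‖ := (norm_add_le x x).trans (by linarith)
    nlinarith [C.2, mul_le_mul_of_nonneg_left h5 C.2]
  have h6 := (convex_closedBall (0 : E) ‖w‖).norm_image_sub_le_of_norm_hasFDerivWithin_le hder hb
    (Metric.mem_closedBall_self (norm_nonneg w)) (mem_closedBall_zero_iff.2 le_rfl)
  simp only [add_zero, sub_zero] at h6
  rw [Real.norm_eq_abs] at h6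
  have : secondDiff φ p w = φ (p + w) + φ (p - w) - (φ p + φ p) := by unfold secondDiff; ring
  rw [this]
  linarith [h6]

theorem secondDiff_zero {E : Type*} [AddCommGroup E] (φ : E → ℝ) (p : E) :
    secondDiff φ p 0 = 0 := by
  simp [secondDiff]; ring

theorem secondDiff_eq_zero {E : Type*} [NormedAddCommGroup E] {φ : E → ℝ} {p w : E} {R : ℝ}
    (hw : ‖w‖ ≤ R) (hp : p ∉ Metric.cthickening R (tsupport φ)) : secondDiff φ p w = 0 := by
  have key : ∀ q, dist p q ≤ R → φ q = 0 := fun q hq =>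
    image_eq_zero_of_notMem_tsupport fun h => hp (Metric.mem_cthickening_of_dist_le p q R _ h hq)
  rw [secondDiff, key (p + w) (by simpa using hw), key (p - w) (by simpa using hw),
    key p (by simpa using (norm_nonneg w).trans hw)]
  simp

/-! ### The inner operator -/

/-- Space-time. -/
abbrev SpaceTime (d : ℕ) : Type := Space d × ℝ

theorem norm_mk_zero {d : ℕ} (z : Space d) : ‖((z, 0) : SpaceTime d)‖ = ‖z‖ := by
  simp [Prod.norm_def]

/-- The operator `g_r`, in terms of second differences. -/
def innerOp {d : ℕ} (c lam r : ℝ) (φ : SpaceTime d → ℝ) (p : SpaceTime d) : ℝ :=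
  c / 2 * ∫ z in {z : Space d | ‖z‖ ≤ r}, secondDiff φ p (z, 0) * kernel d lam z

/-- The quadrature approximation of `g_r`. -/
def discInner {d : ℕ} (c lam r h : ℝ) (φ : SpaceTime d → ℝ) (p : SpaceTime d) : ℝ :=
  c * ∫ z in {z : Space d | ‖z‖ ≤ r}, kernel d lam z * (φ (p - (gridRound h z, 0)) - φ p)

theorem measurableSet_norm_le {d : ℕ} (r : ℝ) : MeasurableSet {z : Space d | ‖z‖ ≤ r} :=
  measurableSet_le (by fun_prop) (by fun_prop)

theorem measurableSet_norm_gt {d : ℕ} (r : ℝ) : MeasurableSet {z : Space d | r < ‖z‖} :=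
  measurableSet_lt (by fun_prop) (by fun_prop)

/-- Vanishing on the central cell removes the ball of radius `h / 2`, outside which the kernel is
integrable. -/
theorem integrable_kernel_mul {d : ℕ} {lam h B : ℝ} (hlam : 0 < lam) (hh : 0 < h)
    {g : Space d → ℝ} (hg : AEStronglyMeasurable g) (hB : ∀ z, |g z| ≤ B)
    (h0 : ∀ z, gridRound h z = 0 → g z = 0) : Integrable fun z => kernel d lam z * g z := by
  have h1 : Integrable ({z : Space d | h / 2 ≤ ‖z‖}.indicator (kernel d lam)) :=
    (integrable_indicator_iff (measurableSet_le (by fun_prop) (by fun_prop))).2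
      (integrableOn_kernel hlam (by positivity))
  refine (h1.mul_const B).mono' (by fun_prop) (ae_of_all _ fun z => ?_)
  rw [norm_mul, Real.norm_of_nonneg (kernel_nonneg z), Real.norm_eq_abs]
  by_cases hz : gridRound h z = 0
  · rw [h0 z hz, abs_zero, mul_zero]
    exact mul_nonneg (indicator_nonneg (fun z _ => kernel_nonneg z) z) ((abs_nonneg _).trans (hB z))
  · rw [indicator_of_mem (s := {z : Space d | h / 2 ≤ ‖z‖}) (mem_ofPred.2 (half_le_norm_of_gridRound_ne_zero hh hz))]
    exact mul_le_mul_of_nonneg_left (hB z) (kernel_nonneg z)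

theorem integral_neg_ball {d : ℕ} (r : ℝ) (g : Space d → ℝ) :
    ∫ z in {z : Space d | ‖z‖ ≤ r}, g (-z) = ∫ z in {z : Space d | ‖z‖ ≤ r}, g z := by
  rw [← integral_indicator (measurableSet_norm_le r), ← integral_indicator (measurableSet_norm_le r),
    ← integral_neg_eq_self]
  congr 1
  ext z
  by_cases hz : ‖z‖ ≤ r
  · rw [indicator_of_mem (by simpa using hz), indicator_of_mem (by simpa using hz)]; simp
  · rw [indicator_of_notMem (by simpa using hz), indicator_of_notMem (by simpa using hz)]

/-- Average over `z` and `-z`: the ball and the kernel are even, and the rounding is odd almost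
everywhere. Only in this form is there a bound uniform in `h`. -/
theorem discInner_eq {d : ℕ} {c lam r h : ℝ} (hlam : 0 < lam) (hh : 0 < h) {φ : SpaceTime d → ℝ}
    (hφ : Continuous φ) (hc : HasCompactSupport φ) (p : SpaceTime d) :
    discInner c lam r h φ p = c / 2 *
      ∫ z in {z : Space d | ‖z‖ ≤ r}, secondDiff φ p (gridRound h z, 0) * kernel d lam z := by
  obtain ⟨B, hB⟩ := hc.exists_bound_of_continuous hφ
  have hb : ∀ q, |φ q - φ p| ≤ B + B := fun q =>
    (abs_sub _ _).trans (add_le_add (hB q) (hB p))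
  have i1 : Integrable fun z : Space d => kernel d lam z * (φ (p - (gridRound h z, 0)) - φ p) :=
    integrable_kernel_mul hlam hh
      (Measurable.aestronglyMeasurable (by have := hφ.measurable; fun_prop)) (fun _ => hb _)
      (fun z hz => by rw [hz, Prod.mk_zero_zero]; simp)
  have i2 : Integrable fun z : Space d => kernel d lam z * (φ (p + (gridRound h z, 0)) - φ p) :=
    integrable_kernel_mul hlam hh
      (Measurable.aestronglyMeasurable (by have := hφ.measurable; fun_prop)) (fun _ => hb _)
      (fun z hz => by rw [hz, Prod.mk_zero_zero]; simp)
  have e1 : ∫ z in {z : Space d | ‖z‖ ≤ r}, kernel d lam z * (φ (p + (gridRound h z, 0)) - φ p)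
      = ∫ z in {z : Space d | ‖z‖ ≤ r}, kernel d lam z * (φ (p - (gridRound h z, 0)) - φ p) := by
    rw [← integral_neg_ball]
    refine integral_congr_ae (ae_restrict_of_ae ?_)
    filter_upwards [gridRound_neg_ae hh] with z hz
    have : ((-gridRound h z, 0) : SpaceTime d) = -(gridRound h z, 0) := by simp
    rw [kernel_neg, hz, this, sub_eq_add_neg p]
  have e2 := integral_add i2.integrableOn i1.integrableOn (μ := volume.restrict {z : Space d | ‖z‖ ≤ r})
  rw [e1] at e2
  rw [discInner]
  have e3 : ∫ z in {z : Space d | ‖z‖ ≤ r}, secondDiff φ p (gridRound h z, 0) * kernel d lam z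
      = ∫ z in {z : Space d | ‖z‖ ≤ r}, (kernel d lam z * (φ (p + (gridRound h z, 0)) - φ p)
        + kernel d lam z * (φ (p - (gridRound h z, 0)) - φ p)) := by
    congr 1; ext z; unfold secondDiff; ring
  rw [e3, e2]; ring

/-- On a symmetric annulus the first difference can be averaged over `±z`. The resulting second
difference is `O(|z|²)`, so the principal value is an absolutely convergent integral, reached by
dominated convergence as `b ↓ 0`. -/
theorem gInner_eq {d : ℕ} (hd : 1 ≤ d) {c lam r : ℝ} (hlam : 0 < lam) (hlam2 : lam < 2)
    {φ : SpaceTime d → ℝ} (hφ : ContDiff ℝ ∞ φ) (hc : HasCompactSupport φ) (p : SpaceTime d) :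
    gInner c lam r (fun y => φ (y, p.2)) p.1 = innerOp c lam r φ p := by
  have := nontrivial_space hd
  have hm := hφ.continuous.measurable
  obtain ⟨B, hB⟩ := hc.exists_bound_of_continuous hφ.continuous
  obtain ⟨C, hC0, hC⟩ := exists_secondDiff_le hφ hc
  have hsd : Measurable fun z : Space d => secondDiff φ p (z, 0) := by unfold secondDiff; fun_prop
  have hS : ∀ b, MeasurableSet {z : Space d | b < ‖z‖ ∧ ‖z‖ < r} := fun b =>
    (measurableSet_norm_gt b).inter (measurableSet_lt measurable_norm measurable_const)
  have hfst : ∀ z : Space d, φ (p.1 + z, p.2) = φ (p + (z, 0)) := fun z => by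
    congr 1; ext <;> simp
  have hmul : Integrable ({z : Space d | ‖z‖ ≤ r}.indicator
      fun z => C * (‖z‖ ^ 2 * kernel d lam z)) :=
    (integrable_indicator_iff (measurableSet_norm_le r)).2
      ((integrableOn_sq_mul_kernel hd hlam2 r).const_mul C)
  have h1 : ∀ b, 0 < b → ∫ z in {z : Space d | b < ‖z‖ ∧ ‖z‖ < r},
      (φ (p.1 + z, p.2) - φ (p.1, p.2)) * kernel d lam z = 1 / 2 *
        ∫ z, {z : Space d | b < ‖z‖ ∧ ‖z‖ < r}.indicator
          (fun z => secondDiff φ p (z, 0) * kernel d lam z) z := by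
    intro b hb
    have ik : IntegrableOn (kernel d lam) {z : Space d | b < ‖z‖ ∧ ‖z‖ < r} :=
      (integrableOn_kernel_gt hlam hb).mono_set fun z hz => hz.1
    have i1 : ∀ g : Space d → SpaceTime d, Measurable g → IntegrableOn
        (fun z => (φ (g z) - φ p) * kernel d lam z) {z : Space d | b < ‖z‖ ∧ ‖z‖ < r} := by
      intro g hg
      refine (ik.const_mul (B + B)).mono' (by fun_prop) (ae_of_all _ fun z => ?_)
      rw [norm_mul, Real.norm_of_nonneg (kernel_nonneg z)]
      exact mul_le_mul_of_nonneg_right ((norm_sub_le _ _).trans (add_le_add (hB _) (hB p)))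
        (kernel_nonneg z)
    have e1 : ∫ z in {z : Space d | b < ‖z‖ ∧ ‖z‖ < r}, (φ (p - (z, 0)) - φ p) * kernel d lam z =
        ∫ z in {z : Space d | b < ‖z‖ ∧ ‖z‖ < r}, (φ (p + (z, 0)) - φ p) * kernel d lam z := by
      rw [← integral_indicator (hS b), ← integral_indicator (hS b), ← integral_neg_eq_self]
      congr 1
      ext z
      have hn : ((-z, 0) : SpaceTime d) = -(z, 0) := by simp
      by_cases hz : b < ‖z‖ ∧ ‖z‖ < r
      · rw [indicator_of_mem (by simpa using hz), indicator_of_mem (by simpa using hz), kernel_neg,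
          hn, sub_neg_eq_add]
      · rw [indicator_of_notMem (by simpa using hz), indicator_of_notMem (by simpa using hz)]
    have e2 := integral_add (i1 (fun z => p + (z, 0)) (by fun_prop))
      (i1 (fun z => p - (z, 0)) (by fun_prop))
    rw [e1] at e2
    rw [integral_indicator (hS b)]
    have e3 : ∫ z in {z : Space d | b < ‖z‖ ∧ ‖z‖ < r}, secondDiff φ p (z, 0) * kernel d lam z =
        ∫ z in {z : Space d | b < ‖z‖ ∧ ‖z‖ < r}, ((φ (p + (z, 0)) - φ p) * kernel d lam z +
          (φ (p - (z, 0)) - φ p) * kernel d lam z) := by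
      congr 1; ext z; unfold secondDiff; ring
    rw [e3, e2]
    simp only [hfst]
    ring
  have h2 : Tendsto (fun b => ∫ z, {z : Space d | b < ‖z‖ ∧ ‖z‖ < r}.indicator
          (fun z => secondDiff φ p (z, 0) * kernel d lam z) z) (𝓝[>] (0 : ℝ))
      (𝓝 (∫ z, {z : Space d | ‖z‖ ≤ r}.indicator
          (fun z => secondDiff φ p (z, 0) * kernel d lam z) z)) := by
    refine tendsto_integral_filter_of_dominated_convergence _ (Eventually.of_forall fun b => ?_)
      (Eventually.of_forall fun b => ae_of_all _ fun z => ?_) hmul ?_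
    · exact (Measurable.aestronglyMeasurable (by fun_prop)).indicator (hS b)
    · by_cases hz : b < ‖z‖ ∧ ‖z‖ < r
      · rw [indicator_of_mem (by simpa using hz), indicator_of_mem (by simpa using hz.2.le),
          norm_mul, Real.norm_of_nonneg (kernel_nonneg z), ← mul_assoc]
        refine mul_le_mul_of_nonneg_right ?_ (kernel_nonneg z)
        simpa [norm_mk_zero] using hC p (z, 0)
      · rw [indicator_of_notMem (by simpa using hz), norm_zero]
        exact indicator_nonneg (fun z _ => by have := kernel_nonneg (lam := lam) z; positivity) z
    -- The definition uses `|z| < r` and `innerOp` uses `|z| ≤ r`; they differ by a null sphere.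
    · have hsph : ∀ᵐ z : Space d, z ∉ Metric.sphere (0 : Space d) r :=
        measure_eq_zero_iff_ae_notMem.1 (Measure.addHaar_sphere _ _ _)
      filter_upwards [hsph] with z hz
      refine tendsto_const_nhds.congr' ?_
      have hz' : ‖z‖ ≠ r := by simpa using hz
      by_cases h0 : z = 0
      · refine Eventually.of_forall fun b => ?_
        have : secondDiff φ p (z, 0) * kernel d lam z = 0 := by
          rw [h0, Prod.mk_zero_zero, secondDiff_zero, zero_mul]
        simp only [indicator, this, ite_self]
      · have hpos : 0 < ‖z‖ := norm_pos_iff.2 h0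
        filter_upwards [Ioo_mem_nhdsGT hpos] with b hb
        by_cases hzr : ‖z‖ ≤ r
        · rw [indicator_of_mem (by simpa using hzr), indicator_of_mem]
          exact ⟨hb.2, lt_of_le_of_ne hzr hz'⟩
        · rw [indicator_of_notMem (by simpa using hzr), indicator_of_notMem]
          exact fun h => hzr h.2.le
  have h3 := (h2.const_mul (1 / 2)).congr' (f₂ := fun b =>
      ∫ z in {z : Space d | b < ‖z‖ ∧ ‖z‖ < r}, (φ (p.1 + z, p.2) - φ (p.1, p.2)) * kernel d lam z)
    (by filter_upwards [self_mem_nhdsWithin] with b hb using (h1 b hb).symm)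
  rw [gInner, h3.limUnder_eq, innerOp, integral_indicator (measurableSet_norm_le r)]
  ring

/-- Dominated convergence under `4 C |z|² kernel(z)`, where the `4` comes from `|gridRound h z| ≤ 2
|z|`. -/
theorem tendsto_discInner {d : ℕ} (hd : 1 ≤ d) {c lam r : ℝ} (hlam : 0 < lam) (hlam2 : lam < 2)
    {φ : SpaceTime d → ℝ} (hφ : ContDiff ℝ ∞ φ) (hc : HasCompactSupport φ)
    {h : ℕ → ℝ} (hh : ∀ m, 0 < h m) (hh0 : Tendsto h atTop (𝓝 0)) (p : SpaceTime d) :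
    Tendsto (fun m => discInner c lam r (h m) φ p) atTop (𝓝 (innerOp c lam r φ p)) := by
  simp_rw [discInner_eq hlam (hh _) hφ.continuous hc, innerOp]
  refine Tendsto.const_mul _ ?_
  obtain ⟨C, hC0, hC⟩ := exists_secondDiff_le hφ hc
  have hm := hφ.continuous.measurable
  refine tendsto_integral_of_dominated_convergence (fun z => 4 * C * (‖z‖ ^ 2 * kernel d lam z))
    (fun m => ?_) ((integrableOn_sq_mul_kernel hd hlam2 r).const_mul _)
    (fun m => ae_of_all _ fun z => ?_) (ae_of_all _ fun z => ?_)
  · unfold secondDiff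
    exact Measurable.aestronglyMeasurable (by fun_prop)
  · rw [norm_mul, Real.norm_of_nonneg (kernel_nonneg z), ← mul_assoc]
    refine mul_le_mul_of_nonneg_right ?_ (kernel_nonneg z)
    refine (hC p _).trans ?_
    rw [norm_mk_zero]
    have := norm_gridRound_le (hh m) z
    have h2 : ‖gridRound (h m) z‖ ^ 2 ≤ (2 * ‖z‖) ^ 2 := by gcongr
    nlinarith
  · refine Tendsto.mul_const _ ?_
    have hcont : Continuous fun w : Space d => secondDiff φ p (w, 0) := by
      unfold secondDiff
      have := hφ.continuous
      fun_prop
    exact (hcont.tendsto z).comp (tendsto_gridRound hh hh0 z)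

/-- The majorant above does not depend on `h`, and rounded shifts with `|z| ≤ r` have length at most
`2 r`, which fixes the thickening. -/
theorem exists_discInner_le {d : ℕ} (hd : 1 ≤ d) {c lam r : ℝ} (hlam : 0 < lam)
    (hlam2 : lam < 2) {φ : SpaceTime d → ℝ} (hφ : ContDiff ℝ ∞ φ) (hc : HasCompactSupport φ) :
    ∃ C, ∀ h, 0 < h → ∀ p, |discInner c lam r h φ p| ≤
      (Metric.cthickening (2 * r) (tsupport φ)).indicator (fun _ => C) p := by
  obtain ⟨C, hC0, hC⟩ := exists_secondDiff_le hφ hc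
  have hint := (integrableOn_sq_mul_kernel (lam := lam) hd hlam2 r).const_mul (4 * C)
  refine ⟨|c / 2| * ∫ z in {z : Space d | ‖z‖ ≤ r}, 4 * C * (‖z‖ ^ 2 * kernel d lam z),
    fun h hh p => ?_⟩
  rw [discInner_eq hlam hh hφ.continuous hc]
  by_cases hp : p ∈ Metric.cthickening (2 * r) (tsupport φ)
  · rw [indicator_of_mem hp, abs_mul]
    refine mul_le_mul_of_nonneg_left ?_ (abs_nonneg _)
    rw [← Real.norm_eq_abs]
    refine norm_integral_le_of_norm_le hint (ae_of_all _ fun z => ?_)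
    rw [norm_mul, Real.norm_of_nonneg (kernel_nonneg z), ← mul_assoc]
    refine mul_le_mul_of_nonneg_right ?_ (kernel_nonneg z)
    refine (hC p _).trans ?_
    rw [norm_mk_zero]
    have := norm_gridRound_le hh z
    have h2 : ‖gridRound h z‖ ^ 2 ≤ (2 * ‖z‖) ^ 2 := by gcongr
    nlinarith
  · rw [indicator_of_notMem hp, setIntegral_eq_zero_of_forall_eq_zero]
    · simp
    · intro z hz
      have hz : ‖z‖ ≤ r := hz
      rw [secondDiff_eq_zero (R := 2 * r) _ hp, zero_mul]
      rw [norm_mk_zero]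
      exact (norm_gridRound_le hh z).trans (by linarith)

theorem exists_innerOp_le {d : ℕ} (hd : 1 ≤ d) {c lam r : ℝ} (hlam : 0 < lam)
    (hlam2 : lam < 2) {φ : SpaceTime d → ℝ} (hφ : ContDiff ℝ ∞ φ) (hc : HasCompactSupport φ) :
    ∃ C, ∀ p, |innerOp c lam r φ p| ≤
      (Metric.cthickening (2 * r) (tsupport φ)).indicator (fun _ => C) p := by
  obtain ⟨C, hC⟩ := exists_discInner_le (c := c) (r := r) hd hlam hlam2 hφ hc
  refine ⟨C, fun p => ?_⟩
  have h := tendsto_discInner (c := c) (r := r) hd hlam hlam2 hφ hc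
    (h := fun m : ℕ => 1 / ((m : ℝ) + 1)) (fun m => by positivity)
    tendsto_one_div_add_atTop_nhds_zero_nat p
  exact le_of_tendsto h.abs (Eventually.of_forall fun m => hC _ (by positivity) p)

theorem measurable_innerOp {d : ℕ} {c lam r : ℝ} {φ : SpaceTime d → ℝ} (hφ : Continuous φ) :
    Measurable (innerOp c lam r φ) := by
  have hm := hφ.measurable
  have h1 : StronglyMeasurable fun q : SpaceTime d × Space d =>
      secondDiff φ q.1 (q.2, 0) * kernel d lam q.2 := by
    unfold secondDiff
    exact Measurable.stronglyMeasurable (by fun_prop)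
  exact (h1.integral_prod_right (ν := volume.restrict {z : Space d | ‖z‖ ≤ r})).measurable.const_mul _

theorem measurable_discInner {d : ℕ} {c lam r h : ℝ} {φ : SpaceTime d → ℝ} (hφ : Continuous φ) :
    Measurable (discInner c lam r h φ) := by
  have hm := hφ.measurable
  have h1 : StronglyMeasurable fun q : SpaceTime d × Space d =>
      kernel d lam q.2 * (φ (q.1 - (gridRound h q.2, 0)) - φ q.1) :=
    Measurable.stronglyMeasurable (by fun_prop)
  exact (h1.integral_prod_right (ν := volume.restrict {z : Space d | ‖z‖ ≤ r})).measurable.const_mul _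

/-! ### The cell entropy inequality -/

/-- The numerical entropy flux. -/
def numEntropyFlux (F : ℝ → ℝ → ℝ) (k a b : ℝ) : ℝ :=
  F (max a k) (max b k) - F (min a k) (min b k)

/-- The discrete divergence of the numerical flux `F` evaluated at `w`. -/
def fluxDiff {d : ℕ} (F : Fin d → ℝ → ℝ → ℝ) (h : ℝ) (w : Space d → ℝ) (x : Space d) : ℝ :=
  ∑ l, (F l (w x) (w (x + EuclideanSpace.single l h))
    - F l (w (x - EuclideanSpace.single l h)) (w x)) / h

/-- The part over `S` of the quadrature of the nonlocal operator. -/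
def quadOn {d : ℕ} (c lam h : ℝ) (S : Set (Space d)) (g : Space d → ℝ) (x : Space d) : ℝ :=
  c * ∫ z in S, kernel d lam z * (g (x + gridRound h z) - g x)

/-- Only `|z| ≥ h / 2` contributes to the mass, so scaling the kernel bounds it by `2 ^ λ / h ^ λ`
times the integral over `|z| > 1`: this is where the CFL constant comes from. The set `S` is
arbitrary because restriction only lowers the mass. -/
theorem CFL.mass_le {d : ℕ} (hd : 1 ≤ d) {c lam : ℝ} (hc : 0 < c) (hlam : 0 < lam)
    {LF LA : ℝ≥0} {h τ : ℝ} (hh : 0 < h) (hτ : 0 < τ) (hcfl : CFL d c lam LF LA h τ)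
    (S : Set (Space d)) :
    2 * d * LF * (τ / h) + τ * (c * (LA *
      ∫ z in S, {z : Space d | gridRound h z ≠ 0}.indicator (kernel d lam) z)) ≤ 1 := by
  have := nontrivial_space hd
  have hmeas : MeasurableSet {z : Space d | gridRound h z ≠ 0} :=
    (measurableSet_eq_fun (measurable_gridRound h) measurable_const).compl
  have hsub : {z : Space d | gridRound h z ≠ 0} ⊆ {z : Space d | h / 2 ≤ ‖z‖} :=
    fun z hz => mem_ofPred.2 (half_le_norm_of_gridRound_ne_zero hh hz)
  have hint : IntegrableOn (kernel d lam) {z : Space d | h / 2 ≤ ‖z‖} :=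
    integrableOn_kernel hlam (by positivity)
  have h1 : ∫ z in S, {z : Space d | gridRound h z ≠ 0}.indicator (kernel d lam) z ≤
      (h / 2) ^ (-lam) * ∫ z in {z : Space d | 1 < ‖z‖}, kernel d lam z := by
    rw [← setIntegral_kernel_gt (by positivity : 0 < h / 2)]
    calc _ ≤ ∫ z, {z : Space d | gridRound h z ≠ 0}.indicator (kernel d lam) z :=
          setIntegral_le_integral ((integrable_indicator_iff hmeas).2 (hint.mono_set hsub))
            (ae_of_all _ fun z => indicator_nonneg (fun z _ => kernel_nonneg z) z)
      _ = ∫ z in {z : Space d | gridRound h z ≠ 0}, kernel d lam z := integral_indicator hmeas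
      _ ≤ ∫ z in {z : Space d | h / 2 ≤ ‖z‖}, kernel d lam z :=
          setIntegral_mono_set hint (ae_of_all _ fun z => kernel_nonneg z)
            (Eventually.of_forall hsub)
      _ = ∫ z in {z : Space d | h / 2 < ‖z‖}, kernel d lam z := by
          refine setIntegral_congr_set ?_
          have hsph : ∀ᵐ z : Space d, z ∉ Metric.sphere (0 : Space d) (h / 2) :=
            measure_eq_zero_iff_ae_notMem.1 (Measure.addHaar_sphere _ _ _)
          filter_upwards [hsph] with z hz
          have hz' : ‖z‖ ≠ h / 2 := by simpa using hz
          exact propext ⟨fun h1 => lt_of_le_of_ne (mem_ofPred.1 h1) (Ne.symm hz'),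
            fun h1 => le_of_lt (mem_ofPred.1 h1)⟩
  refine le_trans ?_ hcfl
  have h2 : (h / 2) ^ (-lam) = 2 ^ lam / h ^ lam := by
    rw [Real.rpow_neg (by positivity), Real.div_rpow hh.le (by norm_num), inv_div]
  rw [h2] at h1
  have h3 := mul_le_mul_of_nonneg_left h1 (by positivity : 0 ≤ τ * (c * LA))
  have h4 : τ * (c * LA) * (2 ^ lam / h ^ lam * ∫ z in {z : Space d | 1 < ‖z‖}, kernel d lam z) =
      c * 2 ^ lam * LA * (∫ z in {z : Space d | 1 < ‖z‖}, kernel d lam z) * (τ / h ^ lam) := by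
    ring
  rw [h4] at h3
  linarith

theorem integrable_kernel_mul_sub {d : ℕ} {lam h B : ℝ} (hlam : 0 < lam) (hh : 0 < h)
    {g : Space d → ℝ} (hg : Measurable g) (hB : ∀ x, |g x| ≤ B) (x : Space d) :
    Integrable fun z => kernel d lam z * (g (x + gridRound h z) - g x) :=
  integrable_kernel_mul (B := B + B) hlam hh (Measurable.aestronglyMeasurable (by fun_prop))
    (fun _ => (abs_sub _ _).trans (add_le_add (hB _) (hB _))) (fun z hz => by rw [hz]; simp)

/-- Monotonicity disposes of the two neighbours `a` and `c`; the central value `b` enters two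
fluxes, each at Lipschitz cost `LF`. -/
theorem IsNumericalFlux.sub_le {LF : ℝ≥0} {f : ℝ → ℝ} {F : ℝ → ℝ → ℝ} (hF : IsNumericalFlux LF f F)
    {a b c a' b' c' : ℝ} (ha : a ≤ a') (hb : b ≤ b') (hc : c ≤ c') :
    (F b' c' - F a' b') - (F b c - F a b) ≤ 2 * LF * (b' - b) := by
  have h1 := hF.antitone_snd b hc
  have h2 := hF.monotone_fst b' ha
  have h3 := (abs_le.1 (hF.lipschitz b' c' b c')).2
  have h4 := (abs_le.1 (hF.lipschitz a b a b')).2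
  simp only [sub_self, abs_zero, add_zero, zero_add] at h1 h2 h3 h4
  rw [abs_of_nonneg (by linarith)] at h3
  rw [abs_of_nonpos (by linarith)] at h4
  linarith

theorem abs_le_of_lipschitz {A : ℝ → ℝ} {LA : ℝ≥0} (hA : LipschitzWith LA A) {a M : ℝ}
    (ha : |a| ≤ M) : |A a| ≤ |A 0| + LA * M := by
  have h1 := hA.dist_le_mul a 0
  rw [Real.dist_eq, Real.dist_eq, sub_zero] at h1
  have h2 := abs_sub_abs_le_abs_sub (A a) (A 0)
  have h3 := mul_le_mul_of_nonneg_left ha LA.2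
  simp only [NNReal.val_eq_coe] at h3
  linarith

/-- One step of the scheme, with the quadrature restricted to `S`, is monotone. -/
theorem step_mono {d : ℕ} (hd : 1 ≤ d) {c lam : ℝ} (hc : 0 < c) (hlam : 0 < lam)
    {f : ℝ → Space d} {A : ℝ → ℝ} {LA : ℝ≥0} (hA : LipschitzWith LA A) (hAmono : Monotone A)
    {F : Fin d → ℝ → ℝ → ℝ} {LF : ℝ≥0} (hF : ∀ l, IsNumericalFlux LF (fun v => f v l) (F l))
    {h τ : ℝ} (hh : 0 < h) (hτ : 0 < τ) (hcfl : CFL d c lam LF LA h τ) (S : Set (Space d))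
    {w₁ w₂ : Space d → ℝ} (hm₁ : Measurable w₁) (hm₂ : Measurable w₂) {M : ℝ}
    (hb₁ : ∀ x, |w₁ x| ≤ M) (hb₂ : ∀ x, |w₂ x| ≤ M) (hle : ∀ x, w₁ x ≤ w₂ x) (x : Space d) :
    w₁ x - τ * fluxDiff F h w₁ x + τ * quadOn c lam h S (fun y => A (w₁ y)) x ≤
      w₂ x - τ * fluxDiff F h w₂ x + τ * quadOn c lam h S (fun y => A (w₂ y)) x := by
  have hAm : Measurable A := hA.continuous.measurable
  have hmeas : MeasurableSet {z : Space d | gridRound h z ≠ 0} :=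
    (measurableSet_eq_fun (measurable_gridRound h) measurable_const).compl
  have iK : Integrable ({z : Space d | gridRound h z ≠ 0}.indicator (kernel d lam)) :=
    (integrable_indicator_iff hmeas).2 ((integrableOn_kernel hlam
      (by positivity : 0 < h / 2)).mono_set
        fun z hz => mem_ofPred.2 (half_le_norm_of_gridRound_ne_zero hh hz))
  have i1 := integrable_kernel_mul_sub hlam hh (hAm.comp hm₁) (fun y => abs_le_of_lipschitz hA (hb₁ y)) x
  have i2 := integrable_kernel_mul_sub hlam hh (hAm.comp hm₂) (fun y => abs_le_of_lipschitz hA (hb₂ y)) x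
  simp only [Function.comp_apply] at i1 i2
  have hδ : 0 ≤ w₂ x - w₁ x := sub_nonneg.2 (hle x)
  have hAx : A (w₂ x) - A (w₁ x) ≤ LA * (w₂ x - w₁ x) := by
    have h1 := hA.dist_le_mul (w₂ x) (w₁ x)
    rw [Real.dist_eq, Real.dist_eq, abs_of_nonneg hδ] at h1
    exact (le_abs_self _).trans h1
  -- Larger neighbour values raise the quadrature, so only the growth of the central value can lower
  -- it, at a rate controlled by the kernel mass off the central cell.
  have hquad : quadOn c lam h S (fun y => A (w₁ y)) x - c * (LA *
      (∫ z in S, {z : Space d | gridRound h z ≠ 0}.indicator (kernel d lam) z)) * (w₂ x - w₁ x) ≤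
      quadOn c lam h S (fun y => A (w₂ y)) x := by
    have e1 : quadOn c lam h S (fun y => A (w₁ y)) x - c * (LA *
      (∫ z in S, {z : Space d | gridRound h z ≠ 0}.indicator (kernel d lam) z)) * (w₂ x - w₁ x) =
      c * ∫ z in S, (kernel d lam z * (A (w₁ (x + gridRound h z)) - A (w₁ x)) -
        LA * (w₂ x - w₁ x) * {z : Space d | gridRound h z ≠ 0}.indicator (kernel d lam) z) := by
      rw [integral_sub i1.integrableOn (iK.integrableOn.const_mul _), integral_const_mul, quadOn]
      ring
    rw [e1, quadOn]
    refine mul_le_mul_of_nonneg_left (integral_mono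
      (i1.integrableOn.sub (iK.integrableOn.const_mul _)) i2.integrableOn fun z => ?_) hc.le
    by_cases hz : gridRound h z = 0
    · simp [hz, indicator]
    · have hk := kernel_nonneg (lam := lam) z
      have h1 := hAmono (hle (x + gridRound h z))
      simp only [indicator, mem_ofPred_eq, hz, ne_eq, not_false_eq_true, if_true]
      nlinarith
  have hflux : fluxDiff F h w₂ x - fluxDiff F h w₁ x ≤ 2 * d * LF * (w₂ x - w₁ x) / h := by
    rw [fluxDiff, fluxDiff, ← Finset.sum_sub_distrib]
    have : ∀ l ∈ Finset.univ, (F l (w₂ x) (w₂ (x + EuclideanSpace.single l h))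
          - F l (w₂ (x - EuclideanSpace.single l h)) (w₂ x)) / h
        - (F l (w₁ x) (w₁ (x + EuclideanSpace.single l h))
          - F l (w₁ (x - EuclideanSpace.single l h)) (w₁ x)) / h ≤ 2 * LF * (w₂ x - w₁ x) / h := by
      intro l _
      rw [← sub_div]
      exact div_le_div_of_nonneg_right
        ((hF l).sub_le (hle _) (hle _) (hle _)) hh.le
    refine (Finset.sum_le_sum this).trans ?_
    rw [Finset.sum_const, Finset.card_univ, Fintype.card_fin, nsmul_eq_mul]
    apply le_of_eq; ring
  -- The losses from flux and quadrature together are at most `w₂ x - w₁ x`, which the leading term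
  -- supplies.
  have hmass := mul_le_mul_of_nonneg_right (hcfl.mass_le hd hc hlam hh hτ S) hδ
  have h1 := mul_le_mul_of_nonneg_left hflux hτ.le
  have h2 := mul_le_mul_of_nonneg_left hquad hτ.le
  have h3 : τ * (2 * d * LF * (w₂ x - w₁ x) / h) = 2 * d * LF * (τ / h) * (w₂ x - w₁ x) := by ring
  rw [h3] at h1
  linarith

/-- A monotone `A` commutes with `max` and `min`, which makes the nonlinear diffusion compatible
with the Kruzkov entropies. -/
theorem abs_comp_sub_eq {A : ℝ → ℝ} (hA : Monotone A) (a k : ℝ) :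
    |A a - A k| = A (max a k) - A (min a k) := by
  rcases le_total a k with h | h
  · rw [max_eq_right h, min_eq_left h, abs_of_nonpos (sub_nonpos.2 (hA h))]; ring
  · rw [max_eq_left h, min_eq_right h, abs_of_nonneg (sub_nonneg.2 (hA h))]

theorem sign_mul_le_abs (a b : ℝ) : Real.sign a * b ≤ |b| := by
  rcases Real.sign_apply_eq a with h | h | h <;> rw [h]
  · simpa using neg_le_abs b
  · simp
  · simpa using le_abs_self b

/-- Crandall–Majda argument for the step `H` with the quadrature over `|z| ≤ r` only, by comparison
with `max w k`, `min w k` and the constant `k`. The outer quadrature enters additively and is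
carried along with the sign of `w' - k`. -/
theorem cell_entropy_inequality {d : ℕ} (hd : 1 ≤ d) {c lam : ℝ} (hc : 0 < c) (hlam : 0 < lam)
    {f : ℝ → Space d} {A : ℝ → ℝ} {LA : ℝ≥0} (hA : LipschitzWith LA A) (hAmono : Monotone A)
    {F : Fin d → ℝ → ℝ → ℝ} {LF : ℝ≥0} (hF : ∀ l, IsNumericalFlux LF (fun v => f v l) (F l))
    {h τ : ℝ} (hh : 0 < h) (hτ : 0 < τ) (hcfl : CFL d c lam LF LA h τ)
    {w : Space d → ℝ} (hm : Measurable w) {M : ℝ} (hb : ∀ x, |w x| ≤ M) (k r : ℝ)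
    {x : Space d} {w' : ℝ}
    (hw' : w' = w x - τ * fluxDiff F h w x + τ * quadOn c lam h univ (fun y => A (w y)) x) :
    |w' - k| ≤ |w x - k| - τ * fluxDiff (fun l => numEntropyFlux (F l) k) h w x
      + τ * quadOn c lam h {z | ‖z‖ ≤ r} (fun y => |A (w y) - A k|) x
      + τ * (Real.sign (w' - k) * quadOn c lam h {z | r < ‖z‖} (fun y => A (w y)) x) := by
  have hAm : Measurable A := hA.continuous.measurable
  set S : Set (Space d) := {z | ‖z‖ ≤ r}
  set H : (Space d → ℝ) → ℝ := fun w => w x - τ * fluxDiff F h w x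
    + τ * quadOn c lam h S (fun y => A (w y)) x with hH
  have hmax : ∀ y, |max (w y) k| ≤ max M |k| := fun y =>
    (abs_max_le_max_abs_abs).trans (max_le_max (hb y) le_rfl)
  have hmin : ∀ y, |min (w y) k| ≤ max M |k| := fun y =>
    (abs_min_le_max_abs_abs).trans (max_le_max (hb y) le_rfl)
  have hw : ∀ y, |w y| ≤ max M |k| := fun y => (hb y).trans (le_max_left _ _)
  have hk : ∀ _ : Space d, |k| ≤ max M |k| := fun _ => le_max_right _ _
  have mono := @step_mono d hd c lam hc hlam f A LA hA hAmono F LF hF h τ hh hτ hcfl S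
  have m1 : H w ≤ H (fun y => max (w y) k) :=
    mono hm (by fun_prop) hw hmax (fun y => le_max_left _ _) x
  have m2 : H (fun _ => k) ≤ H (fun y => max (w y) k) :=
    mono (by fun_prop) (by fun_prop) hk hmax (fun y => le_max_right _ _) x
  have m3 : H (fun y => min (w y) k) ≤ H w :=
    mono (by fun_prop) hm hmin hw (fun y => min_le_left _ _) x
  have m4 : H (fun y => min (w y) k) ≤ H (fun _ => k) :=
    mono (by fun_prop) (by fun_prop) hmin hk (fun y => min_le_right _ _) x
  -- All differences of a constant vanish, so `H` fixes `k`.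
  have hHk : H (fun _ => k) = k := by simp [hH, fluxDiff, quadOn]
  rw [hHk] at m2 m4
  have hHw : |H w - k| ≤ H (fun y => max (w y) k) - H (fun y => min (w y) k) := by
    rw [abs_le]; constructor <;> linarith
  have iq : ∀ {g : Space d → ℝ} {B : ℝ}, Measurable g → (∀ y, |g y| ≤ B) → Integrable
      fun z => kernel d lam z * (A (g (x + gridRound h z)) - A (g x)) := fun hg hB =>
    integrable_kernel_mul_sub hlam hh (hAm.comp hg) (fun y => abs_le_of_lipschitz hA (hB y)) x
  have hdiff : H (fun y => max (w y) k) - H (fun y => min (w y) k) =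
      |w x - k| - τ * fluxDiff (fun l => numEntropyFlux (F l) k) h w x
      + τ * quadOn c lam h S (fun y => |A (w y) - A k|) x := by
    have e1 : |w x - k| = max (w x) k - min (w x) k := by
      rw [max_sub_min_eq_abs, abs_sub_comm]
    have e2 : fluxDiff (fun l => numEntropyFlux (F l) k) h w x =
        fluxDiff F h (fun y => max (w y) k) x - fluxDiff F h (fun y => min (w y) k) x := by
      simp only [fluxDiff, numEntropyFlux]
      rw [← Finset.sum_sub_distrib]
      refine Finset.sum_congr rfl fun l _ => ?_
      ring
    have e3 : quadOn c lam h S (fun y => |A (w y) - A k|) x =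
        quadOn c lam h S (fun y => A (max (w y) k)) x
          - quadOn c lam h S (fun y => A (min (w y) k)) x := by
      simp only [quadOn]
      rw [← mul_sub, ← integral_sub (iq (by fun_prop) hmax).integrableOn
        (iq (by fun_prop) hmin).integrableOn]
      congr 2
      ext z
      rw [abs_comp_sub_eq hAmono, abs_comp_sub_eq hAmono]
      ring
    rw [e1, e2, e3]
    simp only [hH]
    ring
  have hsplit : quadOn c lam h univ (fun y => A (w y)) x =
      quadOn c lam h S (fun y => A (w y)) x
        + quadOn c lam h {z | r < ‖z‖} (fun y => A (w y)) x := by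
    simp only [quadOn, setIntegral_univ]
    have hcompl : Sᶜ = {z : Space d | r < ‖z‖} := by
      ext z; simp [S]
    rw [← integral_add_compl (measurableSet_norm_le r) (iq hm hb), hcompl, mul_add]
  have hw'' : w' - k = (H w - k) + τ * quadOn c lam h {z | r < ‖z‖} (fun y => A (w y)) x := by
    rw [hw', hsplit]; simp only [hH]; ring
  have habs : |w' - k| = Real.sign (w' - k) * (w' - k) := by
    rcases lt_trichotomy (w' - k) 0 with h | h | h
    · rw [Real.sign_of_neg h, abs_of_neg h]; ring
    · rw [h]; simp
    · rw [Real.sign_of_pos h, abs_of_pos h]; ring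
  -- Only the inner part is estimated by its absolute value; the outer part keeps the sign of the
  -- new value exactly.
  have hs := sign_mul_le_abs (w' - k) (H w - k)
  calc |w' - k| = Real.sign (w' - k) * (H w - k) + τ * (Real.sign (w' - k) *
        quadOn c lam h {z | r < ‖z‖} (fun y => A (w y)) x) := by
        rw [habs]; nth_rewrite 2 [hw'']; ring
    _ ≤ _ := by rw [← hdiff]; linarith

/-! ### The integrated discrete entropy inequality -/

theorem add_mk_zero {d : ℕ} (p : SpaceTime d) (z : Space d) : p + (z, 0) = (p.1 + z, p.2) := by
  ext <;> simp

theorem sub_mk_zero {d : ℕ} (p : SpaceTime d) (z : Space d) : p - (z, 0) = (p.1 - z, p.2) := by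
  ext <;> simp

theorem integrable_bdd_mul {E : Type*} [MeasurableSpace E] {μ : Measure E} {g ψ : E → ℝ} {B : ℝ}
    (hg : Measurable g) (hB : ∀ p, |g p| ≤ B) (hψ : Integrable ψ μ) :
    Integrable (fun p => g p * ψ p) μ :=
  hψ.bdd_mul hg.aestronglyMeasurable (ae_of_all _ hB)

/-- Supplies the translation invariance on space-time that replaces summation by parts. -/
instance instIsAddHaarMeasureSpaceTime {d : ℕ} :
    (volume : Measure (SpaceTime d)).IsAddHaarMeasure :=
  Measure.prod.instIsAddHaarMeasure _ _

theorem integral_add_four {E : Type*} [MeasurableSpace E] {μ : Measure E} {f₁ f₂ f₃ f₄ : E → ℝ}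
    (h₁ : Integrable f₁ μ) (h₂ : Integrable f₂ μ) (h₃ : Integrable f₃ μ) (h₄ : Integrable f₄ μ) :
    ∫ p, (f₁ p + f₂ p + f₃ p + f₄ p) ∂μ =
      ∫ p, f₁ p ∂μ + ∫ p, f₂ p ∂μ + ∫ p, f₃ p ∂μ + ∫ p, f₄ p ∂μ := by
  rw [← integral_add h₁ h₂, ← integral_add (by exact h₁.add h₂) h₃,
    ← integral_add (by exact (h₁.add h₂).add h₃) h₄]

theorem integral_translate_mul {d : ℕ} (g ψ : SpaceTime d → ℝ) (w : SpaceTime d) :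
    ∫ p, g (p + w) * ψ p = ∫ p, g p * ψ (p - w) := by
  rw [← integral_add_right_eq_self (fun p => g p * ψ (p - w)) w]
  simp

/-- Fubini, then for each `z` a translation by the rounded shift. This is where the shift on `φ` in
`discInner` acquires its minus sign. -/
theorem integral_mul_quadOn {d : ℕ} {c lam r h : ℝ} (hlam : 0 < lam) (hh : 0 < h)
    {φ a : SpaceTime d → ℝ} (hφ : Continuous φ) (hc : HasCompactSupport φ)
    (ha : Measurable a) {B : ℝ} (hB : ∀ p, |a p| ≤ B) :
    ∫ p, φ p * quadOn c lam h {z | ‖z‖ ≤ r} (fun y => a (y, p.2)) p.1 =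
      ∫ p, a p * discInner c lam r h φ p := by
  set S : Set (Space d) := {z | ‖z‖ ≤ r}
  have hφm := hφ.measurable
  have hφi : Integrable φ := hφ.integrable_of_hasCompactSupport hc
  have hmeas : MeasurableSet {z : Space d | gridRound h z ≠ 0} :=
    (measurableSet_eq_fun (measurable_gridRound h) measurable_const).compl
  have iK : IntegrableOn ({z : Space d | gridRound h z ≠ 0}.indicator (kernel d lam)) S :=
    ((integrable_indicator_iff hmeas).2 ((integrableOn_kernel hlam
      (by positivity : 0 < h / 2)).mono_set
        fun z hz => mem_ofPred.2 (half_le_norm_of_gridRound_ne_zero hh hz))).integrableOn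
  obtain ⟨B', hB'⟩ := hc.exists_bound_of_continuous hφ
  have hB0 : 0 ≤ B := (abs_nonneg _).trans (hB 0)
  have i1 : Integrable (fun q : SpaceTime d × Space d =>
      φ q.1 * (kernel d lam q.2 * (a (q.1 + (gridRound h q.2, 0)) - a q.1)))
      (volume.prod (volume.restrict S)) := by
    refine (hφi.norm.mul_prod (iK.const_mul (B + B))).mono'
      (Measurable.aestronglyMeasurable (by fun_prop)) (ae_of_all _ fun q => ?_)
    rw [norm_mul, norm_mul, Real.norm_of_nonneg (kernel_nonneg _)]
    refine mul_le_mul_of_nonneg_left ?_ (norm_nonneg _)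
    by_cases hz : gridRound h q.2 = 0
    · rw [hz, Prod.mk_zero_zero]; simp [hz, indicator]
    · rw [indicator_of_mem (s := {z : Space d | gridRound h z ≠ 0}) (by simpa using hz), mul_comm]
      exact mul_le_mul_of_nonneg_right ((norm_sub_le _ _).trans (add_le_add (hB _) (hB _)))
        (kernel_nonneg _)
  -- Rounding at most doubles `|z| ≤ r`; the absolute value allows for any sign of `r`.
  set KK := Metric.cthickening (2 * |r|) (tsupport φ)
  have hKc : IsCompact KK := hc.isCompact.cthickening
  have iKK : Integrable (KK.indicator fun _ : SpaceTime d => B * (B' + B')) :=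
    (integrable_indicator_iff hKc.measurableSet).2 (integrableOn_const hKc.measure_lt_top.ne)
  have hφ0 : ∀ p q : SpaceTime d, p ∉ KK → dist p q ≤ 2 * |r| → φ q = 0 := fun p q hp hq =>
    image_eq_zero_of_notMem_tsupport fun h => hp (Metric.mem_cthickening_of_dist_le p q _ _ h hq)
  have i2 : Integrable (fun q : SpaceTime d × Space d =>
      a q.1 * (kernel d lam q.2 * (φ (q.1 - (gridRound h q.2, 0)) - φ q.1)))
      (volume.prod (volume.restrict S)) := by
    refine (iKK.mul_prod iK).mono'
      (Measurable.aestronglyMeasurable (by fun_prop)) ?_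
    have hS : ∀ᵐ q : SpaceTime d × Space d ∂(volume.prod (volume.restrict S)), q.2 ∈ S := by
      have := ae_restrict_mem (μ := (volume : Measure (Space d))) (measurableSet_norm_le (d := d) r)
      exact Measure.quasiMeasurePreserving_snd.ae this
    filter_upwards [hS] with q hq
    have hq : ‖q.2‖ ≤ r := hq
    rw [norm_mul, norm_mul, Real.norm_of_nonneg (kernel_nonneg _)]
    by_cases hz : gridRound h q.2 = 0
    · rw [hz, Prod.mk_zero_zero]; simp [hz, indicator]
    · rw [indicator_of_mem (s := {z : Space d | gridRound h z ≠ 0}) (by simpa using hz)]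
      by_cases hp : q.1 ∈ KK
      · rw [indicator_of_mem hp]
        have h1 : ‖φ (q.1 - (gridRound h q.2, 0)) - φ q.1‖ ≤ B' + B' :=
          (norm_sub_le _ _).trans (add_le_add (hB' _) (hB' _))
        have h2 : ‖a q.1‖ * ‖φ (q.1 - (gridRound h q.2, 0)) - φ q.1‖ ≤ B * (B' + B') :=
          mul_le_mul (hB _) h1 (norm_nonneg _) hB0
        calc _ = ‖a q.1‖ * ‖φ (q.1 - (gridRound h q.2, 0)) - φ q.1‖ * kernel d lam q.2 := by ring
          _ ≤ _ := mul_le_mul_of_nonneg_right h2 (kernel_nonneg _)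
      · rw [indicator_of_notMem hp, hφ0 q.1 q.1 hp (by simp), hφ0 q.1 _ hp]
        · simp
        · rw [dist_eq_norm, sub_sub_cancel, norm_mk_zero]
          refine (norm_gridRound_le hh q.2).trans ?_
          linarith [le_abs_self r]
  have e1 : ∀ p : SpaceTime d, φ p * quadOn c lam h S (fun y => a (y, p.2)) p.1 =
      c * ∫ z in S, φ p * (kernel d lam z * (a (p + (gridRound h z, 0)) - a p)) := by
    intro p
    rw [integral_const_mul, quadOn]
    simp only [add_mk_zero]
    ring
  have e2 : ∀ p : SpaceTime d, a p * discInner c lam r h φ p =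
      c * ∫ z in S, a p * (kernel d lam z * (φ (p - (gridRound h z, 0)) - φ p)) := by
    intro p
    rw [integral_const_mul, discInner]
    ring
  simp_rw [e1, e2]
  have s1 := integral_integral_swap (f := fun (p : SpaceTime d) z =>
    φ p * (kernel d lam z * (a (p + (gridRound h z, 0)) - a p))) i1
  have s2 := integral_integral_swap (f := fun (p : SpaceTime d) z =>
    a p * (kernel d lam z * (φ (p - (gridRound h z, 0)) - φ p))) i2
  rw [integral_const_mul, integral_const_mul, s1, s2]
  congr 2
  ext z
  set w : SpaceTime d := (gridRound h z, 0)
  have j1 : Integrable fun p => a (p + w) * φ p :=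
    integrable_bdd_mul (by fun_prop) (fun p => hB _) hφi
  have j2 : Integrable fun p => a p * φ p := integrable_bdd_mul ha hB hφi
  have j3 : Integrable fun p => a p * φ (p - w) :=
    integrable_bdd_mul ha hB (hφi.comp_sub_right w)
  calc ∫ p, φ p * (kernel d lam z * (a (p + w) - a p))
      = ∫ p, kernel d lam z * (a (p + w) * φ p - a p * φ p) := by congr 1; ext p; ring
    _ = kernel d lam z * (∫ p, a p * φ (p - w) - a p * φ p) := by
      rw [integral_const_mul, integral_sub j1 j2, integral_translate_mul, ← integral_sub j3 j2]
    _ = _ := by rw [← integral_const_mul]; congr 1; ext p; ring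

/-- `v` is a bounded function satisfying the scheme pointwise, with the quadrature written as an
integral, up to the time `T`. -/
structure IsSchemeFun {d : ℕ} (c lam : ℝ) (A : ℝ → ℝ) (F : Fin d → ℝ → ℝ → ℝ) (h τ T M : ℝ)
    (v : SpaceTime d → ℝ) : Prop where
  measurable : Measurable v
  bound : ∀ p, |v p| ≤ M
  step : ∀ x t, 0 ≤ t → t + τ < T → v (x, t + τ) = v (x, t)
    - τ * fluxDiff F h (fun y => v (y, t)) x + τ * quadOn c lam h univ (fun y => A (v (y, t))) x

/-- The integrand of the discrete entropy inequality. -/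
def discIntegrand {d : ℕ} (c lam : ℝ) (A : ℝ → ℝ) (F : Fin d → ℝ → ℝ → ℝ) (h τ k r : ℝ)
    (v φ : SpaceTime d → ℝ) (p : SpaceTime d) : ℝ :=
  |v p - k| * ((φ p - φ (p - (0, τ))) / τ)
    + ∑ l, numEntropyFlux (F l) k (v p) (v (p + (EuclideanSpace.single l h, 0)))
        * ((φ (p + (EuclideanSpace.single l h, 0)) - φ p) / h)
    + |A (v p) - A k| * discInner c lam r h φ p
    + Real.sign (v (p + (0, τ)) - k)
        * quadOn c lam h {z | r < ‖z‖} (fun y => A (v (y, p.2))) p.1 * φ p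

/-! ### Bounds and measurability of the terms of the discrete inequality -/

theorem abs_quadOn_le {d : ℕ} {c lam h r B : ℝ} (hc : 0 < c) (hlam : 0 < lam) (hr : 0 < r)
    {g : Space d → ℝ} (hB : ∀ x, |g x| ≤ B) (x : Space d) :
    |quadOn c lam h {z | r < ‖z‖} g x| ≤
      c * ∫ z in {z : Space d | r < ‖z‖}, kernel d lam z * (B + B) := by
  rw [quadOn, abs_mul, abs_of_pos hc]
  refine mul_le_mul_of_nonneg_left ?_ hc.le
  rw [← Real.norm_eq_abs]
  refine norm_integral_le_of_norm_le ((integrableOn_kernel_gt hlam hr).mul_const _)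
    (ae_of_all _ fun z => ?_)
  rw [norm_mul, Real.norm_of_nonneg (kernel_nonneg z)]
  exact mul_le_mul_of_nonneg_left ((norm_sub_le _ _).trans (add_le_add (hB _) (hB _)))
    (kernel_nonneg _)

theorem measurable_quadOn {d : ℕ} {c lam h : ℝ} {S : Set (Space d)} {g : SpaceTime d → ℝ}
    (hg : Measurable g) :
    Measurable fun p : SpaceTime d => quadOn c lam h S (fun y => g (y, p.2)) p.1 := by
  have h1 : StronglyMeasurable fun q : SpaceTime d × Space d =>
      kernel d lam q.2 * (g (q.1.1 + gridRound h q.2, q.1.2) - g (q.1.1, q.1.2)) :=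
    Measurable.stronglyMeasurable (by fun_prop)
  exact (h1.integral_prod_right (ν := volume.restrict S)).measurable.const_mul _

theorem measurable_sign : Measurable Real.sign := by
  unfold Real.sign
  exact Measurable.ite measurableSet_Iio measurable_const
    (Measurable.ite measurableSet_Ioi measurable_const measurable_const)

theorem abs_sign_le (a : ℝ) : |Real.sign a| ≤ 1 := by
  rcases Real.sign_apply_eq a with h | h | h <;> rw [h] <;> simp

theorem IsNumericalFlux.continuous {LF : ℝ≥0} {f : ℝ → ℝ} {F : ℝ → ℝ → ℝ}
    (hF : IsNumericalFlux LF f F) : Continuous fun q : ℝ × ℝ => F q.1 q.2 := by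
  refine (LipschitzWith.of_dist_le_mul (K := LF * 2) fun q q' => ?_).continuous
  rw [Real.dist_eq, Prod.dist_eq, Real.dist_eq, Real.dist_eq]
  refine (hF.lipschitz _ _ _ _).trans ?_
  push_cast
  rw [mul_assoc]
  refine mul_le_mul_of_nonneg_left ?_ LF.2
  linarith [le_max_left |q.1 - q'.1| |q.2 - q'.2|, le_max_right |q.1 - q'.1| |q.2 - q'.2|]

/-- By consistency the exact entropy flux is the numerical one at `(u, u)`; then `F` is Lipschitz
and `max · k`, `min · k` are contractions. -/
theorem IsNumericalFlux.abs_numEntropyFlux_sub_le {LF : ℝ≥0} {f : ℝ → ℝ} {F : ℝ → ℝ → ℝ}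
    (hF : IsNumericalFlux LF f F) (k a b u : ℝ) :
    |numEntropyFlux F k a b - Real.sign (u - k) * (f u - f k)| ≤
      2 * LF * (|a - u| + |b - u|) := by
  have h0 : Real.sign (u - k) * (f u - f k) = F (max u k) (max u k) - F (min u k) (min u k) := by
    rw [hF.consistent, hF.consistent]
    rcases lt_trichotomy u k with h | h | h
    · rw [max_eq_right h.le, min_eq_left h.le, Real.sign_of_neg (by linarith)]; ring
    · rw [h]; simp
    · rw [max_eq_left h.le, min_eq_right h.le, Real.sign_of_pos (by linarith)]; ring
  have h1 := hF.lipschitz (max a k) (max b k) (max u k) (max u k)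
  have h2 := hF.lipschitz (min a k) (min b k) (min u k) (min u k)
  have hL : (0 : ℝ) ≤ LF := LF.2
  have mx : ∀ a, |max a k - max u k| ≤ |a - u| := fun a => abs_max_sub_max_le_abs _ _ _
  have mn : ∀ a, |min a k - min u k| ≤ |a - u| := fun a => by
    have := abs_min_sub_min_le_max a k u k
    simpa using this
  have h3 := mul_le_mul_of_nonneg_left (add_le_add (mx a) (mx b)) hL
  have h4 := mul_le_mul_of_nonneg_left (add_le_add (mn a) (mn b)) hL
  rw [h0, numEntropyFlux]
  have : F (max a k) (max b k) - F (min a k) (min b k)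
      - (F (max u k) (max u k) - F (min u k) (min u k)) =
      (F (max a k) (max b k) - F (max u k) (max u k))
        - (F (min a k) (min b k) - F (min u k) (min u k)) := by ring
  rw [this]
  refine (abs_sub _ _).trans ?_
  linarith

theorem IsNumericalFlux.abs_numEntropyFlux_le {LF : ℝ≥0} {f : ℝ → ℝ} {F : ℝ → ℝ → ℝ}
    (hF : IsNumericalFlux LF f F) (k : ℝ) {a b M : ℝ} (ha : |a| ≤ M) (hb : |b| ≤ M) :
    |numEntropyFlux F k a b| ≤ 2 * LF * (2 * (M + |k|)) := by
  -- At `u = k` the exact flux vanishes.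
  have h1 := hF.abs_numEntropyFlux_sub_le k a b k
  simp only [sub_self, Real.sign_zero, mul_zero, sub_zero] at h1
  refine h1.trans (mul_le_mul_of_nonneg_left ?_ (by positivity))
  have h2 := abs_sub a k
  have h3 := abs_sub b k
  linarith

theorem measurable_numEntropyFlux {LF : ℝ≥0} {f : ℝ → ℝ} {F : ℝ → ℝ → ℝ}
    (hF : IsNumericalFlux LF f F) (k : ℝ) {E : Type*} [MeasurableSpace E] {a b : E → ℝ}
    (ha : Measurable a) (hb : Measurable b) :
    Measurable fun p => numEntropyFlux F k (a p) (b p) := by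
  have hm := hF.continuous.measurable
  have h1 : Measurable fun p => (max (a p) k, max (b p) k) := by fun_prop
  have h2 : Measurable fun p => (min (a p) k, min (b p) k) := by fun_prop
  exact (hm.comp h1).sub (hm.comp h2)

/-- The cell inequality times `φ / τ`, integrated, with all shifts of `v` moved onto `φ`. The
hypothesis `hφτ` restricts its use to points where one step of the scheme is available. -/
theorem integral_discIntegrand_nonneg {d : ℕ} (hd : 1 ≤ d) {c lam : ℝ} (hc : 0 < c)
    (hlam : 0 < lam) (hlam2 : lam < 2)
    {f : ℝ → Space d} {A : ℝ → ℝ} {LA : ℝ≥0} (hA : LipschitzWith LA A) (hAmono : Monotone A)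
    {F : Fin d → ℝ → ℝ → ℝ} {LF : ℝ≥0} (hF : ∀ l, IsNumericalFlux LF (fun v => f v l) (F l))
    {h τ T M : ℝ} (hh : 0 < h) (hτ : 0 < τ) (hcfl : CFL d c lam LF LA h τ)
    {v : SpaceTime d → ℝ} (hv : IsSchemeFun c lam A F h τ T M v)
    {φ : SpaceTime d → ℝ} (hφ : IsTestFunction T φ)
    (hφτ : ∀ p, φ p ≠ 0 → 0 ≤ p.2 ∧ p.2 + τ < T) (k : ℝ) {r : ℝ} (hr : 0 < r) :
    0 ≤ ∫ p, discIntegrand c lam A F h τ k r v φ p := by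
  have hvm := hv.measurable
  have hAm : Measurable A := hA.continuous.measurable
  have hφc := hφ.smooth.continuous
  have hφm := hφc.measurable
  have hφi : Integrable φ := hφc.integrable_of_hasCompactSupport hφ.compact
  have hφs : ∀ w, Integrable fun p => φ (p - w) := fun w => hφi.comp_sub_right w
  have hφa : ∀ w, Integrable fun p => φ (p + w) := fun w => hφi.comp_add_right w
  have hvk : ∀ p, |(|v p - k|)| ≤ M + |k| := fun p => by
    rw [abs_abs]; exact (abs_sub _ _).trans (add_le_add (hv.bound p) le_rfl)
  have hAb : ∀ p, |A (v p)| ≤ |A 0| + LA * M := fun p => abs_le_of_lipschitz hA (hv.bound p)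
  have hAk : ∀ p, |(|A (v p) - A k|)| ≤ |A 0| + LA * M + |A k| := fun p => by
    rw [abs_abs]; exact (abs_sub _ _).trans (add_le_add (hAb p) le_rfl)
  have mvk : Measurable fun p => |v p - k| := by fun_prop
  have mAk : Measurable fun p => |A (v p) - A k| := by fun_prop
  have mQ : ∀ l, Measurable fun p =>
      numEntropyFlux (F l) k (v p) (v (p + (EuclideanSpace.single l h, 0))) := fun l =>
    measurable_numEntropyFlux (hF l) k hvm (by fun_prop)
  have bQ : ∀ l p, |numEntropyFlux (F l) k (v p) (v (p + (EuclideanSpace.single l h, 0)))| ≤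
      2 * LF * (2 * (M + |k|)) := fun l p =>
    (hF l).abs_numEntropyFlux_le k (hv.bound _) (hv.bound _)
  have mout : Measurable fun p : SpaceTime d =>
      quadOn c lam h {z | r < ‖z‖} (fun y => A (v (y, p.2))) p.1 :=
    measurable_quadOn (hAm.comp hvm)
  have bout : ∀ p : SpaceTime d, |quadOn c lam h {z | r < ‖z‖} (fun y => A (v (y, p.2))) p.1| ≤
      c * ∫ z in {z : Space d | r < ‖z‖}, kernel d lam z * ((|A 0| + LA * M) + (|A 0| + LA * M)) :=
    fun p => abs_quadOn_le hc hlam hr (fun y => hAb _) p.1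
  have msg : Measurable fun p : SpaceTime d => Real.sign (v (p + (0, τ)) - k) :=
    measurable_sign.comp (by fun_prop)
  -- integrability of the four terms
  have i1 : Integrable fun p => |v p - k| * ((φ p - φ (p - (0, τ))) / τ) :=
    integrable_bdd_mul mvk hvk ((hφi.sub (hφs _)).div_const τ)
  have i2 : ∀ l, Integrable fun p =>
      numEntropyFlux (F l) k (v p) (v (p + (EuclideanSpace.single l h, 0)))
        * ((φ (p + (EuclideanSpace.single l h, 0)) - φ p) / h) := fun l =>
    integrable_bdd_mul (mQ l) (bQ l) (((hφa _).sub hφi).div_const h)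
  have iD : Integrable (discInner c lam r h φ) := by
    obtain ⟨C, hC⟩ := exists_discInner_le (c := c) (r := r) hd hlam hlam2 hφ.smooth hφ.compact
    have hKc : IsCompact (Metric.cthickening (2 * r) (tsupport φ)) := hφ.compact.isCompact.cthickening
    exact ((integrable_indicator_iff hKc.measurableSet).2
      (integrableOn_const hKc.measure_lt_top.ne)).mono'
      (measurable_discInner hφc).aestronglyMeasurable (ae_of_all _ (hC h hh))
  have i3 : Integrable fun p => |A (v p) - A k| * discInner c lam r h φ p :=
    integrable_bdd_mul mAk hAk iD
  have i4 : Integrable fun p => Real.sign (v (p + (0, τ)) - k)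
        * quadOn c lam h {z | r < ‖z‖} (fun y => A (v (y, p.2))) p.1 * φ p :=
    integrable_bdd_mul (msg.mul mout) (fun p => (abs_mul _ _).trans_le
      (mul_le_mul (abs_sign_le _) (bout p) (abs_nonneg _) zero_le_one)) hφi
  -- moving the differences to `v`
  have e1 : ∫ p, |v p - k| * ((φ p - φ (p - (0, τ))) / τ)
      = ∫ p, φ p * ((|v p - k| - |v (p + (0, τ)) - k|) / τ) := by
    have a1 : ∫ p, |v (p + (0, τ)) - k| * φ p = ∫ p, |v p - k| * φ (p - (0, τ)) :=
      integral_translate_mul (fun p => |v p - k|) φ _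
    have b1 : Integrable fun p => |v p - k| * φ p := integrable_bdd_mul mvk hvk hφi
    have b2 : Integrable fun p => |v p - k| * φ (p - (0, τ)) := integrable_bdd_mul mvk hvk (hφs _)
    have b3 : Integrable fun p => |v (p + (0, τ)) - k| * φ p :=
      integrable_bdd_mul (by fun_prop) (fun p => hvk (p + (0, τ))) hφi
    calc _ = ∫ p, (|v p - k| * φ p - |v p - k| * φ (p - (0, τ))) / τ := by
          congr 1; ext p; ring
      _ = ∫ p, (|v p - k| * φ p - |v (p + (0, τ)) - k| * φ p) / τ := by
          rw [integral_div, integral_div, integral_sub b1 b2, integral_sub b1 b3, a1]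
      _ = _ := by congr 1; ext p; ring
  have c1 : Integrable fun p => φ p * ((|v p - k| - |v (p + (0, τ)) - k|) / τ) := by
    have b1 : Integrable fun p => |v p - k| * φ p := integrable_bdd_mul mvk hvk hφi
    have b3 : Integrable fun p => |v (p + (0, τ)) - k| * φ p :=
      integrable_bdd_mul (by fun_prop) (fun p => hvk (p + (0, τ))) hφi
    refine ((b1.sub b3).div_const τ).congr (ae_of_all _ fun p => ?_)
    simp only [Pi.sub_apply]; ring
  have bl : ∀ l : Fin d, Integrable fun p : SpaceTime d =>
      numEntropyFlux (F l) k (v (p - (EuclideanSpace.single l h, 0))) (v p) * φ p := fun l =>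
    integrable_bdd_mul (measurable_numEntropyFlux (hF l) k (by fun_prop) hvm)
      (fun p => (hF l).abs_numEntropyFlux_le k (hv.bound _) (hv.bound _)) hφi
  have bl' : ∀ l : Fin d, Integrable fun p : SpaceTime d =>
      numEntropyFlux (F l) k (v p) (v (p + (EuclideanSpace.single l h, 0))) * φ p := fun l =>
    integrable_bdd_mul (mQ l) (bQ l) hφi
  have e2 : ∀ l : Fin d, ∫ p, numEntropyFlux (F l) k (v p) (v (p + (EuclideanSpace.single l h, 0)))
        * ((φ (p + (EuclideanSpace.single l h, 0)) - φ p) / h)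
      = ∫ p, -(φ p * ((numEntropyFlux (F l) k (v p) (v (p + (EuclideanSpace.single l h, 0)))
          - numEntropyFlux (F l) k (v (p - (EuclideanSpace.single l h, 0))) (v p)) / h)) := by
    intro l
    set w : SpaceTime d := (EuclideanSpace.single l h, 0)
    have a1 : ∫ p, numEntropyFlux (F l) k (v p) (v (p + w)) * φ (p + w) =
        ∫ p, numEntropyFlux (F l) k (v (p - w)) (v p) * φ p := by
      rw [← integral_add_right_eq_self
        (fun p => numEntropyFlux (F l) k (v (p - w)) (v p) * φ p) w]
      simp
    calc _ = ∫ p, (numEntropyFlux (F l) k (v p) (v (p + w)) * φ (p + w)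
            - numEntropyFlux (F l) k (v p) (v (p + w)) * φ p) / h := by congr 1; ext p; ring
      _ = ∫ p, (numEntropyFlux (F l) k (v (p - w)) (v p) * φ p
            - numEntropyFlux (F l) k (v p) (v (p + w)) * φ p) / h := by
          rw [integral_div, integral_div, integral_sub (integrable_bdd_mul (mQ l) (bQ l) (hφa w))
            (bl' l), integral_sub (bl l) (bl' l), a1]
      _ = _ := by congr 1; ext p; ring
  have c2 : ∀ l : Fin d, Integrable fun p =>
      -(φ p * ((numEntropyFlux (F l) k (v p) (v (p + (EuclideanSpace.single l h, 0)))
          - numEntropyFlux (F l) k (v (p - (EuclideanSpace.single l h, 0))) (v p)) / h)) := by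
    intro l
    refine (((bl l).sub (bl' l)).div_const h).congr (ae_of_all _ fun p => ?_)
    simp only [Pi.sub_apply]; ring
  have e3 := integral_mul_quadOn (c := c) (r := r) hlam hh hφc hφ.compact mAk hAk
  have c3 : Integrable fun p : SpaceTime d =>
      φ p * quadOn c lam h {z | ‖z‖ ≤ r} (fun y => |A (v (y, p.2)) - A k|) p.1 := by
    have mq := measurable_quadOn (c := c) (lam := lam) (h := h) (S := {z : Space d | ‖z‖ ≤ r}) mAk
    have hmeas : MeasurableSet {z : Space d | gridRound h z ≠ 0} :=
      (measurableSet_eq_fun (measurable_gridRound h) measurable_const).compl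
    have iK : Integrable ({z : Space d | gridRound h z ≠ 0}.indicator (kernel d lam)) :=
      (integrable_indicator_iff hmeas).2 ((integrableOn_kernel hlam
        (by positivity : 0 < h / 2)).mono_set
          fun z hz => mem_ofPred.2 (half_le_norm_of_gridRound_ne_zero hh hz))
    set B := |A 0| + LA * M + |A k|
    -- Integrability at a fixed mesh needs no cancellation: the kernel has finite mass off the
    -- central cell.
    have hbd : ∀ p : SpaceTime d,
        |quadOn c lam h {z | ‖z‖ ≤ r} (fun y => |A (v (y, p.2)) - A k|) p.1| ≤
        c * ∫ z in {z : Space d | ‖z‖ ≤ r},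
          {z : Space d | gridRound h z ≠ 0}.indicator (kernel d lam) z * (B + B) := by
      intro p
      rw [quadOn, abs_mul, abs_of_pos hc]
      refine mul_le_mul_of_nonneg_left ?_ hc.le
      rw [← Real.norm_eq_abs]
      refine norm_integral_le_of_norm_le (iK.mul_const _).integrableOn (ae_of_all _ fun z => ?_)
      rw [norm_mul, Real.norm_of_nonneg (kernel_nonneg z)]
      by_cases hz : gridRound h z = 0
      · simp [hz, indicator]
      · rw [indicator_of_mem (s := {z : Space d | gridRound h z ≠ 0}) (by simpa using hz)]
        exact mul_le_mul_of_nonneg_left ((norm_sub_le _ _).trans (add_le_add (hAk _) (hAk _)))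
          (kernel_nonneg _)
    refine (integrable_bdd_mul mq hbd hφi).congr (ae_of_all _ fun p => ?_)
    ring
  have i2s : Integrable fun p : SpaceTime d =>
      ∑ l, numEntropyFlux (F l) k (v p) (v (p + (EuclideanSpace.single l h, 0)))
        * ((φ (p + (EuclideanSpace.single l h, 0)) - φ p) / h) :=
    integrable_finsetSum _ fun l _ => i2 l
  have c2s := integrable_finsetSum Finset.univ fun l _ => c2 l
  have etot : ∫ p, discIntegrand c lam A F h τ k r v φ p =
      ∫ p, (φ p * ((|v p - k| - |v (p + (0, τ)) - k|) / τ)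
        + ∑ l, -(φ p * ((numEntropyFlux (F l) k (v p) (v (p + (EuclideanSpace.single l h, 0)))
          - numEntropyFlux (F l) k (v (p - (EuclideanSpace.single l h, 0))) (v p)) / h))
        + φ p * quadOn c lam h {z | ‖z‖ ≤ r} (fun y => |A (v (y, p.2)) - A k|) p.1
        + Real.sign (v (p + (0, τ)) - k)
          * quadOn c lam h {z | r < ‖z‖} (fun y => A (v (y, p.2))) p.1 * φ p) := by
    unfold discIntegrand
    rw [integral_add_four i1 i2s i3 i4, integral_add_four c1 c2s c3 i4,
      integral_finsetSum _ fun l _ => i2 l, integral_finsetSum _ fun l _ => c2 l, e1, e3]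
    simp_rw [e2]
  rw [etot]
  -- With the differences back on `v`, the integrand is nonnegative pointwise.
  refine integral_nonneg fun p => ?_
  by_cases hp : φ p = 0
  · simp [hp]
  obtain ⟨hp0, hpT⟩ := hφτ p hp
  have key := cell_entropy_inequality hd hc hlam hA hAmono hF hh hτ hcfl
    (w := fun y => v (y, p.2)) (by fun_prop) (fun y => hv.bound _) k r (hv.step p.1 p.2 hp0 hpT)
  have hpτ : p + (0, τ) = (p.1, p.2 + τ) := by ext <;> simp
  have hsum : ∑ l, -(φ p * ((numEntropyFlux (F l) k (v p) (v (p + (EuclideanSpace.single l h, 0)))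
          - numEntropyFlux (F l) k (v (p - (EuclideanSpace.single l h, 0))) (v p)) / h)) =
      -(φ p * fluxDiff (fun l => numEntropyFlux (F l) k) h (fun y => v (y, p.2)) p.1) := by
    rw [Finset.sum_neg_distrib, ← Finset.mul_sum, fluxDiff]
    simp only [add_mk_zero, sub_mk_zero]
  simp only [Pi.zero_apply]
  rw [hsum, hpτ]
  have hφp : 0 ≤ φ p := hφ.nonneg p
  have hle : 0 ≤ (|v (p.1, p.2) - k| - |v (p.1, p.2 + τ) - k|) / τ
      - fluxDiff (fun l => numEntropyFlux (F l) k) h (fun y => v (y, p.2)) p.1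
      + quadOn c lam h {z | ‖z‖ ≤ r} (fun y => |A (v (y, p.2)) - A k|) p.1
      + Real.sign (v (p.1, p.2 + τ) - k)
          * quadOn c lam h {z | r < ‖z‖} (fun y => A (v (y, p.2))) p.1 := by
    have h1 : 0 ≤ τ * ((|v (p.1, p.2) - k| - |v (p.1, p.2 + τ) - k|) / τ
      - fluxDiff (fun l => numEntropyFlux (F l) k) h (fun y => v (y, p.2)) p.1
      + quadOn c lam h {z | ‖z‖ ≤ r} (fun y => |A (v (y, p.2)) - A k|) p.1
      + Real.sign (v (p.1, p.2 + τ) - k)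
          * quadOn c lam h {z | r < ‖z‖} (fun y => A (v (y, p.2))) p.1) := by
      have h2 : τ * ((|v (p.1, p.2) - k| - |v (p.1, p.2 + τ) - k|) / τ) =
          |v (p.1, p.2) - k| - |v (p.1, p.2 + τ) - k| := mul_div_cancel₀ _ hτ.ne'
      rw [mul_add, mul_add, mul_sub, h2]
      linarith
    exact nonneg_of_mul_nonneg_right h1 hτ
  have := mul_nonneg hφp hle
  refine this.trans_eq ?_
  simp only [Prod.mk.eta]
  ring

/-! ### Convergence of the approximations, their shifts, and the outer quadrature -/

/-- Fubini and dominated convergence in `t`; the slice integrals are at most `C` times the finite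
mass of `μ`. -/
theorem tendsto_lintegral_of_slices {X Y : Type*} [MeasurableSpace X] [MeasurableSpace Y]
    {μ : Measure X} {ν : Measure Y} [IsFiniteMeasure μ] [IsFiniteMeasure ν]
    {g : ℕ → X × Y → ℝ} {C : ℝ} (hg : ∀ m, Measurable (g m)) (hC : ∀ m p, |g m p| ≤ C)
    (hlim : ∀ᵐ t ∂ν, Tendsto (fun m => ∫⁻ x, ‖g m (x, t)‖ₑ ∂μ) atTop (𝓝 0)) :
    Tendsto (fun m => ∫⁻ p, ‖g m p‖ₑ ∂(μ.prod ν)) atTop (𝓝 0) := by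
  have h1 : ∀ m, ∫⁻ p, ‖g m p‖ₑ ∂(μ.prod ν) = ∫⁻ t, ∫⁻ x, ‖g m (x, t)‖ₑ ∂μ ∂ν := fun m =>
    lintegral_prod_symm' _ (hg m).enorm
  simp_rw [h1]
  rw [← lintegral_zero (μ := ν)]
  refine tendsto_lintegral_of_dominated_convergence (fun _ => ENNReal.ofReal C * μ univ)
    (fun m => (hg m).enorm.lintegral_prod_left') (fun m => ae_of_all _ fun t => ?_) ?_ hlim
  · rw [← lintegral_const]
    refine lintegral_mono fun x => ?_
    rw [Real.enorm_eq_ofReal_abs]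
    exact ENNReal.ofReal_le_ofReal (hC m _)
  · rw [lintegral_const]
    exact ENNReal.mul_ne_top (ENNReal.mul_ne_top ENNReal.ofReal_ne_top (measure_ne_top _ _))
      (measure_ne_top _ _)

theorem enorm_lipschitz_sub_le {A : ℝ → ℝ} {LA : ℝ≥0} (hA : LipschitzWith LA A) (a b : ℝ) :
    ‖A a - A b‖ₑ ≤ LA * ‖a - b‖ₑ := by
  have := hA a b
  rwa [edist_eq_enorm_sub, edist_eq_enorm_sub] at this

/-- After exchanging the integrals, for each `z` the integral over `B` tends to `0` by continuity of
translations, and it is bounded uniformly in `z`. Since the kernel is integrable on `|z| > r`,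
dominated convergence in `z` applies; the finite measure of `B` is needed only for the majorant. -/
theorem tendsto_lintegral_quadOn_sub_gOuter {d : ℕ} {c lam r : ℝ} (hc : 0 < c) (hlam : 0 < lam)
    (hr : 0 < r) {A : ℝ → ℝ} {LA : ℝ≥0} (hA : LipschitzWith LA A)
    {h : ℕ → ℝ} (hh : ∀ m, 0 < h m) (hh0 : Tendsto h atTop (𝓝 0)) {M : ℝ}
    {v : ℕ → Space d → ℝ} {u : Space d → ℝ} (hv : ∀ m, Measurable (v m)) (hu : Measurable u)
    (hvM : ∀ m x, |v m x| ≤ M) (huM : ∀ x, |u x| ≤ M) (hui : Integrable u)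
    (hvu : Tendsto (fun m => ∫⁻ x, ‖v m x - u x‖ₑ) atTop (𝓝 0))
    (B : Set (Space d)) [IsFiniteMeasure (volume.restrict B)] :
    Tendsto (fun m => ∫⁻ x in B, ‖quadOn c lam (h m) {z | r < ‖z‖} (fun y => A (v m y)) x
      - gOuter c lam r (fun y => A (u y)) x‖ₑ) atTop (𝓝 0) := by
  have hAm := hA.continuous.measurable
  set S : Set (Space d) := {z | r < ‖z‖}
  set N := |A 0| + LA * M
  have hAv : ∀ m y, |A (v m y)| ≤ N := fun m y => abs_le_of_lipschitz hA (hvM m y)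
  have hAu : ∀ y, |A (u y)| ≤ N := fun y => abs_le_of_lipschitz hA (huM y)
  have iK : IntegrableOn (kernel d lam) S := integrableOn_kernel_gt hlam hr
  let D : ℕ → Space d → Space d → ℝ := fun m x z =>
    (A (v m (x + gridRound (h m) z)) - A (v m x)) - (A (u (x + z)) - A (u x))
  have hDm : ∀ m, Measurable fun q : Space d × Space d => D m q.1 q.2 := fun m => by
    have := hv m
    simp only [D]; fun_prop
  have hDb : ∀ m x z, |D m x z| ≤ 4 * N := fun m x z => by
    simp only [D]
    have h1 := abs_le.1 (hAv m (x + gridRound (h m) z))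
    have h2 := abs_le.1 (hAv m x)
    have h3 := abs_le.1 (hAu (x + z))
    have h4 := abs_le.1 (hAu x)
    rw [abs_le]; constructor <;> linarith
  have hrep : ∀ m x, quadOn c lam (h m) S (fun y => A (v m y)) x - gOuter c lam r (fun y => A (u y)) x
      = c * ∫ z in S, kernel d lam z * D m x z := by
    intro m x
    have bd : ∀ g : Space d → ℝ, Measurable g → (∀ z, |g z| ≤ N + N) →
        IntegrableOn (fun z => kernel d lam z * g z) S := fun g hg hb =>
      (Integrable.bdd_mul (c := N + N) iK hg.aestronglyMeasurable
        (ae_of_all _ hb)).congr (ae_of_all _ fun z => by ring)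
    have := hv m
    have j1 := bd (fun z => A (v m (x + gridRound (h m) z)) - A (v m x)) (by fun_prop)
      fun z => (abs_sub _ _).trans (add_le_add (hAv _ _) (hAv _ _))
    have j2 := bd (fun z => A (u (x + z)) - A (u x)) (by fun_prop)
      fun z => (abs_sub _ _).trans (add_le_add (hAu _) (hAu _))
    rw [quadOn, gOuter, ← mul_sub]
    congr 1
    rw [show (∫ z in {z : Space d | r < ‖z‖}, (A (u (x + z)) - A (u x)) * kernel d lam z) =
      ∫ z in S, kernel d lam z * (A (u (x + z)) - A (u x)) by congr 1; ext z; ring,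
      ← integral_sub j1 j2]
    congr 1; ext z; simp only [D]; ring
  have hbound : ∀ m, ∫⁻ x in B, ‖quadOn c lam (h m) S (fun y => A (v m y)) x
      - gOuter c lam r (fun y => A (u y)) x‖ₑ ≤
      ENNReal.ofReal c * ∫⁻ z in S, ‖kernel d lam z‖ₑ * ∫⁻ x in B, ‖D m x z‖ₑ := by
    intro m
    have hDm' := hDm m
    calc _ = ∫⁻ x in B, ENNReal.ofReal c * ‖∫ z in S, kernel d lam z * D m x z‖ₑ := by
          refine lintegral_congr fun x => ?_
          rw [hrep, enorm_mul, Real.enorm_of_nonneg hc.le]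
      _ ≤ ∫⁻ x in B, ENNReal.ofReal c * ∫⁻ z in S, ‖kernel d lam z‖ₑ * ‖D m x z‖ₑ := by
          refine lintegral_mono fun x => mul_le_mul_right ?_ _
          refine (enorm_integral_le_lintegral_enorm _).trans_eq ?_
          exact lintegral_congr fun z => enorm_mul _ _
      _ = ENNReal.ofReal c * ∫⁻ x in B, ∫⁻ z in S, ‖kernel d lam z‖ₑ * ‖D m x z‖ₑ :=
          lintegral_const_mul' _ _ ENNReal.ofReal_ne_top
      _ = ENNReal.ofReal c * ∫⁻ z in S, ∫⁻ x in B, ‖kernel d lam z‖ₑ * ‖D m x z‖ₑ := by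
          rw [lintegral_lintegral_swap]
          have : Measurable fun q : Space d × Space d => ‖kernel d lam q.2‖ₑ * ‖D m q.1 q.2‖ₑ := by
            fun_prop
          exact this.aemeasurable
      _ = _ := by
          congr 1
          refine lintegral_congr fun z => ?_
          rw [lintegral_const_mul' _ _ enorm_ne_top]
  have hz : ∀ z, Tendsto (fun m => ∫⁻ x in B, ‖D m x z‖ₑ) atTop (𝓝 0) := by
    intro z
    have t1 := tendsto_lintegral_translate_sub hv hui hvu (tendsto_gridRound hh hh0 z)
    have t2 := ENNReal.Tendsto.const_mul (a := (LA : ℝ≥0∞)) (t1.add hvu) (Or.inr ENNReal.coe_ne_top)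
    rw [add_zero, mul_zero] at t2
    refine tendsto_of_tendsto_of_tendsto_of_le_of_le tendsto_const_nhds t2 (fun _ => zero_le)
      fun m => ?_
    have hvm := hv m
    calc ∫⁻ x in B, ‖D m x z‖ₑ ≤ ∫⁻ x, ‖D m x z‖ₑ := setLIntegral_le_lintegral _ _
      _ ≤ ∫⁻ x, (LA * ‖v m (x + gridRound (h m) z) - u (x + z)‖ₑ + LA * ‖v m x - u x‖ₑ) := by
          refine lintegral_mono fun x => ?_
          have : D m x z = (A (v m (x + gridRound (h m) z)) - A (u (x + z)))
            - (A (v m x) - A (u x)) := by simp only [D]; ring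
          rw [this]
          exact (enorm_sub_le).trans (add_le_add (enorm_lipschitz_sub_le hA _ _)
            (enorm_lipschitz_sub_le hA _ _))
      _ = _ := by
          rw [lintegral_add_left (by fun_prop), lintegral_const_mul' _ _ ENNReal.coe_ne_top,
            lintegral_const_mul' _ _ ENNReal.coe_ne_top, mul_add]
  have hlim : Tendsto (fun m => ∫⁻ z in S, ‖kernel d lam z‖ₑ * ∫⁻ x in B, ‖D m x z‖ₑ) atTop
      (𝓝 (∫⁻ _ in S, 0)) := by
    refine tendsto_lintegral_of_dominated_convergence
      (fun z => ‖kernel d lam z‖ₑ * (ENNReal.ofReal (4 * N) * volume.restrict B univ))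
      (fun m => ?_) (fun m => ae_of_all _ fun z => ?_) ?_ (ae_of_all _ fun z => ?_)
    · exact measurable_kernel.enorm.mul (hDm m).enorm.lintegral_prod_left'
    · refine mul_le_mul_right ?_ _
      rw [← lintegral_const]
      refine lintegral_mono fun x => ?_
      rw [Real.enorm_eq_ofReal_abs]
      exact ENNReal.ofReal_le_ofReal (hDb m _ _)
    · rw [lintegral_mul_const _ measurable_kernel.enorm]
      exact ENNReal.mul_ne_top iK.2.ne (ENNReal.mul_ne_top ENNReal.ofReal_ne_top
        (measure_ne_top _ _))
    · have := ENNReal.Tendsto.const_mul (a := ‖kernel d lam z‖ₑ) (hz z) (Or.inr enorm_ne_top)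
      rwa [mul_zero] at this
  rw [lintegral_zero] at hlim
  have hfin := ENNReal.Tendsto.const_mul (a := ENNReal.ofReal c) hlim (Or.inr ENNReal.ofReal_ne_top)
  rw [mul_zero] at hfin
  exact tendsto_of_tendsto_of_tendsto_of_le_of_le tendsto_const_nhds hfin (fun _ => zero_le) hbound

theorem measurable_gOuter {d : ℕ} {c lam r : ℝ} {g : SpaceTime d → ℝ} (hg : Measurable g) :
    Measurable fun p : SpaceTime d => gOuter c lam r (fun y => g (y, p.2)) p.1 := by
  have h1 : StronglyMeasurable fun q : SpaceTime d × Space d =>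
      (g (q.1.1 + q.2, q.1.2) - g (q.1.1, q.1.2)) * kernel d lam q.2 :=
    Measurable.stronglyMeasurable (by fun_prop)
  exact (h1.integral_prod_right (ν := volume.restrict {z | r < ‖z‖})).measurable.const_mul _

theorem abs_gOuter_le {d : ℕ} {c lam r B : ℝ} (hc : 0 < c) (hlam : 0 < lam) (hr : 0 < r)
    {g : Space d → ℝ} (hB : ∀ x, |g x| ≤ B) (x : Space d) :
    |gOuter c lam r g x| ≤ c * ∫ z in {z : Space d | r < ‖z‖}, kernel d lam z * (B + B) := by
  rw [gOuter, abs_mul, abs_of_pos hc]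
  refine mul_le_mul_of_nonneg_left ?_ hc.le
  rw [← Real.norm_eq_abs]
  refine norm_integral_le_of_norm_le ((integrableOn_kernel_gt hlam hr).mul_const _)
    (ae_of_all _ fun z => ?_)
  rw [norm_mul, Real.norm_of_nonneg (kernel_nonneg z), mul_comm]
  exact mul_le_mul_of_nonneg_left ((norm_sub_le _ _).trans (add_le_add (hB _) (hB _)))
    (kernel_nonneg _)

/-- Convergence of `v m` to `u` in `L¹(ℝ^d)` at almost all times, also after a time shift `τ m`. -/
structure ConvergesSlicewise {d : ℕ} (T : ℝ) (τ : ℕ → ℝ) (v : ℕ → SpaceTime d → ℝ)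
    (u : SpaceTime d → ℝ) : Prop where
  integrable : ∀ᵐ t ∂(volume.restrict (Ioo 0 T)), Integrable fun x => u (x, t)
  tendsto : ∀ᵐ t ∂(volume.restrict (Ioo 0 T)),
    Tendsto (fun m => ∫⁻ x, ‖v m (x, t) - u (x, t)‖ₑ) atTop (𝓝 0)
  tendsto_shift : ∀ᵐ t ∂(volume.restrict (Ioo 0 T)),
    Tendsto (fun m => ∫⁻ x, ‖v m (x, t + τ m) - u (x, t)‖ₑ) atTop (𝓝 0)

/-- All differences are summed into one function that tends to `0` in `L¹`, so a single extraction
through convergence in measure serves every term. -/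
theorem exists_subseq_tendsto {d : ℕ} {c lam r T : ℝ} (hc : 0 < c) (hlam : 0 < lam)
    (hr : 0 < r) {A : ℝ → ℝ} {LA : ℝ≥0} (hA : LipschitzWith LA A)
    {h τ : ℕ → ℝ} (hh : ∀ m, 0 < h m) (hh0 : Tendsto h atTop (𝓝 0)) {M : ℝ}
    {v : ℕ → SpaceTime d → ℝ} {u : SpaceTime d → ℝ} (hv : ∀ m, Measurable (v m))
    (hu : Measurable u) (hvM : ∀ m p, |v m p| ≤ M) (huM : ∀ p, |u p| ≤ M)
    (hconv : ConvergesSlicewise T τ v u) (R : ℝ) :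
    ∃ ns : ℕ → ℕ, StrictMono ns ∧ ∀ᵐ p : SpaceTime d, p ∈ Metric.closedBall 0 R ×ˢ Ioo 0 T →
      Tendsto (fun i => v (ns i) p) atTop (𝓝 (u p)) ∧
      (∀ l, Tendsto (fun i => v (ns i) (p + (EuclideanSpace.single l (h (ns i)), 0))) atTop
        (𝓝 (u p))) ∧
      Tendsto (fun i => v (ns i) (p + (0, τ (ns i)))) atTop (𝓝 (u p)) ∧
      Tendsto (fun i => quadOn c lam (h (ns i)) {z | r < ‖z‖} (fun y => A (v (ns i) (y, p.2))) p.1)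
        atTop (𝓝 (gOuter c lam r (fun y => A (u (y, p.2))) p.1)) := by
  set B : Set (Space d) := Metric.closedBall 0 R
  have hAm := hA.continuous.measurable
  have : IsFiniteMeasure (volume.restrict B) :=
    isFiniteMeasure_restrict.2 (isCompact_closedBall _ _).measure_lt_top.ne
  have hbd : ∀ a b : ℝ, |a| ≤ M → |b| ≤ M → |a - b| ≤ M + M := fun a b ha hb =>
    (abs_sub _ _).trans (add_le_add ha hb)
  set ν := (volume.restrict B).prod (volume.restrict (Ioo 0 T))
  have hle : ∀ g : Space d → ℝ≥0∞, ∫⁻ x in B, g x ≤ ∫⁻ x, g x := fun g =>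
    setLIntegral_le_lintegral _ _
  have sq : ∀ {f g : ℕ → ℝ≥0∞}, Tendsto g atTop (𝓝 0) → (∀ m, f m ≤ g m) →
      Tendsto f atTop (𝓝 0) := fun hg hfg =>
    tendsto_of_tendsto_of_tendsto_of_le_of_le tendsto_const_nhds hg (fun _ => zero_le) hfg
  have t1 : Tendsto (fun m => ∫⁻ p, ‖v m p - u p‖ₑ ∂ν) atTop (𝓝 0) := by
    refine tendsto_lintegral_of_slices (fun m => (hv m).sub hu)
      (fun m p => hbd _ _ (hvM _ _) (huM _)) ?_
    filter_upwards [hconv.tendsto] with t ht using sq ht fun m => hle _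
  have t2 : ∀ l, Tendsto (fun m => ∫⁻ p, ‖v m (p + (EuclideanSpace.single l (h m), 0)) - u p‖ₑ ∂ν)
      atTop (𝓝 0) := by
    intro l
    refine tendsto_lintegral_of_slices
      (fun m => by have := hv m; fun_prop) (fun m p => hbd _ _ (hvM _ _) (huM _)) ?_
    filter_upwards [hconv.tendsto, hconv.integrable] with t ht hi
    have hs : Tendsto (fun m => (EuclideanSpace.single l (h m) : Space d)) atTop (𝓝 0) := by
      rw [tendsto_zero_iff_norm_tendsto_zero]
      simpa using hh0.abs
    have := tendsto_lintegral_translate_sub (fun m => (hv m).comp (measurable_prodMk_right (y := t)))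
      hi ht hs
    refine sq this fun m => (hle _).trans_eq ?_
    simp
  have t3 : Tendsto (fun m => ∫⁻ p, ‖v m (p + (0, τ m)) - u p‖ₑ ∂ν) atTop (𝓝 0) := by
    refine tendsto_lintegral_of_slices
      (fun m => by have := hv m; fun_prop) (fun m p => hbd _ _ (hvM _ _) (huM _)) ?_
    filter_upwards [hconv.tendsto_shift] with t ht
    refine sq ht fun m => (hle _).trans_eq ?_
    simp
  have t4 : Tendsto (fun m => ∫⁻ p : SpaceTime d,
      ‖quadOn c lam (h m) {z | r < ‖z‖} (fun y => A (v m (y, p.2))) p.1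
        - gOuter c lam r (fun y => A (u (y, p.2))) p.1‖ₑ ∂ν) atTop (𝓝 0) := by
    refine tendsto_lintegral_of_slices
      (fun m => (measurable_quadOn (hAm.comp (hv m))).sub (measurable_gOuter (hAm.comp hu)))
      (fun m p => (abs_sub _ _).trans (add_le_add
        (abs_quadOn_le hc hlam hr (fun y => abs_le_of_lipschitz hA (hvM m _)) _)
        (abs_gOuter_le hc hlam hr (fun y => abs_le_of_lipschitz hA (huM _)) _))) ?_
    filter_upwards [hconv.tendsto, hconv.integrable] with t ht hi
    exact tendsto_lintegral_quadOn_sub_gOuter hc hlam hr hA hh hh0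
      (fun m => (hv m).comp (measurable_prodMk_right (y := t)))
      (hu.comp (measurable_prodMk_right (y := t))) (fun m x => hvM m _) (fun x => huM _) hi ht B
  -- one function dominating all differences
  set s : ℕ → SpaceTime d → ℝ := fun m p => |v m p - u p|
    + ∑ l, |v m (p + (EuclideanSpace.single l (h m), 0)) - u p| + |v m (p + (0, τ m)) - u p|
    + |quadOn c lam (h m) {z | r < ‖z‖} (fun y => A (v m (y, p.2))) p.1
        - gOuter c lam r (fun y => A (u (y, p.2))) p.1| with hs
  have m1 : ∀ m, Measurable fun p => |v m p - u p| := fun m => by have := hv m; fun_prop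
  have m2 : ∀ m, Measurable fun p : SpaceTime d =>
      ∑ l, |v m (p + (EuclideanSpace.single l (h m), 0)) - u p| := fun m => by
    have := hv m; fun_prop
  have m3 : ∀ m, Measurable fun p : SpaceTime d => |v m (p + (0, τ m)) - u p| := fun m => by
    have := hv m; fun_prop
  have m4 : ∀ m, Measurable fun p : SpaceTime d =>
      |quadOn c lam (h m) {z | r < ‖z‖} (fun y => A (v m (y, p.2))) p.1
        - gOuter c lam r (fun y => A (u (y, p.2))) p.1| := fun m =>
    ((measurable_quadOn (hAm.comp (hv m))).sub (measurable_gOuter (hAm.comp hu))).abs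
  have hsm : ∀ m, Measurable (s m) := fun m => (((m1 m).add (m2 m)).add (m3 m)).add (m4 m)
  have hslim : Tendsto (fun m => eLpNorm (s m) 1 ν) atTop (𝓝 0) := by
    have tt := ((t1.add (tendsto_finsetSum Finset.univ fun l _ => t2 l)).add t3).add t4
    simp only [Finset.sum_const_zero, add_zero] at tt
    refine sq tt fun m => ?_
    rw [eLpNorm_one_eq_lintegral_enorm]
    have hvm := hv m
    rw [← lintegral_finsetSum _ fun l _ => by fun_prop, ← lintegral_add_left (by fun_prop),
      ← lintegral_add_left (by fun_prop), ← lintegral_add_left (by fun_prop)]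
    refine lintegral_mono fun p => ?_
    refine (enorm_add_le _ _).trans (add_le_add ((enorm_add_le _ _).trans (add_le_add
      ((enorm_add_le _ _).trans (add_le_add ?_ ?_)) ?_)) ?_)
    · rw [← Real.norm_eq_abs, enorm_norm]
    · refine (enorm_sum_le _ _).trans (Finset.sum_le_sum fun l _ => ?_)
      rw [← Real.norm_eq_abs, enorm_norm]
    · rw [← Real.norm_eq_abs, enorm_norm]
    · rw [← Real.norm_eq_abs, enorm_norm]
  have htm : TendstoInMeasure ν s atTop (fun _ => 0) := by
    refine tendstoInMeasure_of_tendsto_eLpNorm one_ne_zero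
      (fun m => (hsm m).aestronglyMeasurable) aestronglyMeasurable_const ?_
    refine hslim.congr fun m => ?_
    congr 1; ext p; simp
  obtain ⟨ns, hns, hae⟩ := htm.exists_seq_tendsto_ae
  refine ⟨ns, hns, ?_⟩
  have hνeq : ν = (volume : Measure (SpaceTime d)).restrict (B ×ˢ Ioo 0 T) :=
    Measure.prod_restrict _ _
  rw [hνeq] at hae
  have hae' := ae_imp_of_ae_restrict hae
  filter_upwards [hae'] with p hp hpm
  have hp := hp hpm
  have fin : ∀ {a : ℕ → ℝ} {b : ℝ}, (∀ m, |a m - b| ≤ s m p) →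
      Tendsto (fun i => a (ns i)) atTop (𝓝 b) := fun hab =>
    tendsto_iff_norm_sub_tendsto_zero.2
      (squeeze_zero (fun _ => norm_nonneg _) (fun i => hab (ns i)) hp)
  have hsum0 : ∀ m, 0 ≤ ∑ l, |v m (p + (EuclideanSpace.single l (h m), 0)) - u p| := fun m =>
    Finset.sum_nonneg fun l _ => abs_nonneg _
  refine ⟨fin (a := fun m => v m p) fun m => ?_,
    fun l => fin (a := fun m => v m (p + (EuclideanSpace.single l (h m), 0))) fun m => ?_,
    fin (a := fun m => v m (p + (0, τ m))) fun m => ?_,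
    fin (a := fun m => quadOn c lam (h m) {z | r < ‖z‖} (fun y => A (v m (y, p.2))) p.1)
      fun m => ?_⟩
  all_goals simp only [hs]
  · have := hsum0 m; have := abs_nonneg (v m (p + (0, τ m)) - u p)
    have := abs_nonneg (quadOn c lam (h m) {z | r < ‖z‖} (fun y => A (v m (y, p.2))) p.1
        - gOuter c lam r (fun y => A (u (y, p.2))) p.1)
    linarith
  · have h1 := Finset.single_le_sum (f := fun l =>
      |v m (p + (EuclideanSpace.single l (h m), 0)) - u p|) (fun l _ => abs_nonneg _)
      (Finset.mem_univ l)
    have := abs_nonneg (v m (p + (0, τ m)) - u p)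
    have := abs_nonneg (v m p - u p)
    have := abs_nonneg (quadOn c lam (h m) {z | r < ‖z‖} (fun y => A (v m (y, p.2))) p.1
        - gOuter c lam r (fun y => A (u (y, p.2))) p.1)
    linarith
  · have := hsum0 m; have := abs_nonneg (v m p - u p)
    have := abs_nonneg (quadOn c lam (h m) {z | r < ‖z‖} (fun y => A (v m (y, p.2))) p.1
        - gOuter c lam r (fun y => A (u (y, p.2))) p.1)
    linarith
  · have := hsum0 m; have := abs_nonneg (v m p - u p)
    have := abs_nonneg (v m (p + (0, τ m)) - u p)
    linarith

/-! ### Passage to the limit -/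

/-- Coordinate form, with every derivative read off the full differential, so that the terms match
those of `discIntegrand` one by one. -/
theorem entropyIntegrand_eq {d : ℕ} (hd : 1 ≤ d) {c lam r : ℝ} (hlam : 0 < lam) (hlam2 : lam < 2)
    (f : ℝ → Space d) (A : ℝ → ℝ) (k : ℝ) (u : SpaceTime d → ℝ) {φ : SpaceTime d → ℝ}
    (hφ : ContDiff ℝ ∞ φ) (hφc : HasCompactSupport φ) (p : SpaceTime d) :
    entropyIntegrand c lam f A k r u φ p =
      |u p - k| * fderiv ℝ φ p (0, 1)
      + ∑ l, Real.sign (u p - k) * (f (u p) l - f k l)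
          * fderiv ℝ φ p (EuclideanSpace.single l 1, 0)
      + |A (u p) - A k| * innerOp c lam r φ p
      + Real.sign (u p - k) * gOuter c lam r (fun y => A (u (y, p.2))) p.1 * φ p := by
  have hD : HasFDerivAt φ (fderiv ℝ φ p) p := (hφ.differentiable (by simp) p).hasFDerivAt
  have h1 : deriv (fun s => φ (p.1, s)) p.2 = fderiv ℝ φ p (0, 1) := by
    have h2 : HasFDerivAt (fun s => φ (p.1, s)) ((fderiv ℝ φ p).comp
        (ContinuousLinearMap.inr ℝ (Space d) ℝ)) p.2 :=
      HasFDerivAt.comp p.2 (f := fun s => (p.1, s)) hD (hasFDerivAt_prodMk_right p.1 p.2)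
    have := h2.hasDerivAt.deriv
    rw [this]; simp
  have h3 : ∀ q : Space d, inner ℝ q (gradient (fun y => φ (y, p.2)) p.1)
      = ∑ l, q l * fderiv ℝ φ p (EuclideanSpace.single l 1, 0) := by
    intro q
    have h2 : HasFDerivAt (fun y => φ (y, p.2)) ((fderiv ℝ φ p).comp
        (ContinuousLinearMap.inl ℝ (Space d) ℝ)) p.1 :=
      HasFDerivAt.comp p.1 (f := fun y => (y, p.2)) hD (hasFDerivAt_prodMk_left p.1 p.2)
    rw [real_inner_comm, gradient, InnerProductSpace.toDual_symm_apply, h2.fderiv]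
    have hq : q = ∑ l, q l • (EuclideanSpace.single l (1 : ℝ) : Space d) := by
      ext j; simp [Finset.sum_apply, Pi.single_apply]
    conv_lhs => rw [hq]
    rw [map_sum]
    refine Finset.sum_congr rfl fun l _ => ?_
    rw [map_smul]; simp
  rw [entropyIntegrand, h1, h3, gInner_eq hd hlam hlam2 hφ hφc]
  simp only [entropy, entropyFlux, entropySign, PiLp.smul_apply, PiLp.sub_apply, smul_eq_mul]

theorem tendsto_diffQuot {E : Type*} [NormedAddCommGroup E] [NormedSpace ℝ E] {φ : E → ℝ} {p : E}
    (hφ : DifferentiableAt ℝ φ p) (w : E) {s : ℕ → ℝ} (hs : ∀ m, s m ≠ 0)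
    (hs0 : Tendsto s atTop (𝓝 0)) :
    Tendsto (fun m => (φ (p + s m • w) - φ p) / s m) atTop (𝓝 (fderiv ℝ φ p w)) := by
  have h1 := (hφ.hasFDerivAt.hasLineDerivAt w).tendsto_slope_zero
  have h2 := h1.comp (tendsto_nhdsWithin_iff.2 ⟨hs0, Eventually.of_forall hs⟩)
  refine h2.congr fun m => ?_
  simp [div_eq_inv_mul]

/-- Where the limit of the test factor vanishes, boundedness of the other factor is enough.
Convergence of the approximations is thus needed only near the support of `φ` and at times in
`(0,T)`. -/
theorem tendsto_mul_of_bdd {a ψ : ℕ → ℝ} {a₀ ψ₀ C : ℝ} (ha : ∀ m, |a m| ≤ C)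
    (hψ : Tendsto ψ atTop (𝓝 ψ₀)) (h : ψ₀ ≠ 0 → Tendsto a atTop (𝓝 a₀)) :
    Tendsto (fun m => a m * ψ m) atTop (𝓝 (a₀ * ψ₀)) := by
  by_cases h0 : ψ₀ = 0
  · rw [h0, mul_zero]
    rw [h0] at hψ
    refine squeeze_zero_norm (fun m => ?_) (by simpa using hψ.abs.const_mul C)
    rw [norm_mul]
    exact mul_le_mul_of_nonneg_right (ha m) (norm_nonneg _)
  · exact (h h0).mul hψ

theorem tendsto_sign {a : ℕ → ℝ} {a₀ : ℝ} (ha : Tendsto a atTop (𝓝 a₀)) (h0 : a₀ ≠ 0) :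
    Tendsto (fun m => Real.sign (a m)) atTop (𝓝 (Real.sign a₀)) := by
  refine tendsto_const_nhds.congr' ?_
  rcases lt_or_gt_of_ne h0 with h | h
  · filter_upwards [ha.eventually_lt_const h] with m hm
    rw [Real.sign_of_neg h, Real.sign_of_neg hm]
  · filter_upwards [ha.eventually_const_lt h] with m hm
    rw [Real.sign_of_pos h, Real.sign_of_pos hm]

theorem abs_translate_sub_le {d : ℕ} {φ : SpaceTime d → ℝ} {L : ℝ≥0} (hL : LipschitzWith L φ)
    {R s : ℝ} (hs : 0 < s) (p w : SpaceTime d) (hw : ‖w‖ ≤ s) (hR : s ≤ R) :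
    |(φ (p + w) - φ p) / s| ≤ (Metric.cthickening R (tsupport φ)).indicator (fun _ => (L : ℝ)) p := by
  by_cases hp : p ∈ Metric.cthickening R (tsupport φ)
  · rw [indicator_of_mem hp, abs_div, abs_of_pos hs, div_le_iff₀ hs]
    have := hL.dist_le_mul (p + w) p
    rw [Real.dist_eq, dist_eq_norm, add_sub_cancel_left] at this
    exact this.trans (mul_le_mul_of_nonneg_left hw L.2)
  · have key : ∀ q, dist p q ≤ R → φ q = 0 := fun q hq =>
      image_eq_zero_of_notMem_tsupport fun h => hp (Metric.mem_cthickening_of_dist_le p q R _ h hq)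
    rw [indicator_of_notMem hp, key p (by simpa using hs.le.trans hR), key (p + w)
      (by simpa using hw.trans hR)]
    simp

theorem innerOp_eq_zero {d : ℕ} {c lam r : ℝ} {φ : SpaceTime d → ℝ} {p : SpaceTime d}
    (h : ∀ x, φ (x, p.2) = 0) : innerOp c lam r φ p = 0 := by
  have : ∀ z : Space d, secondDiff φ p (z, 0) = 0 := fun z => by
    rw [secondDiff, add_mk_zero, sub_mk_zero, h, h, show φ p = 0 from h p.1]; simp
  simp [innerOp, this]

/-- The last time in the compact support lies strictly before `T`, and the gap leaves room for one
time step. -/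
theorem IsTestFunction.eventually_support {d : ℕ} {T : ℝ} {φ : SpaceTime d → ℝ}
    (hφ : IsTestFunction T φ) :
    ∃ δ > 0, ∀ τ, 0 < τ → τ < δ → ∀ p, φ p ≠ 0 → 0 ≤ p.2 ∧ p.2 + τ < T := by
  have hK : IsCompact (Prod.snd '' tsupport φ) := hφ.compact.isCompact.image continuous_snd
  have hsub : Prod.snd '' tsupport φ ⊆ Ioo 0 T := by
    rintro _ ⟨p, hp, rfl⟩
    exact (hφ.support hp).2
  rcases (tsupport φ).eq_empty_or_nonempty with he | hne
  · refine ⟨1, one_pos, fun τ _ _ p hp => ?_⟩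
    have := subset_tsupport φ hp
    rw [he] at this
    exact absurd this (notMem_empty _)
  obtain ⟨b, hb, hmax⟩ := hK.exists_isMaxOn (hne.image _) continuousOn_id
  refine ⟨T - b, sub_pos.2 (hsub hb).2, fun τ _ hτ p hp => ?_⟩
  have hp' : p.2 ∈ Prod.snd '' tsupport φ := ⟨p, subset_tsupport φ hp, rfl⟩
  have h1 : p.2 ≤ b := hmax hp'
  exact ⟨(hsub hp').1.le, by linarith⟩

theorem entropyIntegrand_eq_zero {d : ℕ} (hd : 1 ≤ d) {c lam r T : ℝ} (hlam : 0 < lam)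
    (hlam2 : lam < 2) {f : ℝ → Space d} {A : ℝ → ℝ} {k : ℝ} {u : SpaceTime d → ℝ}
    {φ : SpaceTime d → ℝ} (hφ : IsTestFunction T φ) {p : SpaceTime d} (hp : p.2 ∉ Ioo 0 T) :
    entropyIntegrand c lam f A k r u φ p = 0 := by
  have hz : ∀ x, (x, p.2) ∉ tsupport φ := fun x hx => hp (hφ.support hx).2
  have hz0 : ∀ x, φ (x, p.2) = 0 := fun x => image_eq_zero_of_notMem_tsupport (hz x)
  have hD : fderiv ℝ φ p = 0 := by
    by_contra hne
    exact hz p.1 (support_fderiv_subset ℝ hne)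
  rw [entropyIntegrand_eq hd hlam hlam2 f A k u hφ.smooth hφ.compact, hD, innerOp_eq_zero hz0,
    show φ p = 0 from hz0 p.1]
  simp

/-- Each term is a bounded factor times a test factor converging everywhere, so `hp` is required
only where the latter can survive. The thickening by `2 r` accounts for the nonlocal `innerOp`. -/
theorem tendsto_discIntegrand {d : ℕ} (hd : 1 ≤ d) {c lam r T : ℝ} (hc : 0 < c) (hlam : 0 < lam)
    (hlam2 : lam < 2) (hr : 0 < r) {f : ℝ → Space d} {A : ℝ → ℝ} {LA : ℝ≥0}
    (hA : LipschitzWith LA A)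
    {F : ℕ → Fin d → ℝ → ℝ → ℝ} {LF : ℝ≥0}
    (hF : ∀ m l, IsNumericalFlux LF (fun v => f v l) (F m l))
    {h τ : ℕ → ℝ} (hh : ∀ m, 0 < h m) (hh0 : Tendsto h atTop (𝓝 0))
    (hτ : ∀ m, 0 < τ m) (hτ0 : Tendsto τ atTop (𝓝 0)) {M : ℝ}
    {v : ℕ → SpaceTime d → ℝ} {u : SpaceTime d → ℝ} (hvM : ∀ m p, |v m p| ≤ M)
    {φ : SpaceTime d → ℝ} (hφ : IsTestFunction T φ) {k : ℝ} {p : SpaceTime d}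
    (hp : p ∈ Metric.cthickening (2 * r) (tsupport φ) → p.2 ∈ Ioo 0 T →
      u p ≠ k ∧ Tendsto (fun m => v m p) atTop (𝓝 (u p)) ∧
      (∀ l, Tendsto (fun m => v m (p + (EuclideanSpace.single l (h m), 0))) atTop (𝓝 (u p))) ∧
      Tendsto (fun m => v m (p + (0, τ m))) atTop (𝓝 (u p)) ∧
      Tendsto (fun m => quadOn c lam (h m) {z | r < ‖z‖} (fun y => A (v m (y, p.2))) p.1)
        atTop (𝓝 (gOuter c lam r (fun y => A (u (y, p.2))) p.1))) :
    Tendsto (fun m => discIntegrand c lam A (F m) (h m) (τ m) k r (v m) φ p) atTop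
      (𝓝 (entropyIntegrand c lam f A k r u φ p)) := by
  rw [entropyIntegrand_eq hd hlam hlam2 f A k u hφ.smooth hφ.compact]
  have hsub : tsupport φ ⊆ Metric.cthickening (2 * r) (tsupport φ) :=
    Metric.self_subset_cthickening _
  have hfd : ∀ w, fderiv ℝ φ p w ≠ 0 → p ∈ tsupport φ := fun w hw =>
    support_fderiv_subset ℝ (f := φ) fun h0 => hw (by rw [h0]; rfl)
  have hsupp : p ∈ tsupport φ → p ∈ Metric.cthickening (2 * r) (tsupport φ) ∧ p.2 ∈ Ioo 0 T :=
    fun h => ⟨hsub h, (hφ.support h).2⟩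
  have hdiff : DifferentiableAt ℝ φ p := hφ.smooth.differentiable (by simp) p
  have hAb : ∀ m q, |A (v m q)| ≤ |A 0| + LA * M := fun m q => abs_le_of_lipschitz hA (hvM m q)
  have t1 : Tendsto (fun m => |v m p - k| * ((φ p - φ (p - (0, τ m))) / τ m)) atTop
      (𝓝 (|u p - k| * fderiv ℝ φ p (0, 1))) := by
    refine tendsto_mul_of_bdd (C := M + |k|) (fun m => ?_) ?_ fun h0 => ?_
    · rw [abs_abs]; exact (abs_sub _ _).trans (add_le_add (hvM m p) le_rfl)
    -- The backward time difference is a difference quotient with step `-τ`.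
    · have := tendsto_diffQuot hdiff (0, 1) (s := fun m => -τ m) (fun m => (neg_ne_zero.2 (hτ m).ne'))
        (by simpa using hτ0.neg)
      refine this.congr fun m => ?_
      have e : p + (-τ m) • ((0, 1) : SpaceTime d) = p - (0, τ m) := by ext <;> simp [sub_eq_add_neg]
      rw [e, ← neg_sub (φ p), neg_div_neg_eq]
    · obtain ⟨h1, h2⟩ := hsupp (hfd _ h0)
      exact ((hp h1 h2).2.1.sub_const k).abs
  have t2 : ∀ l, Tendsto (fun m => numEntropyFlux (F m l) k (v m p)
        (v m (p + (EuclideanSpace.single l (h m), 0)))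
        * ((φ (p + (EuclideanSpace.single l (h m), 0)) - φ p) / h m)) atTop
      (𝓝 (Real.sign (u p - k) * (f (u p) l - f k l)
          * fderiv ℝ φ p (EuclideanSpace.single l 1, 0))) := by
    intro l
    refine tendsto_mul_of_bdd (fun m => (hF m l).abs_numEntropyFlux_le k (hvM m _) (hvM m _)) ?_
      fun h0 => ?_
    · have := tendsto_diffQuot hdiff (EuclideanSpace.single l (1 : ℝ), 0) (s := h)
        (fun m => (hh m).ne') hh0
      refine this.congr fun m => ?_
      have e : p + h m • ((EuclideanSpace.single l 1, 0) : SpaceTime d)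
          = p + (EuclideanSpace.single l (h m), 0) := by
        rw [Prod.smul_mk, smul_zero]
        congr 2
        ext j; simp
      rw [e]
    · obtain ⟨h1, h2⟩ := hsupp (hfd _ h0)
      obtain ⟨-, c1, c2, -⟩ := hp h1 h2
      rw [tendsto_iff_norm_sub_tendsto_zero]
      have lim : Tendsto (fun m => 2 * (LF : ℝ) * (|v m p - u p|
          + |v m (p + (EuclideanSpace.single l (h m), 0)) - u p|)) atTop (𝓝 0) := by
        have a1 := (tendsto_iff_norm_sub_tendsto_zero.1 c1).add
          (tendsto_iff_norm_sub_tendsto_zero.1 (c2 l))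
        simpa using a1.const_mul (2 * (LF : ℝ))
      exact squeeze_zero (fun _ => norm_nonneg _)
        (fun m => (hF m l).abs_numEntropyFlux_sub_le k _ _ (u p)) lim
  have t3 : Tendsto (fun m => |A (v m p) - A k| * discInner c lam r (h m) φ p) atTop
      (𝓝 (|A (u p) - A k| * innerOp c lam r φ p)) := by
    refine tendsto_mul_of_bdd (C := |A 0| + LA * M + |A k|) (fun m => ?_)
      (tendsto_discInner hd hlam hlam2 hφ.smooth hφ.compact hh hh0 p) fun h0 => ?_
    · rw [abs_abs]; exact (abs_sub _ _).trans (add_le_add (hAb m p) le_rfl)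
    · have h1 : p ∈ Metric.cthickening (2 * r) (tsupport φ) := by
        by_contra h1
        obtain ⟨C, hC⟩ := exists_innerOp_le (c := c) (r := r) hd hlam hlam2 hφ.smooth hφ.compact
        have := hC p
        rw [indicator_of_notMem h1] at this
        exact h0 (abs_nonpos_iff.1 this)
      have h2 : p.2 ∈ Ioo 0 T := by
        by_contra h2
        exact h0 (innerOp_eq_zero fun x =>
          image_eq_zero_of_notMem_tsupport fun hx => h2 (hφ.support hx).2)
      exact (((hA.continuous.tendsto _).comp (hp h1 h2).2.1).sub_const (A k)).abs
  have t4 : Tendsto (fun m => Real.sign (v m (p + (0, τ m)) - k)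
        * quadOn c lam (h m) {z | r < ‖z‖} (fun y => A (v m (y, p.2))) p.1 * φ p) atTop
      (𝓝 (Real.sign (u p - k) * gOuter c lam r (fun y => A (u (y, p.2))) p.1 * φ p)) := by
    refine tendsto_mul_of_bdd (fun m => (abs_mul _ _).trans_le (mul_le_mul (abs_sign_le _)
      (abs_quadOn_le hc hlam hr (fun y => hAb m _) _) (abs_nonneg _) zero_le_one))
      tendsto_const_nhds fun h0 => ?_
    obtain ⟨h1, h2⟩ := hsupp (subset_tsupport φ h0)
    obtain ⟨c0, -, -, c3, c4⟩ := hp h1 h2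
    -- The only use of `u p ≠ k`: elsewhere in the integrand the sign multiplies a factor that
    -- vanishes at `u = k`.
    exact (tendsto_sign (c3.sub_const k) (sub_ne_zero.2 c0)).mul c4
  exact ((t1.add (tendsto_finsetSum _ fun l _ => t2 l)).add t3).add t4

/-- The majorant for the limit in the mesh: `C` is chosen before the flux, the step sizes and the
approximation. -/
theorem exists_discIntegrand_le {d : ℕ} (hd : 1 ≤ d) {c lam r T : ℝ} (hc : 0 < c)
    (hlam : 0 < lam) (hlam2 : lam < 2) (hr : 0 < r) {f : ℝ → Space d} {A : ℝ → ℝ} {LA : ℝ≥0}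
    (hA : LipschitzWith LA A) (LF : ℝ≥0) (M : ℝ)
    {φ : SpaceTime d → ℝ} (hφ : IsTestFunction T φ) (k : ℝ) :
    ∃ C, ∀ (F : Fin d → ℝ → ℝ → ℝ), (∀ l, IsNumericalFlux LF (fun v => f v l) (F l)) →
      ∀ h τ, 0 < h → h ≤ 2 * r → 0 < τ → τ ≤ 2 * r → ∀ v : SpaceTime d → ℝ, (∀ p, |v p| ≤ M) →
      ∀ p, |discIntegrand c lam A F h τ k r v φ p| ≤
        (Metric.cthickening (2 * r) (tsupport φ)).indicator (fun _ => C) p := by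
  obtain ⟨L, hL⟩ := ContDiff.lipschitzWith_of_hasCompactSupport hφ.compact hφ.smooth (by simp)
  obtain ⟨C₃, hC₃⟩ := exists_discInner_le (c := c) (r := r) hd hlam hlam2 hφ.smooth hφ.compact
  obtain ⟨C₄, hC₄⟩ := hφ.compact.exists_bound_of_continuous hφ.smooth.continuous
  set N := |A 0| + LA * M
  set I := c * ∫ z in {z : Space d | r < ‖z‖}, kernel d lam z * (N + N)
  refine ⟨(M + |k|) * L + d * (2 * LF * (2 * (M + |k|)) * L) + (N + |A k|) * C₃ + 1 * I * C₄,
    fun F hF h τ hh hhr hτ hτr v hv p => ?_⟩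
  set KK := Metric.cthickening (2 * r) (tsupport φ)
  have hAb : ∀ q, |A (v q)| ≤ N := fun q => abs_le_of_lipschitz hA (hv q)
  have b1 : |(φ p - φ (p - (0, τ))) / τ| ≤ KK.indicator (fun _ => (L : ℝ)) p := by
    have := abs_translate_sub_le hL hτ p (-(0, τ)) (by simp [Prod.norm_def, abs_of_pos hτ, hτ.le]) hτr
    rwa [← sub_eq_add_neg, ← abs_neg, ← neg_div, neg_sub] at this
  have b2 : ∀ l, |(φ (p + (EuclideanSpace.single l h, 0)) - φ p) / h| ≤
      KK.indicator (fun _ => (L : ℝ)) p := fun l =>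
    abs_translate_sub_le hL hh p _ (by rw [norm_mk_zero]; simp [abs_of_pos hh]) hhr
  have b3 := hC₃ h hh p
  have b4 : |φ p| ≤ KK.indicator (fun _ => C₄) p := by
    by_cases hp : p ∈ KK
    · rw [indicator_of_mem hp]; exact hC₄ p
    · rw [indicator_of_notMem hp, image_eq_zero_of_notMem_tsupport
        fun hx => hp (Metric.self_subset_cthickening _ hx), abs_zero]
  have a1 : |(|v p - k|)| ≤ M + |k| := by
    rw [abs_abs]; exact (abs_sub _ _).trans (add_le_add (hv p) le_rfl)
  have a2 : ∀ l, |numEntropyFlux (F l) k (v p) (v (p + (EuclideanSpace.single l h, 0)))| ≤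
      2 * LF * (2 * (M + |k|)) := fun l => (hF l).abs_numEntropyFlux_le k (hv _) (hv _)
  have a3 : |(|A (v p) - A k|)| ≤ N + |A k| := by
    rw [abs_abs]; exact (abs_sub _ _).trans (add_le_add (hAb p) le_rfl)
  have a4 : |Real.sign (v (p + (0, τ)) - k)
        * quadOn c lam h {z | r < ‖z‖} (fun y => A (v (y, p.2))) p.1| ≤ 1 * I :=
    (abs_mul _ _).trans_le (mul_le_mul (abs_sign_le _)
      (abs_quadOn_le hc hlam hr (fun y => hAb _) _) (abs_nonneg _) zero_le_one)
  have mul : ∀ {x y X Y : ℝ}, |x| ≤ X → |y| ≤ Y → |x * y| ≤ X * Y := fun hx hy => by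
    rw [abs_mul]; exact mul_le_mul hx hy (abs_nonneg _) ((abs_nonneg _).trans hx)
  have e1 := mul a1 b1
  have e2 : |∑ l, numEntropyFlux (F l) k (v p) (v (p + (EuclideanSpace.single l h, 0)))
        * ((φ (p + (EuclideanSpace.single l h, 0)) - φ p) / h)| ≤
      d * (2 * LF * (2 * (M + |k|)) * KK.indicator (fun _ => (L : ℝ)) p) := by
    refine (Finset.abs_sum_le_sum_abs _ _).trans
      ((Finset.sum_le_sum fun l _ => mul (a2 l) (b2 l)).trans_eq ?_)
    simp
  have e3 := mul a3 b3
  have e4 := mul a4 b4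
  unfold discIntegrand
  refine (abs_add_le _ _).trans ((add_le_add ((abs_add_le _ _).trans (add_le_add
    ((abs_add_le _ _).trans (add_le_add e1 e2)) e3)) e4).trans_eq ?_)
  by_cases hp : p ∈ KK
  · simp only [indicator_of_mem hp]
  · simp only [indicator_of_notMem hp]; simp

theorem measurable_discIntegrand {d : ℕ} {c lam r h τ k : ℝ} {f : ℝ → Space d} {A : ℝ → ℝ}
    {LA : ℝ≥0} (hA : LipschitzWith LA A) {F : Fin d → ℝ → ℝ → ℝ} {LF : ℝ≥0}
    (hF : ∀ l, IsNumericalFlux LF (fun v => f v l) (F l)) {v φ : SpaceTime d → ℝ}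
    (hv : Measurable v) (hφ : Continuous φ) :
    Measurable (discIntegrand c lam A F h τ k r v φ) := by
  have hAm := hA.continuous.measurable
  have hφm := hφ.measurable
  have h3 := measurable_discInner (c := c) (lam := lam) (r := r) (h := h) hφ
  have h4 := measurable_quadOn (c := c) (lam := lam) (h := h) (S := {z | r < ‖z‖}) (hAm.comp hv)
  have h5 : Measurable fun p : SpaceTime d => Real.sign (v (p + (0, τ)) - k) :=
    measurable_sign.comp (by fun_prop)
  have h2 : ∀ l, Measurable fun p : SpaceTime d =>
      numEntropyFlux (F l) k (v p) (v (p + (EuclideanSpace.single l h, 0))) := fun l =>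
    measurable_numEntropyFlux (hF l) k hv (by fun_prop)
  unfold discIntegrand
  refine ((Measurable.add (by fun_prop) ?_).add ?_).add ((h5.mul h4).mul hφm)
  · exact Finset.measurable_fun_sum _ fun l _ => (h2 l).mul (by fun_prop)
  · exact Measurable.mul (by fun_prop) h3

/-- The entropy inequality for those `k` whose level set is negligible. -/
theorem entropy_inequality_of_level_null {d : ℕ} (hd : 1 ≤ d) {c lam T : ℝ} (hc : 0 < c)
    (hlam : 0 < lam) (hlam2 : lam < 2) {f : ℝ → Space d}
    {A : ℝ → ℝ} {LA : ℝ≥0} (hA : LipschitzWith LA A) (hAmono : Monotone A)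
    {F : ℕ → Fin d → ℝ → ℝ → ℝ} {LF : ℝ≥0}
    (hF : ∀ m l, IsNumericalFlux LF (fun v => f v l) (F m l))
    {h τ : ℕ → ℝ} (hh : ∀ m, 0 < h m) (hh0 : Tendsto h atTop (𝓝 0))
    (hτ : ∀ m, 0 < τ m) (hτ0 : Tendsto τ atTop (𝓝 0))
    (hcfl : ∀ m, CFL d c lam LF LA (h m) (τ m)) {M : ℝ}
    {v : ℕ → SpaceTime d → ℝ} (hv : ∀ m, IsSchemeFun c lam A (F m) (h m) (τ m) T M (v m))
    {u : SpaceTime d → ℝ} (hu : Measurable u) (huM : ∀ p, |u p| ≤ M)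
    (hconv : ConvergesSlicewise T τ v u) {k : ℝ}
    (hk : ∀ᵐ p ∂(volume.restrict (cylinder d T)), u p ≠ k) {r : ℝ} (hr : 0 < r)
    {φ : SpaceTime d → ℝ} (hφ : IsTestFunction T φ) :
    0 ≤ ∫ p in cylinder d T, entropyIntegrand c lam f A k r u φ p := by
  set KK := Metric.cthickening (2 * r) (tsupport φ)
  have hKc : IsCompact KK := hφ.compact.isCompact.cthickening
  obtain ⟨R, hR⟩ := hKc.isBounded.subset_closedBall 0
  have hvM : ∀ m p, |v m p| ≤ M := fun m => (hv m).bound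
  -- A subsequence suffices, since the inequality for the limit no longer refers to the
  -- approximations.
  obtain ⟨ns, hns, hae⟩ := exists_subseq_tendsto hc hlam hr hA hh hh0
    (fun m => (hv m).measurable) hu hvM huM hconv R
  have hnst := hns.tendsto_atTop
  obtain ⟨C, hC⟩ := exists_discIntegrand_le hd hc hlam hlam2 hr (f := f) hA LF M hφ k
  obtain ⟨δ, hδ, hδφ⟩ := hφ.eventually_support
  have hh' := hh0.comp hnst
  have hτ' := hτ0.comp hnst
  have hlim : Tendsto (fun i => ∫ p, discIntegrand c lam A (F (ns i)) (h (ns i)) (τ (ns i)) k r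
      (v (ns i)) φ p) atTop (𝓝 (∫ p, entropyIntegrand c lam f A k r u φ p)) := by
    refine tendsto_integral_filter_of_dominated_convergence (KK.indicator fun _ => C)
      (Eventually.of_forall fun i => (measurable_discIntegrand hA (hF _) (hv _).measurable
        hφ.smooth.continuous).aestronglyMeasurable) ?_
      ((integrable_indicator_iff hKc.measurableSet).2 (integrableOn_const hKc.measure_lt_top.ne)) ?_
    · filter_upwards [hh'.eventually_le_const (by positivity : 0 < 2 * r),
        hτ'.eventually_le_const (by positivity : 0 < 2 * r)] with i h1 h2
      exact ae_of_all _ (hC _ (hF _) _ _ (hh _) h1 (hτ _) h2 _ (hvM _))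
    · have hk' := ae_imp_of_ae_restrict hk
      filter_upwards [hae, hk'] with p hp hpk
      refine tendsto_discIntegrand hd hc hlam hlam2 hr hA (fun i => hF (ns i)) (fun i => hh _) hh'
        (fun i => hτ _) hτ' (fun i => hvM _) hφ fun hpK hpT => ⟨hpk ⟨mem_univ _, hpT⟩, hp ⟨?_, hpT⟩⟩
      have := hR hpK
      rw [mem_closedBall_zero_iff] at this ⊢
      exact (norm_fst_le p).trans this
  have hnn : ∀ᶠ i in atTop, 0 ≤ ∫ p, discIntegrand c lam A (F (ns i)) (h (ns i)) (τ (ns i)) k r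
      (v (ns i)) φ p := by
    filter_upwards [hτ'.eventually_lt_const hδ] with i hi
    exact integral_discIntegrand_nonneg hd hc hlam hlam2 hA hAmono (hF _) (hh _) (hτ _) (hcfl _)
      (hv _) hφ (hδφ _ (hτ _) hi) k hr
  have h0 := ge_of_tendsto hlim hnn
  rwa [← setIntegral_eq_integral_of_forall_compl_eq_zero (s := cylinder d T)] at h0
  intro p hp
  exact entropyIntegrand_eq_zero hd hlam hlam2 hφ fun h => hp ⟨mem_univ _, h⟩

/-! ### The entropy inequality for all `k` -/

theorem abs_coord_sub_le {d : ℕ} {f : ℝ → Space d} {Lf : ℝ≥0} (hf : LipschitzWith Lf f) (a k : ℝ)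
    (l : Fin d) : |f a l - f k l| ≤ Lf * |a - k| := by
  have h1 := PiLp.norm_apply_le (f a - f k) l
  have h2 := hf.dist_le_mul a k
  rw [dist_eq_norm, Real.dist_eq] at h2
  exact h1.trans h2

/-- Uniformity over `|k| ≤ κ` provides the majorant for the later limit in `k`. -/
theorem exists_entropyIntegrand_le {d : ℕ} (hd : 1 ≤ d) {c lam r T : ℝ} (hc : 0 < c)
    (hlam : 0 < lam) (hlam2 : lam < 2) (hr : 0 < r) {f : ℝ → Space d} {Lf : ℝ≥0}
    (hf : LipschitzWith Lf f) {A : ℝ → ℝ} {LA : ℝ≥0} (hA : LipschitzWith LA A) {M : ℝ}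
    {u : SpaceTime d → ℝ} (huM : ∀ p, |u p| ≤ M)
    {φ : SpaceTime d → ℝ} (hφ : IsTestFunction T φ) (κ : ℝ) :
    ∃ C, ∀ k, |k| ≤ κ → ∀ p, |entropyIntegrand c lam f A k r u φ p| ≤
      (Metric.cthickening (2 * r) (tsupport φ)).indicator (fun _ => C) p := by
  obtain ⟨L, hL⟩ := (hφ.compact.fderiv ℝ).exists_bound_of_continuous
    (hφ.smooth.continuous_fderiv (by simp))
  obtain ⟨C₃, hC₃⟩ := exists_innerOp_le (c := c) (r := r) hd hlam hlam2 hφ.smooth hφ.compact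
  obtain ⟨C₄, hC₄⟩ := hφ.compact.exists_bound_of_continuous hφ.smooth.continuous
  set N := |A 0| + LA * M
  set I := c * ∫ z in {z : Space d | r < ‖z‖}, kernel d lam z * (N + N)
  refine ⟨(M + κ) * L + d * (1 * (Lf * (M + κ)) * L) + (N + (|A 0| + LA * κ)) * C₃ + 1 * I * C₄,
    fun k hk p => ?_⟩
  rw [entropyIntegrand_eq hd hlam hlam2 f A k u hφ.smooth hφ.compact]
  set KK := Metric.cthickening (2 * r) (tsupport φ)
  have hsub : tsupport φ ⊆ KK := Metric.self_subset_cthickening _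
  have hAb : ∀ q, |A (u q)| ≤ N := fun q => abs_le_of_lipschitz hA (huM q)
  have b1 : ∀ w : SpaceTime d, ‖w‖ ≤ 1 → |fderiv ℝ φ p w| ≤ KK.indicator (fun _ => L) p := by
    intro w hw
    by_cases hp : p ∈ KK
    · rw [indicator_of_mem hp]
      refine ((fderiv ℝ φ p).le_opNorm w).trans ?_
      have := norm_nonneg (fderiv ℝ φ p)
      nlinarith [hL p]
    · have : fderiv ℝ φ p = 0 := by
        by_contra hne
        exact hp (hsub (support_fderiv_subset ℝ hne))
      rw [indicator_of_notMem hp, this]; simp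
  have b4 : |φ p| ≤ KK.indicator (fun _ => C₄) p := by
    by_cases hp : p ∈ KK
    · rw [indicator_of_mem hp]; exact hC₄ p
    · rw [indicator_of_notMem hp, image_eq_zero_of_notMem_tsupport fun hx => hp (hsub hx), abs_zero]
  have a0 : |u p - k| ≤ M + κ := (abs_sub _ _).trans (add_le_add (huM p) hk)
  have a1 : |(|u p - k|)| ≤ M + κ := by rwa [abs_abs]
  have a3 : |(|A (u p) - A k|)| ≤ N + (|A 0| + LA * κ) := by
    rw [abs_abs]; exact (abs_sub _ _).trans (add_le_add (hAb p) (abs_le_of_lipschitz hA hk))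
  have mul : ∀ {x y X Y : ℝ}, |x| ≤ X → |y| ≤ Y → |x * y| ≤ X * Y := fun hx hy => by
    rw [abs_mul]; exact mul_le_mul hx hy (abs_nonneg _) ((abs_nonneg _).trans hx)
  have a2 : ∀ l, |Real.sign (u p - k) * (f (u p) l - f k l)| ≤ 1 * (Lf * (M + κ)) := fun l =>
    mul (abs_sign_le _) ((abs_coord_sub_le hf _ _ l).trans (mul_le_mul_of_nonneg_left a0 Lf.2))
  have a4 : |Real.sign (u p - k) * gOuter c lam r (fun y => A (u (y, p.2))) p.1| ≤ 1 * I :=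
    mul (abs_sign_le _) (abs_gOuter_le hc hlam hr (fun y => hAb _) _)
  have e1 := mul a1 (b1 (0, 1) (by simp))
  have e2 : |∑ l, Real.sign (u p - k) * (f (u p) l - f k l)
          * fderiv ℝ φ p (EuclideanSpace.single l 1, 0)| ≤
      d * (1 * (Lf * (M + κ)) * KK.indicator (fun _ => L) p) := by
    refine (Finset.abs_sum_le_sum_abs _ _).trans ((Finset.sum_le_sum fun l _ =>
      mul (a2 l) (b1 (EuclideanSpace.single l 1, 0) (by rw [norm_mk_zero]; simp))).trans_eq ?_)
    simp
  have e3 := mul a3 (hC₃ p)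
  have e4 := mul a4 b4
  refine (abs_add_le _ _).trans ((add_le_add ((abs_add_le _ _).trans (add_le_add
    ((abs_add_le _ _).trans (add_le_add e1 e2)) e3)) e4).trans_eq ?_)
  by_cases hp : p ∈ KK
  · simp only [indicator_of_mem hp]
  · simp only [indicator_of_notMem hp]; simp

theorem measurable_entropyIntegrand {d : ℕ} (hd : 1 ≤ d) {c lam r : ℝ} (hlam : 0 < lam)
    (hlam2 : lam < 2) {f : ℝ → Space d} (hf : Continuous f) {A : ℝ → ℝ} (hA : Continuous A)
    {u : SpaceTime d → ℝ} (hu : Measurable u) {φ : SpaceTime d → ℝ}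
    (hφ : ContDiff ℝ ∞ φ) (hφc : HasCompactSupport φ) (k : ℝ) :
    Measurable (entropyIntegrand c lam f A k r u φ) := by
  rw [funext (entropyIntegrand_eq hd hlam hlam2 f A k u hφ hφc)]
  have hAm := hA.measurable
  have hfm : ∀ l, Measurable fun a => f a l := fun l =>
    (by fun_prop : Continuous fun a => f a l).measurable
  have hfd : Continuous (fderiv ℝ φ) := hφ.continuous_fderiv (by simp)
  have hfd' : ∀ w, Measurable fun p => fderiv ℝ φ p w := fun w =>
    (by fun_prop : Continuous fun p => fderiv ℝ φ p w).measurable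
  have h3 := measurable_innerOp (c := c) (lam := lam) (r := r) hφ.continuous
  have h4 := measurable_gOuter (c := c) (lam := lam) (r := r) (hAm.comp hu)
  have h5 : Measurable fun p : SpaceTime d => Real.sign (u p - k) :=
    measurable_sign.comp (by fun_prop)
  refine ((Measurable.add ?_ ?_).add ?_).add ((h5.mul h4).mul hφ.continuous.measurable)
  · exact Measurable.mul (by fun_prop) (hfd' _)
  · exact Finset.measurable_fun_sum _ fun l _ =>
      (h5.mul (((hfm l).comp hu).sub_const _)).mul (hfd' _)
  · exact Measurable.mul (by fun_prop) h3

theorem integrable_entropyIntegrand {d : ℕ} (hd : 1 ≤ d) {c lam r T : ℝ} (hc : 0 < c)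
    (hlam : 0 < lam) (hlam2 : lam < 2) (hr : 0 < r) {f : ℝ → Space d} {Lf : ℝ≥0}
    (hf : LipschitzWith Lf f) {A : ℝ → ℝ} {LA : ℝ≥0} (hA : LipschitzWith LA A) {M : ℝ}
    {u : SpaceTime d → ℝ} (hu : Measurable u) (huM : ∀ p, |u p| ≤ M)
    {φ : SpaceTime d → ℝ} (hφ : IsTestFunction T φ) (k : ℝ) :
    Integrable (entropyIntegrand c lam f A k r u φ) := by
  obtain ⟨C, hC⟩ := exists_entropyIntegrand_le hd hc hlam hlam2 hr hf hA huM hφ |k|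
  have hKc : IsCompact (Metric.cthickening (2 * r) (tsupport φ)) := hφ.compact.isCompact.cthickening
  exact ((integrable_indicator_iff hKc.measurableSet).2
    (integrableOn_const hKc.measure_lt_top.ne)).mono'
    (measurable_entropyIntegrand hd hlam hlam2 hf.continuous hA.continuous hu hφ.smooth
      hφ.compact k).aestronglyMeasurable (ae_of_all _ (hC k le_rfl))

/-- At `u = k` the signs are `-1` and `1`, whose sum `0` is twice `sgn 0`; elsewhere the sign is
locally constant. -/
theorem tendsto_sign_add_sign {k u : ℝ} {k₁ k₂ : ℕ → ℝ} (h₁ : Tendsto k₁ atTop (𝓝 k))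
    (h₂ : Tendsto k₂ atTop (𝓝 k)) (hk₁ : ∀ n, k < k₁ n) (hk₂ : ∀ n, k₂ n < k) :
    Tendsto (fun n => Real.sign (u - k₁ n) + Real.sign (u - k₂ n)) atTop
      (𝓝 (Real.sign (u - k) + Real.sign (u - k))) := by
  by_cases hu : u = k
  · subst hu
    refine tendsto_const_nhds.congr fun n => ?_
    rw [Real.sign_of_neg (sub_neg.2 (hk₁ n)), Real.sign_of_pos (sub_pos.2 (hk₂ n))]
    simp
  · exact (tendsto_sign (h₁.const_sub u) (sub_ne_zero.2 hu)).add
      (tendsto_sign (h₂.const_sub u) (sub_ne_zero.2 hu))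

/-- The flux needs no averaging: at `u = k` the jump of the sign is multiplied by `f u - f k = 0`.
-/
theorem tendsto_sign_mul_sub {d : ℕ} {f : ℝ → Space d} (hf : Continuous f) {k u : ℝ}
    {k' : ℕ → ℝ} (h : Tendsto k' atTop (𝓝 k)) (l : Fin d) :
    Tendsto (fun n => Real.sign (u - k' n) * (f u l - f (k' n) l)) atTop
      (𝓝 (Real.sign (u - k) * (f u l - f k l))) := by
  have hfl : Continuous fun a => f a l := by fun_prop
  have hψ : Tendsto (fun n => f u l - f (k' n) l) atTop (𝓝 (f u l - f k l)) :=
    ((hfl.tendsto k).comp h).const_sub _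
  refine tendsto_mul_of_bdd (fun n => abs_sign_le _) hψ fun h0 => ?_
  refine tendsto_sign (h.const_sub u) (sub_ne_zero.2 fun hu => h0 ?_)
  rw [hu, sub_self]

theorem tendsto_entropyIntegrand_add {d : ℕ} (hd : 1 ≤ d) {c lam r T : ℝ} (hlam : 0 < lam)
    (hlam2 : lam < 2) {f : ℝ → Space d} (hf : Continuous f) {A : ℝ → ℝ} (hA : Continuous A)
    {u φ : SpaceTime d → ℝ} (hφ : IsTestFunction T φ) {k : ℝ} {k₁ k₂ : ℕ → ℝ}
    (h₁ : Tendsto k₁ atTop (𝓝 k)) (h₂ : Tendsto k₂ atTop (𝓝 k)) (hk₁ : ∀ n, k < k₁ n)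
    (hk₂ : ∀ n, k₂ n < k) (p : SpaceTime d) :
    Tendsto (fun n => entropyIntegrand c lam f A (k₁ n) r u φ p
        + entropyIntegrand c lam f A (k₂ n) r u φ p) atTop
      (𝓝 (entropyIntegrand c lam f A k r u φ p + entropyIntegrand c lam f A k r u φ p)) := by
  simp only [entropyIntegrand_eq hd hlam hlam2 f A _ u hφ.smooth hφ.compact]
  have part : ∀ {k' : ℕ → ℝ}, Tendsto k' atTop (𝓝 k) → Tendsto (fun n =>
      |u p - k' n| * fderiv ℝ φ p (0, 1)
      + ∑ l, Real.sign (u p - k' n) * (f (u p) l - f (k' n) l)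
          * fderiv ℝ φ p (EuclideanSpace.single l 1, 0)
      + |A (u p) - A (k' n)| * innerOp c lam r φ p) atTop
      (𝓝 (|u p - k| * fderiv ℝ φ p (0, 1)
      + ∑ l, Real.sign (u p - k) * (f (u p) l - f k l)
          * fderiv ℝ φ p (EuclideanSpace.single l 1, 0)
      + |A (u p) - A k| * innerOp c lam r φ p)) := by
    intro k' hk'
    refine (((hk'.const_sub (u p)).abs.mul_const _).add (tendsto_finsetSum _ fun l _ =>
      (tendsto_sign_mul_sub hf hk' l).mul_const _)).add ?_
    exact ((((hA.tendsto k).comp hk').const_sub _).abs).mul_const _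
  have hs := ((tendsto_sign_add_sign (u := u p) h₁ h₂ hk₁ hk₂).mul_const
    (gOuter c lam r (fun y => A (u (y, p.2))) p.1)).mul_const (φ p)
  have htot := ((part h₁).add (part h₂)).add hs
  convert htot using 2
  · ring
  · ring

/-- Disjoint level sets of positive measure are countable in number, so good levels are dense.
Approaching `k` from both sides and adding the inequalities yields twice the inequality at `k`. -/
theorem entropy_inequality_of_forall_level_null {d : ℕ} (hd : 1 ≤ d) {c lam r T : ℝ} (hc : 0 < c)
    (hlam : 0 < lam) (hlam2 : lam < 2) (hr : 0 < r) {f : ℝ → Space d} {Lf : ℝ≥0}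
    (hf : LipschitzWith Lf f) {A : ℝ → ℝ} {LA : ℝ≥0} (hA : LipschitzWith LA A) {M : ℝ}
    {u : SpaceTime d → ℝ} (hu : Measurable u) (huM : ∀ p, |u p| ≤ M)
    {φ : SpaceTime d → ℝ} (hφ : IsTestFunction T φ)
    (H : ∀ k, (∀ᵐ p ∂(volume.restrict (cylinder d T)), u p ≠ k) →
      0 ≤ ∫ p in cylinder d T, entropyIntegrand c lam f A k r u φ p) (k : ℝ) :
    0 ≤ ∫ p in cylinder d T, entropyIntegrand c lam f A k r u φ p := by
  set μ := (volume : Measure (SpaceTime d)).restrict (cylinder d T)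
  have hcount : {t : ℝ | 0 < μ {p | u p = t}}.Countable :=
    Measure.countable_meas_level_set_pos hu
  have hdense := hcount.dense_compl ℝ
  have hgood : ∀ t ∈ {t : ℝ | 0 < μ {p | u p = t}}ᶜ, ∀ᵐ p ∂μ, u p ≠ t := by
    intro t ht
    have : μ {p | u p = t} = 0 := by simpa using ht
    exact measure_eq_zero_iff_ae_notMem.1 this
  have hδ : ∀ n : ℕ, (0 : ℝ) < 1 / ((n : ℝ) + 1) := fun n => by positivity
  have ex₁ : ∀ n : ℕ, ∃ t, (∀ᵐ p ∂μ, u p ≠ t) ∧ k < t ∧ t < k + 1 / ((n : ℝ) + 1) := by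
    intro n
    obtain ⟨t, ht, ht'⟩ := hdense.exists_between (by linarith [hδ n] : k < k + 1 / ((n : ℝ) + 1))
    exact ⟨t, hgood t ht, ht'.1, ht'.2⟩
  have ex₂ : ∀ n : ℕ, ∃ t, (∀ᵐ p ∂μ, u p ≠ t) ∧ k - 1 / ((n : ℝ) + 1) < t ∧ t < k := by
    intro n
    obtain ⟨t, ht, ht'⟩ := hdense.exists_between (by linarith [hδ n] : k - 1 / ((n : ℝ) + 1) < k)
    exact ⟨t, hgood t ht, ht'.1, ht'.2⟩
  choose k₁ g₁ l₁ u₁ using ex₁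
  choose k₂ g₂ l₂ u₂ using ex₂
  have h0 := tendsto_one_div_add_atTop_nhds_zero_nat (𝕜 := ℝ)
  have t₁ : Tendsto k₁ atTop (𝓝 k) := tendsto_of_tendsto_of_tendsto_of_le_of_le tendsto_const_nhds
    (by simpa using h0.const_add k) (fun n => (l₁ n).le) (fun n => (u₁ n).le)
  have t₂ : Tendsto k₂ atTop (𝓝 k) := tendsto_of_tendsto_of_tendsto_of_le_of_le
    (by simpa using h0.const_sub k) tendsto_const_nhds (fun n => (l₂ n).le) (fun n => (u₂ n).le)
  have hδ1 : ∀ n : ℕ, 1 / ((n : ℝ) + 1) ≤ 1 := fun n => by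
    rw [div_le_one (by positivity)]; linarith [(Nat.cast_nonneg n : (0 : ℝ) ≤ n)]
  have b₁ : ∀ n, |k₁ n| ≤ |k| + 1 := fun n => by
    have := abs_sub_abs_le_abs_sub (k₁ n) k
    rw [abs_of_pos (sub_pos.2 (l₁ n))] at this
    linarith [u₁ n, hδ1 n]
  have b₂ : ∀ n, |k₂ n| ≤ |k| + 1 := fun n => by
    have := abs_sub_abs_le_abs_sub (k₂ n) k
    rw [abs_of_neg (sub_neg.2 (u₂ n))] at this
    linarith [l₂ n, hδ1 n]
  obtain ⟨C, hC⟩ := exists_entropyIntegrand_le hd hc hlam hlam2 hr hf hA huM hφ (|k| + 1)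
  have hKc : IsCompact (Metric.cthickening (2 * r) (tsupport φ)) := hφ.compact.isCompact.cthickening
  have hbint : Integrable ((Metric.cthickening (2 * r) (tsupport φ)).indicator fun _ => C) :=
    (integrable_indicator_iff hKc.measurableSet).2 (integrableOn_const hKc.measure_lt_top.ne)
  have hm := measurable_entropyIntegrand (c := c) (r := r) hd hlam hlam2 hf.continuous hA.continuous
    hu hφ.smooth hφ.compact
  have hint : ∀ k, Integrable (entropyIntegrand c lam f A k r u φ) μ := fun k =>
    (integrable_entropyIntegrand hd hc hlam hlam2 hr hf hA hu huM hφ k).integrableOn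
  have hlim := tendsto_integral_of_dominated_convergence (μ := μ)
    (F := fun n p => entropyIntegrand c lam f A (k₁ n) r u φ p
        + entropyIntegrand c lam f A (k₂ n) r u φ p) _
    (fun n => ((hm (k₁ n)).add (hm (k₂ n))).aestronglyMeasurable)
    (hbint.add hbint).integrableOn
    (fun n => ae_of_all _ fun p => (norm_add_le _ _).trans
      (add_le_add (hC _ (b₁ n) p) (hC _ (b₂ n) p)))
    (ae_of_all _ fun p => tendsto_entropyIntegrand_add hd hlam hlam2 hf.continuous hA.continuous hφ
      t₁ t₂ l₁ u₂ p)
  have hnn : ∀ n, 0 ≤ ∫ p, (entropyIntegrand c lam f A (k₁ n) r u φ p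
        + entropyIntegrand c lam f A (k₂ n) r u φ p) ∂μ := fun n => by
    rw [integral_add (hint _) (hint _)]
    exact add_nonneg (H _ (g₁ n)) (H _ (g₂ n))
  have hfin := ge_of_tendsto' hlim hnn
  rw [integral_add (hint _) (hint _)] at hfin
  linarith

/-! ### Measurable representatives -/

theorem ae_slice_of_ae_cylinder {d : ℕ} {T : ℝ} {P : SpaceTime d → Prop}
    (h : ∀ᵐ p ∂(volume.restrict (cylinder d T)), P p) :
    ∀ᵐ t ∂(volume.restrict (Ioo 0 T)), ∀ᵐ x : Space d, P (x, t) := by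
  have hμ : (volume : Measure (SpaceTime d)).restrict (cylinder d T) =
      (volume : Measure (Space d)).prod (volume.restrict (Ioo 0 T)) := by
    rw [cylinder, Measure.volume_eq_prod, ← Measure.prod_restrict, Measure.restrict_univ]
  rw [hμ, ← Measure.prod_swap] at h
  have h' := ae_of_ae_map (measurable_swap.aemeasurable) h
  exact Measure.ae_ae_of_ae_prod h'

/-- A measurable version truncated at the essential bound; this makes measurability and bounds hold
everywhere, including outside the cylinder. -/
theorem IsBoundedContL1.exists_representative {d : ℕ} {T : ℝ} {u : SpaceTime d → ℝ}
    (hu : IsBoundedContL1 T u) :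
    ∃ (w : SpaceTime d → ℝ) (M : ℝ), Measurable w ∧ (∀ p, |w p| ≤ M) ∧
      w =ᵐ[volume.restrict (cylinder d T)] u := by
  have hm := hu.memLp_top.1
  obtain ⟨M, hM⟩ : ∃ M : ℝ, ∀ᵐ p ∂(volume.restrict (cylinder d T)), |u p| ≤ M := by
    refine ⟨(eLpNorm u ∞ (volume.restrict (cylinder d T))).toReal, ?_⟩
    have hfin := hu.memLp_top.2
    have := ae_le_eLpNormEssSup (f := u) (μ := volume.restrict (cylinder d T))
    filter_upwards [this] with p hp
    rw [eLpNorm_exponent_top] at hfin ⊢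
    have h2 := ENNReal.toReal_mono hfin.ne hp
    rwa [toReal_enorm, Real.norm_eq_abs] at h2
  refine ⟨fun p => max (-|M|) (min |M| (hm.mk u p)), |M|, ?_, fun p => ?_, ?_⟩
  · have := hm.stronglyMeasurable_mk.measurable
    fun_prop
  · rw [abs_le]
    exact ⟨le_max_left _ _, max_le (by linarith [abs_nonneg M]) (min_le_left _ _)⟩
  · filter_upwards [hm.ae_eq_mk, hM] with p hp hpM
    rw [← hp]
    have := abs_le.1 (hpM.trans (le_abs_self M))
    rw [min_eq_right this.2, max_eq_right this.1]

/-- The outer operator at a point sees a whole time slice, so equality on almost every slice is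
needed, not only at the point. -/
theorem entropyIntegrand_congr {d : ℕ} {c lam r T : ℝ} {f : ℝ → Space d} {A : ℝ → ℝ} {k : ℝ}
    {u w φ : SpaceTime d → ℝ} (h : w =ᵐ[volume.restrict (cylinder d T)] u) :
    entropyIntegrand c lam f A k r w φ =ᵐ[volume.restrict (cylinder d T)]
      entropyIntegrand c lam f A k r u φ := by
  have h1 := ae_slice_of_ae_cylinder h
  have hμ : (volume : Measure (SpaceTime d)).restrict (cylinder d T) =
      (volume : Measure (Space d)).prod (volume.restrict (Ioo 0 T)) := by
    rw [cylinder, Measure.volume_eq_prod, ← Measure.prod_restrict, Measure.restrict_univ]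
  have h2 : ∀ᵐ p ∂((volume : Measure (SpaceTime d)).restrict (cylinder d T)),
      ∀ᵐ x : Space d, w (x, p.2) = u (x, p.2) := by
    rw [hμ]
    exact Measure.quasiMeasurePreserving_snd.ae h1
  filter_upwards [h, h2] with p hp hp2
  have hg : gOuter c lam r (fun y => A (w (y, p.2))) p.1
      = gOuter c lam r (fun y => A (u (y, p.2))) p.1 := by
    unfold gOuter
    congr 1
    refine integral_congr_ae (ae_restrict_of_ae ?_)
    have h3 := (measurePreserving_add_left volume p.1).quasiMeasurePreserving.ae hp2
    filter_upwards [h3] with z hz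
    rw [hz, show w (p.1, p.2) = u (p.1, p.2) from hp]
  simp only [entropyIntegrand, hp, hg]

/-! ### The interpolated scheme -/

theorem measurableSet_centredCell {d : ℕ} (h : ℝ) (β : Fin d → ℤ) :
    MeasurableSet (centredCell h β) := by
  have : centredCell h β = ⋂ l, {z : Space d | h * β l - h / 2 ≤ z l ∧ z l < h * β l + h / 2} := by
    ext z; simp [centredCell]
  rw [this]
  refine MeasurableSet.iInter fun l => ?_
  exact (measurableSet_le measurable_const (by fun_prop : Measurable fun z : Space d => z l)).inter
    (measurableSet_lt (by fun_prop : Measurable fun z : Space d => z l) measurable_const)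

theorem measurable_gridIndex {d : ℕ} (h : ℝ) :
    Measurable (gridIndex h : Space d → Fin d → ℤ) :=
  measurable_pi_lambda _ fun l =>
    Int.measurable_floor.comp (by fun_prop : Measurable fun z : Space d => z l / h + 1 / 2)

theorem gridRound_eq_zero_iff {d : ℕ} {h : ℝ} (hh : 0 < h) (z : Space d) :
    gridRound h z = 0 ↔ gridIndex h z = 0 := by
  constructor
  · intro hz
    funext l
    have := congrArg (fun y : Space d => y l) hz
    simpa [gridIndex, hh.ne'] using this
  · intro hz
    ext l
    simp [gridRound, hz]

/-- The centred cells partition the space and `b` is constant on each once composed with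
`gridIndex`. The condition `b 0 = 0` makes the integral converge and accounts for the omitted index
`β = 0`. -/
theorem tsum_weight_mul {d : ℕ} {c lam h B : ℝ} (hlam : 0 < lam) (hh : 0 < h)
    {b : (Fin d → ℤ) → ℝ} (hB : ∀ β, |b β| ≤ B) (hb : b 0 = 0) :
    ∑' β : {β : Fin d → ℤ // β ≠ 0}, weight c lam h β.1 * b β.1 =
      c * ∫ z, kernel d lam z * b (gridIndex h z) := by
  have hm : Measurable fun z : Space d => b (gridIndex h z) :=
    (measurable_of_countable b).comp (measurable_gridIndex h)
  have hint : Integrable fun z : Space d => kernel d lam z * b (gridIndex h z) :=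
    integrable_kernel_mul hlam hh hm.aestronglyMeasurable (fun z => hB _)
      (fun z hz => by rw [(gridRound_eq_zero_iff hh z).1 hz, hb])
  have hU : ⋃ β, centredCell h β = (univ : Set (Space d)) := by
    refine eq_univ_of_forall fun z => mem_iUnion.2 ⟨gridIndex h z, ?_⟩
    exact (mem_centredCell_iff hh z _).2 rfl
  have hsum := hasSum_integral_iUnion (fun β => measurableSet_centredCell h β)
    (fun β γ hβγ => Set.disjoint_left.2 fun z h1 h2 => hβγ <| by
      rw [← (mem_centredCell_iff hh z _).1 h1, ← (mem_centredCell_iff hh z _).1 h2])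
    (by rw [hU]; exact hint.integrableOn : IntegrableOn
      (fun z : Space d => kernel d lam z * b (gridIndex h z)) (⋃ β, centredCell h β))
  rw [hU, setIntegral_univ] at hsum
  have hterm : ∀ β, c * ∫ z in centredCell h β, kernel d lam z * b (gridIndex h z)
      = weight c lam h β * b β := by
    intro β
    rw [weight, mul_assoc, ← integral_mul_const]
    congr 1
    refine setIntegral_congr_fun (measurableSet_centredCell h β) fun z hz => ?_
    simp only [(mem_centredCell_iff hh z β).1 hz]
  have hsum' := hsum.mul_left c
  simp only [hterm] at hsum'
  rw [← hsum'.tsum_eq]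
  refine tsum_subtype_eq_of_support_subset (f := fun β => weight c lam h β * b β)
    (s := {β | β ≠ 0}) fun β hβ => ?_
  intro h0
  exact hβ (by simp only [h0, hb, mul_zero])

theorem measurable_interp {d : ℕ} (h τ : ℝ) (U : ℕ → (Fin d → ℤ) → ℝ) :
    Measurable (interp h τ U) := by
  have h1 : Measurable fun p : SpaceTime d => ((⌊p.2 / τ⌋₊, fun l => ⌊p.1 l / h⌋) :
      ℕ × (Fin d → ℤ)) := by
    refine Measurable.prodMk (Nat.measurable_floor.comp (by fun_prop))
      (measurable_pi_lambda _ fun l => Int.measurable_floor.comp (by fun_prop))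
  exact (measurable_of_countable (fun q : ℕ × (Fin d → ℤ) => U q.1 q.2)).comp h1

/-- The interpolation of the scheme, set to `0` from the time `T` on. -/
def cutInterp {d : ℕ} (h τ T : ℝ) (U : ℕ → (Fin d → ℤ) → ℝ) (p : SpaceTime d) : ℝ :=
  if p.2 < T then interp h τ U p else 0

theorem cutInterp_of_lt {d : ℕ} {h τ T : ℝ} {U : ℕ → (Fin d → ℤ) → ℝ} {x : Space d} {t : ℝ}
    (ht : t < T) : cutInterp h τ T U (x, t) = interp h τ U (x, t) := if_pos ht

theorem measurable_cutInterp {d : ℕ} (h τ T : ℝ) (U : ℕ → (Fin d → ℤ) → ℝ) :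
    Measurable (cutInterp h τ T U) :=
  Measurable.ite (measurableSet_lt measurable_snd measurable_const) (measurable_interp h τ U)
    measurable_const

theorem floor_lt_of_lt {τ T t : ℝ} {N : ℕ} (hτ : 0 < τ) (hT : 0 < T) (hN : N * τ = T)
    (ht : t < T) : ⌊t / τ⌋₊ < N := by
  have hN0 : N ≠ 0 := by rintro rfl; simp at hN; linarith
  rw [Nat.floor_lt' hN0, div_lt_iff₀ hτ, hN]
  exact ht

/-- The assumed bounds control `U n` only for `n < N`, hence the cut at `T`; negative times are
floored to level `0`. -/
theorem abs_cutInterp_le {d : ℕ} {h τ T M : ℝ} {N : ℕ} {U : ℕ → (Fin d → ℤ) → ℝ} (hτ : 0 < τ)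
    (hT : 0 < T) (hN : N * τ = T) (hU : ∀ n < N, ∀ α, |U n α| ≤ M) (hM : 0 ≤ M)
    (p : SpaceTime d) : |cutInterp h τ T U p| ≤ M := by
  unfold cutInterp
  split_ifs with hp
  · exact hU _ (floor_lt_of_lt hτ hT hN hp) _
  · simpa using hM

theorem interp_add_gridPoint {d : ℕ} {h τ : ℝ} (hh : 0 < h) (U : ℕ → (Fin d → ℤ) → ℝ)
    (x : Space d) (t : ℝ) (β : Fin d → ℤ) :
    interp h τ U (x + gridPoint h β, t) = U ⌊t / τ⌋₊ ((fun l => ⌊x l / h⌋) + β) := by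
  simp only [interp]
  congr 1
  funext l
  have : (x + gridPoint h β) l / h = x l / h + β l := by
    simp only [PiLp.add_apply, gridPoint_apply]
    field_simp
  rw [this, Int.floor_add_intCast]
  rfl

theorem single_eq_gridPoint {d : ℕ} (h : ℝ) (l : Fin d) :
    (EuclideanSpace.single l h : Space d) = gridPoint h (Pi.single l 1) := by
  ext j
  by_cases hj : j = l
  · subst hj; simp
  · simp [hj]

theorem neg_gridPoint {d : ℕ} (h : ℝ) (β : Fin d → ℤ) :
    -(gridPoint h β : Space d) = gridPoint h (-β) := by
  ext j; simp

theorem IsSchemeSolution.isSchemeFun {d : ℕ} {c lam : ℝ} (hlam : 0 < lam) {A : ℝ → ℝ}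
    {LA : ℝ≥0} (hA : LipschitzWith LA A) {F : Fin d → ℝ → ℝ → ℝ} {u₀ : Space d → ℝ} {h τ T M : ℝ}
    {N : ℕ} {U : ℕ → (Fin d → ℤ) → ℝ} (hS : IsSchemeSolution c lam A F u₀ h τ N U) (hh : 0 < h)
    (hτ : 0 < τ) (hT : 0 < T) (hN : N * τ = T) (hU : ∀ n < N, ∀ α, |U n α| ≤ M) (hM : 0 ≤ M) :
    IsSchemeFun c lam A F h τ T M (cutInterp h τ T U) where
  measurable := measurable_cutInterp h τ T U
  bound := abs_cutInterp_le hτ hT hN hU hM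
  step := by
    intro x t ht0 htT
    have htT' : t < T := by linarith
    have hn := floor_lt_of_lt hτ hT hN htT'
    simp only [cutInterp_of_lt htT, cutInterp_of_lt htT']
    set n := ⌊t / τ⌋₊
    set α : Fin d → ℤ := fun l => ⌊x l / h⌋
    have e0 : interp h τ U (x, t) = U n α := rfl
    have e1 : interp h τ U (x, t + τ) = U (n + 1) α := by
      -- This uses `0 ≤ t`: the natural-number floor is `0` at negative times, where a shift by `τ`
      -- need not raise the level.
      have : ⌊(t + τ) / τ⌋₊ = n + 1 := by
        rw [add_div, div_self hτ.ne', Nat.floor_add_one (by positivity)]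
      simp only [interp, this, α]
    have e2 : ∀ l, interp h τ U (x + EuclideanSpace.single l h, t) = U n (α + Pi.single l 1) :=
      fun l => by rw [single_eq_gridPoint, interp_add_gridPoint hh]
    have e3 : ∀ l, interp h τ U (x - EuclideanSpace.single l h, t) = U n (α - Pi.single l 1) :=
      fun l => by
        rw [sub_eq_add_neg, single_eq_gridPoint, neg_gridPoint, interp_add_gridPoint hh,
          ← sub_eq_add_neg]
    have e4 : ∀ z, interp h τ U (x + gridRound h z, t) = U n (α + gridIndex h z) :=
      fun z => interp_add_gridPoint hh U x t _
    have hsum := tsum_weight_mul (c := c) hlam hh (b := fun β => A (U n (α + β)) - A (U n α))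
      (fun β => (abs_sub _ _).trans (add_le_add (abs_le_of_lipschitz hA (hU n hn _))
        (abs_le_of_lipschitz hA (hU n hn _)))) (by simp)
    rw [e1, hS.step n hn α, hsum]
    simp only [fluxDiff, quadOn, setIntegral_univ, e0, e2, e3, e4]

theorem interp_eq_zero_time {d : ℕ} {h τ T : ℝ} {N : ℕ} {U : ℕ → (Fin d → ℤ) → ℝ} (hτ : 0 < τ)
    (hT : 0 < T) (hN : N * τ = T) (hU : ∀ n < N, U (n + 1) = U n) (x : Space d) {t : ℝ}
    (ht : t < T) : interp h τ U (x, t) = U 0 fun l => ⌊x l / h⌋ := by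
  have key : ∀ n ≤ N, U n = U 0 := by
    intro n
    induction n with
    | zero => simp
    | succ n ih => intro hn; rw [hU n (by omega), ih (by omega)]
  simp only [interp]
  rw [key _ (floor_lt_of_lt hτ hT hN ht).le]

/-- Without flux and diffusion the scheme is stationary, and any time step may be used. -/
theorem IsSchemeSolution.isSchemeFun_of_stationary {d : ℕ} {c lam : ℝ} {f : ℝ → Space d}
    {A : ℝ → ℝ} (hA : LipschitzWith 0 A) {F : Fin d → ℝ → ℝ → ℝ}
    (hF : ∀ l, IsNumericalFlux 0 (fun v => f v l) (F l))
    {u₀ : Space d → ℝ} {h τ T M : ℝ}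
    {N : ℕ} {U : ℕ → (Fin d → ℤ) → ℝ} (hS : IsSchemeSolution c lam A F u₀ h τ N U)
    (hτ : 0 < τ) (hT : 0 < T) (hN : N * τ = T) (hU : ∀ n < N, ∀ α, |U n α| ≤ M) (hM : 0 ≤ M)
    {τ' : ℝ} (hτ' : 0 < τ') : IsSchemeFun c lam A F h τ' T M (cutInterp h τ T U) where
  measurable := measurable_cutInterp h τ T U
  bound := abs_cutInterp_le hτ hT hN hU hM
  step := by
    -- Zero Lipschitz constants make `A` and every `F l` constant, so all differences in the scheme
    -- vanish, for any time step.
    have hAc : ∀ a b, A a - A b = 0 := fun a b => by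
      have := hA.dist_le_mul a b
      rw [Real.dist_eq] at this
      exact abs_nonpos_iff.1 (by simpa using this)
    have hFc : ∀ l a b a' b', F l a b - F l a' b' = 0 := fun l a b a' b' => by
      have := (hF l).lipschitz a b a' b'
      exact abs_nonpos_iff.1 (by simpa using this)
    have hst : ∀ n < N, U (n + 1) = U n := fun n hn => by
      funext α
      rw [hS.step n hn α]
      simp [hAc, hFc]
    intro x t _ htT
    have htT' : t < T := by linarith
    simp only [fluxDiff, quadOn, hAc, hFc]
    rw [cutInterp_of_lt htT, cutInterp_of_lt htT', interp_eq_zero_time hτ hT hN hst x htT,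
      interp_eq_zero_time hτ hT hN hst x htT']
    simp

/-! ### Cells, and pointwise bounds from almost everywhere bounds -/

theorem measurableSet_cell {d : ℕ} (h : ℝ) (α : Fin d → ℤ) :
    MeasurableSet (cell h α) := by
  have : cell h α = ⋂ l, {z : Space d | h * α l ≤ z l ∧ z l < h * α l + h} := by
    ext z; simp [cell]
  rw [this]
  exact MeasurableSet.iInter fun l =>
    (measurableSet_le measurable_const (by fun_prop : Measurable fun z : Space d => z l)).inter
      (measurableSet_lt (by fun_prop : Measurable fun z : Space d => z l) measurable_const)

theorem volume_cell {d : ℕ} {h : ℝ} (hh : 0 < h) (α : Fin d → ℤ) :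
    volume (cell h α) = ENNReal.ofReal (h ^ d) := by
  rw [← (EuclideanSpace.volume_preserving_symm_measurableEquiv_toLp (Fin d)).symm.measure_preimage
    (measurableSet_cell h α).nullMeasurableSet]
  have : (MeasurableEquiv.toLp 2 (Fin d → ℝ)).symm.symm ⁻¹' cell h α =
      univ.pi fun l => Ico (h * α l) (h * α l + h) := by
    ext x; simp [cell]
  rw [this, Real.volume_pi_Ico]
  simp [ENNReal.ofReal_pow hh.le]

/-- For `n < N` each value is taken on a space-time cell of positive measure inside the cylinder. -/
theorem abs_le_of_ae_interp_le {d : ℕ} {h τ T M : ℝ} {N : ℕ} {U : ℕ → (Fin d → ℤ) → ℝ}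
    (hh : 0 < h) (hτ : 0 < τ) (hN : N * τ = T)
    (hb : ∀ᵐ p ∂(volume.restrict (cylinder d T)), |interp h τ U p| ≤ M) :
    ∀ n < N, ∀ α, |U n α| ≤ M := by
  intro n hn α
  have hsub : cell h α ×ˢ Ioo ((n : ℝ) * τ) ((n + 1) * τ) ⊆ cylinder d T := by
    rintro ⟨x, t⟩ ⟨-, ht⟩
    refine ⟨mem_univ _, ?_, ?_⟩
    · exact lt_of_le_of_lt (by positivity) ht.1
    · refine lt_of_lt_of_le ht.2 ?_
      rw [← hN]
      have : ((n : ℝ) + 1) ≤ N := by exact_mod_cast hn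
      exact mul_le_mul_of_nonneg_right this hτ.le
  have hpos : 0 < volume (cell h α ×ˢ Ioo ((n : ℝ) * τ) ((n + 1) * τ)) := by
    rw [Measure.volume_eq_prod, Measure.prod_prod]
    refine ENNReal.mul_pos (by rw [volume_cell hh]; simp; positivity) ?_
    rw [Real.volume_Ioo]
    simp only [ne_eq, ENNReal.ofReal_eq_zero, not_le]
    nlinarith
  have hb' := ae_restrict_of_ae_restrict_of_subset hsub hb
  by_contra hcon
  have hmeas : MeasurableSet (cell h α ×ˢ Ioo ((n : ℝ) * τ) ((n + 1) * τ)) :=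
    (measurableSet_cell h α).prod measurableSet_Ioo
  have hz : ∀ᵐ p ∂((volume : Measure (SpaceTime d)).restrict
      (cell h α ×ˢ Ioo ((n : ℝ) * τ) ((n + 1) * τ))), False := by
    filter_upwards [hb', ae_restrict_mem hmeas] with p hp hpm
    apply hcon
    have := interp_eq hh hτ U (x := p.1) (t := p.2) hpm.1 ⟨hpm.2.1.le, hpm.2.2⟩
    rw [Prod.mk.eta] at this
    rwa [this] at hp
  rw [ae_iff] at hz
  simp only [not_false_eq_true] at hz
  have : volume.restrict (cell h α ×ˢ Ioo ((n : ℝ) * τ) ((n + 1) * τ)) univ = 0 := by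
    simpa using hz
  rw [Measure.restrict_apply_univ] at this
  exact hpos.ne' this

/-- The shifted limit combines uniformity in time of the convergence, applied at `t + τ m`, with
continuity of `u` at `t`. The shift `τ` is not tied to the mesh step `σ`, as the stationary case
requires. -/
theorem convergesSlicewise_cutInterp {d : ℕ} {T : ℝ} {h σ τ : ℕ → ℝ}
    {U : ℕ → ℕ → (Fin d → ℤ) → ℝ}
    {u w : SpaceTime d → ℝ} (hu : IsBoundedContL1 T u)
    (hw : w =ᵐ[volume.restrict (cylinder d T)] u)
    (hconv : Tendsto (fun m => ⨆ t ∈ Icc (0 : ℝ) T,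
        eLpNorm (fun x : Space d => interp (h m) (σ m) (U m) (x, t) - u (x, t)) 1 volume)
      atTop (𝓝 0))
    (hτ : ∀ m, 0 < τ m) (hτ0 : Tendsto τ atTop (𝓝 0)) :
    ConvergesSlicewise T τ (fun m => cutInterp (h m) (σ m) T (U m)) w := by
  have hsl := ae_slice_of_ae_cylinder hw
  have hle : ∀ m, ∀ t ∈ Icc (0 : ℝ) T,
      ∫⁻ x : Space d, ‖interp (h m) (σ m) (U m) (x, t) - u (x, t)‖ₑ ≤ ⨆ t ∈ Icc (0 : ℝ) T,
        eLpNorm (fun x : Space d => interp (h m) (σ m) (U m) (x, t) - u (x, t)) 1 volume := by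
    intro m t ht
    rw [← eLpNorm_one_eq_lintegral_enorm]
    exact le_iSup₂ (f := fun t (_ : t ∈ Icc (0 : ℝ) T) =>
      eLpNorm (fun x : Space d => interp (h m) (σ m) (U m) (x, t) - u (x, t)) 1 volume) t ht
  refine ⟨?_, ?_, ?_⟩
  · filter_upwards [hsl, ae_restrict_mem measurableSet_Ioo] with t ht htT
    exact (hu.integrable t ⟨htT.1.le, htT.2.le⟩).congr (ht.mono fun x hx => hx.symm)
  · filter_upwards [hsl, ae_restrict_mem measurableSet_Ioo] with t ht htT
    refine tendsto_of_tendsto_of_tendsto_of_le_of_le tendsto_const_nhds hconv (fun _ => zero_le)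
      fun m => (Eq.trans_le ?_ (hle m t ⟨htT.1.le, htT.2.le⟩))
    refine lintegral_congr_ae ?_
    filter_upwards [ht] with x hx
    rw [hx, cutInterp_of_lt htT.2]
  · filter_upwards [hsl, ae_restrict_mem measurableSet_Ioo] with t ht htT
    have ht' : t ∈ Icc (0 : ℝ) T := ⟨htT.1.le, htT.2.le⟩
    have hlt : Tendsto (fun m => t + τ m) atTop (𝓝 t) := by simpa using hτ0.const_add t
    -- From some index on the cut at `T` does not act.
    have hev : ∀ᶠ m in atTop, t + τ m < T := hlt.eventually_lt_const htT.2
    have hwithin : Tendsto (fun m => t + τ m) atTop (𝓝[Icc 0 T] t) :=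
      tendsto_nhdsWithin_iff.2 ⟨hlt, hev.mono fun m hm => ⟨by linarith [hτ m, htT.1], hm.le⟩⟩
    have h1 := hconv.add ((hu.continuous t ht').comp hwithin)
    rw [add_zero] at h1
    refine tendsto_of_tendsto_of_tendsto_of_le_of_le' tendsto_const_nhds h1
      (Eventually.of_forall fun _ => zero_le) ?_
    filter_upwards [hev] with m hm
    have hmem : t + τ m ∈ Icc (0 : ℝ) T := ⟨by linarith [hτ m, htT.1], hm.le⟩
    have hmeas : AEMeasurable fun x : Space d =>
        ‖interp (h m) (σ m) (U m) (x, t + τ m) - u (x, t + τ m)‖ₑ :=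
      (((measurable_interp (h m) (σ m) (U m)).comp
        measurable_prodMk_right).aemeasurable.sub
          (hu.integrable _ hmem).1.aemeasurable).enorm
    calc ∫⁻ x : Space d, ‖cutInterp (h m) (σ m) T (U m) (x, t + τ m) - w (x, t)‖ₑ
        = ∫⁻ x : Space d, ‖interp (h m) (σ m) (U m) (x, t + τ m) - u (x, t)‖ₑ := by
          refine lintegral_congr_ae ?_
          filter_upwards [ht] with x hx
          rw [hx, cutInterp_of_lt hm]
      _ ≤ ∫⁻ x : Space d, (‖interp (h m) (σ m) (U m) (x, t + τ m) - u (x, t + τ m)‖ₑ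
            + ‖u (x, t + τ m) - u (x, t)‖ₑ) := by
          refine lintegral_mono fun x => ?_
          refine Eq.trans_le ?_ (enorm_add_le _ _)
          congr 1; ring
      _ = _ := lintegral_add_left' hmeas _
      _ ≤ _ := by
          refine add_le_add (hle m _ hmem) ?_
          rw [← eLpNorm_one_eq_lintegral_enorm]
          rfl

/-- Each summand of the CFL condition is nonnegative, hence at most `1`, and one with a nonzero
constant bounds `τ` by a multiple of `h` or of `h ^ λ`. -/
theorem tendsto_timeStep {d : ℕ} (hd : 1 ≤ d) {c lam : ℝ} (hc : 0 < c) (hlam : 0 < lam)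
    {LF LA : ℝ≥0} {h τ : ℕ → ℝ} (hh : ∀ m, 0 < h m) (hh0 : Tendsto h atTop (𝓝 0))
    (hτ : ∀ m, 0 < τ m) (hcfl : ∀ m, CFL d c lam LF LA (h m) (τ m)) (hne : LF ≠ 0 ∨ LA ≠ 0) :
    Tendsto τ atTop (𝓝 0) := by
  set I := ∫ z in {z : Space d | 1 < ‖z‖}, kernel d lam z
  have hI : 0 < I := setIntegral_kernel_pos hd hlam
  have hd0 : (0 : ℝ) < d := by exact_mod_cast hd
  have hp1 : ∀ m, 0 ≤ 2 * d * LF * (τ m / h m) := fun m => by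
    have := hτ m; have := hh m; positivity
  have hp2 : ∀ m, 0 ≤ c * 2 ^ lam * LA * I * (τ m / h m ^ lam) := fun m => by
    have := hτ m; have := hh m; positivity
  rcases hne with hF | hA
  · have hF0 : (0 : ℝ) < LF := by positivity
    have hb : ∀ m, τ m ≤ h m / (2 * d * LF) := fun m => by
      have h1 : 2 * d * LF * (τ m / h m) ≤ 1 := by
        have h2 := hcfl m; unfold CFL at h2; linarith [hp2 m]
      rw [← mul_div_assoc, div_le_one (hh m)] at h1
      rw [le_div_iff₀ (by positivity)]; linarith
    exact squeeze_zero (fun m => (hτ m).le) hb (by simpa using hh0.div_const (2 * d * LF : ℝ))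
  · have hA0 : (0 : ℝ) < LA := by positivity
    have hb : ∀ m, τ m ≤ h m ^ lam / (c * 2 ^ lam * LA * I) := fun m => by
      have h1 : c * 2 ^ lam * LA * I * (τ m / h m ^ lam) ≤ 1 := by
        have h2 := hcfl m; unfold CFL at h2; linarith [hp1 m]
      have h3 : 0 < h m ^ lam := Real.rpow_pos_of_pos (hh m) _
      rw [← mul_div_assoc, div_le_one h3] at h1
      rw [le_div_iff₀ (by positivity)]; linarith
    have h0 : Tendsto (fun m => h m ^ lam) atTop (𝓝 0) := by
      have := hh0.rpow_const (p := lam) (Or.inr hlam.le)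
      rwa [Real.zero_rpow hlam.ne'] at this
    exact squeeze_zero (fun m => (hτ m).le) hb
      (by simpa using h0.div_const (c * 2 ^ lam * LA * I))

/-! ### The initial datum -/

/-- The index of the cell containing `x`. -/
def cellIndex {d : ℕ} (h : ℝ) (x : Space d) : Fin d → ℤ := fun l => ⌊x l / h⌋

theorem measurable_cellIndex {d : ℕ} (h : ℝ) :
    Measurable (cellIndex h : Space d → Fin d → ℤ) :=
  measurable_pi_lambda _ fun l =>
    Int.measurable_floor.comp (by fun_prop : Measurable fun z : Space d => z l / h)

theorem mem_cell_iff {d : ℕ} {h : ℝ} (hh : 0 < h) (x : Space d) (α : Fin d → ℤ) :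
    x ∈ cell h α ↔ cellIndex h x = α := by
  simp only [cell, mem_ofPred_eq, cellIndex, funext_iff, Int.floor_eq_iff]
  refine forall_congr' fun l => ?_
  rw [le_div_iff₀ hh, div_lt_iff₀ hh]
  constructor <;> rintro ⟨h1, h2⟩ <;> constructor <;> linarith

theorem norm_sub_le_of_cellIndex_eq {d : ℕ} {h : ℝ} (hh : 0 < h) {x y : Space d}
    (hxy : cellIndex h x = cellIndex h y) : ‖x - y‖ ≤ d * h := by
  have hx := (mem_cell_iff hh x _).2 hxy
  have hy := (mem_cell_iff hh y _).2 rfl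
  have hl : ∀ l, |x l - y l| ≤ h := fun l => by
    rw [abs_le]; constructor <;> linarith [(hx l).1, (hx l).2, (hy l).1, (hy l).2]
  rw [EuclideanSpace.norm_eq]
  refine Real.sqrt_le_iff.2 ⟨by positivity, ?_⟩
  calc ∑ l, ‖(x - y) l‖ ^ 2 ≤ ∑ _l : Fin d, h ^ 2 := by
        refine Finset.sum_le_sum fun l _ => ?_
        rw [PiLp.sub_apply, Real.norm_eq_abs]
        have := hl l
        gcongr
    _ = d * h ^ 2 := by simp
    _ ≤ (d * h) ^ 2 := by
        rw [mul_pow]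
        refine mul_le_mul_of_nonneg_right ?_ (by positivity)
        rcases Nat.eq_zero_or_pos d with h0 | h0
        · simp [h0]
        · have : (1 : ℝ) ≤ d := by exact_mod_cast h0
          nlinarith

/-- Testing the cell averages of `u₀` against a Lipschitz function with compact support. -/
theorem abs_integral_average_sub_le {d : ℕ} {h : ℝ} (hh : 0 < h) (hh1 : h ≤ 1) {u₀ ψ : Space d → ℝ}
    (hu₀ : LocallyIntegrable u₀) {L : ℝ≥0} (hL : LipschitzWith L ψ) (hψ : HasCompactSupport ψ)
    {V : (Fin d → ℤ) → ℝ} (hV : ∀ α, V α = 1 / h ^ d * ∫ x in cell h α, u₀ x) :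
    |(∫ x, ψ x * V (cellIndex h x)) - ∫ x, ψ x * u₀ x| ≤
      (∫ x in Metric.cthickening d (tsupport ψ), |u₀ x|) * (L * (d * h)) := by
  set K := Metric.cthickening (d : ℝ) (tsupport ψ)
  have hK : IsCompact K := hψ.isCompact.cthickening
  have hKm := hK.measurableSet
  set g : Space d → ℝ := K.indicator u₀
  have hg : Integrable g := (integrable_indicator_iff hKm).2 (hu₀.integrableOn_isCompact hK)
  have hψc := hL.continuous
  have hψi : Integrable ψ := hψc.integrable_of_hasCompactSupport hψ
  obtain ⟨B, hB⟩ := hψ.exists_bound_of_continuous hψc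
  -- Cells have diameter at most `d h ≤ d`, which explains the thickening radius.
  have hmemK : ∀ x y, cellIndex h x = cellIndex h y → ψ x ≠ 0 → y ∈ K := by
    intro x y hxy hx
    refine Metric.mem_cthickening_of_dist_le y x _ _ (subset_tsupport ψ hx) ?_
    rw [dist_eq_norm]
    refine (norm_sub_le_of_cellIndex_eq hh hxy.symm).trans ?_
    nlinarith [(Nat.cast_nonneg d : (0 : ℝ) ≤ d)]
  have hD : MeasurableSet {q : Space d × Space d | cellIndex h q.1 = cellIndex h q.2} :=
    measurableSet_eq_fun ((measurable_cellIndex h).comp measurable_fst)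
      ((measurable_cellIndex h).comp measurable_snd)
  -- Integrating `G` in `y` gives `ψ` times the cell average of `u₀`; integrating in `x` gives `u₀`,
  -- cut to `K`, times the cell average of `ψ`. Fubini thus moves the averaging from the merely
  -- integrable datum to the Lipschitz function.
  set G : Space d → Space d → ℝ := fun x y =>
    {q : Space d × Space d | cellIndex h q.1 = cellIndex h q.2}.indicator
      (fun q => 1 / h ^ d * (ψ q.1 * g q.2)) (x, y) with hG
  have hGi : Integrable (Function.uncurry G) (volume.prod volume) :=
    ((hψi.mul_prod hg).const_mul (1 / h ^ d)).indicator hD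
  have hGx : ∀ x, G x = fun y => (cell h (cellIndex h x)).indicator
      (fun y => 1 / h ^ d * ψ x * g y) y := by
    intro x; funext y
    simp only [hG, indicator, mem_ofPred_eq, mem_cell_iff hh]
    simp only [eq_comm, mul_assoc]
  have hGy : ∀ y, (fun x => G x y) = fun x => (cell h (cellIndex h y)).indicator
      (fun x => g y * (1 / h ^ d) * ψ x) x := by
    intro y; funext x
    simp only [hG, indicator, mem_ofPred_eq, mem_cell_iff hh]
    split_ifs <;> ring
  have e1 : ∀ x, ∫ y, G x y = ψ x * V (cellIndex h x) := by
    intro x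
    rw [hGx, integral_indicator (measurableSet_cell h _), integral_const_mul, hV]
    by_cases hx : ψ x = 0
    · simp [hx]
    have : ∫ y in cell h (cellIndex h x), g y = ∫ y in cell h (cellIndex h x), u₀ y := by
      refine setIntegral_congr_fun (measurableSet_cell h _) fun y hy => ?_
      exact indicator_of_mem (hmemK x y ((mem_cell_iff hh y _).1 hy).symm hx) _
    rw [this]; ring
  have e2 : ∀ y, ∫ x, G x y = g y * (1 / h ^ d * ∫ x in cell h (cellIndex h y), ψ x) := by
    intro y
    rw [hGy, integral_indicator (measurableSet_cell h _), integral_const_mul]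
    ring
  have hswap := integral_integral_swap hGi
  simp only [e1, e2] at hswap
  have e3 : ∀ x, ψ x * u₀ x = g x * ψ x := by
    intro x
    by_cases hx : ψ x = 0
    · simp [hx]
    · rw [show g x = u₀ x from indicator_of_mem (hmemK x x rfl hx) _, mul_comm]
  have i1 : Integrable fun y => g y * (1 / h ^ d * ∫ x in cell h (cellIndex h y), ψ x) := by
    have := hGi.integral_prod_right
    simpa only [Function.uncurry_apply_pair, e2] using this
  have i2 : Integrable fun x => g x * ψ x :=
    (hg.bdd_mul hψc.aestronglyMeasurable (ae_of_all _ hB)).congr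
      (ae_of_all _ fun x => mul_comm _ _)
  rw [hswap]
  simp only [e3]
  rw [← integral_sub i1 i2, ← Real.norm_eq_abs, ← integral_indicator hKm, ← integral_mul_const]
  have ib : Integrable fun x => K.indicator (fun x => |u₀ x|) x * (L * (d * h)) :=
    ((integrable_indicator_iff hKm).2 (hu₀.integrableOn_isCompact hK).abs).mul_const _
  refine norm_integral_le_of_norm_le ib (ae_of_all _ fun y => ?_)
  have havg : |1 / h ^ d * (∫ x in cell h (cellIndex h y), ψ x) - ψ y| ≤ L * (d * h) := by
    have hvol : volume.real (cell h (cellIndex h y)) = h ^ d := by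
      rw [Measure.real, volume_cell hh, ENNReal.toReal_ofReal (by positivity)]
    have hfin : volume (cell h (cellIndex h y)) < ⊤ := by
      rw [volume_cell hh]; exact ENNReal.ofReal_lt_top
    have hpd : 0 < h ^ d := by positivity
    have h1 : 1 / h ^ d * (∫ x in cell h (cellIndex h y), ψ x) - ψ y =
        1 / h ^ d * ∫ x in cell h (cellIndex h y), (ψ x - ψ y) := by
      rw [integral_sub hψi.integrableOn (integrableOn_const hfin.ne), setIntegral_const, hvol,
        smul_eq_mul]
      field_simp
    have h2 : ‖∫ x in cell h (cellIndex h y), (ψ x - ψ y)‖ ≤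
        L * (d * h) * volume.real (cell h (cellIndex h y)) := by
      refine norm_setIntegral_le_of_norm_le_const hfin fun x hx => ?_
      have h3 := hL.dist_le_mul x y
      rw [dist_eq_norm, dist_eq_norm] at h3
      exact h3.trans (mul_le_mul_of_nonneg_left
        (norm_sub_le_of_cellIndex_eq hh ((mem_cell_iff hh x _).1 hx)) L.2)
    rw [hvol, Real.norm_eq_abs] at h2
    rw [h1, abs_mul, abs_of_pos (by positivity), one_div_mul_eq_div, div_le_iff₀ hpd]
    exact h2
  rw [← mul_sub, norm_mul]
  refine mul_le_mul (le_of_eq ?_) havg (norm_nonneg _) ?_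
  · simp only [g, indicator]
    split_ifs <;> simp
  · exact indicator_nonneg (fun _ _ => abs_nonneg _) _

/-- Against smooth compactly supported functions the cell averages tend to `u₀`, while the uniform
convergence at time `0` sends them to `u(·,0)` in `L¹`; the limits agree. -/
theorem initial_ae_eq {d : ℕ} {T : ℝ} (hT : 0 < T) {u₀ : Space d → ℝ} (hu₀ : LocallyIntegrable u₀)
    {h σ : ℕ → ℝ} (hh : ∀ m, 0 < h m) (hh0 : Tendsto h atTop (𝓝 0))
    {U : ℕ → ℕ → (Fin d → ℤ) → ℝ}
    (hU : ∀ m α, U m 0 α = 1 / h m ^ d * ∫ x in cell (h m) α, u₀ x)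
    {u : SpaceTime d → ℝ} (hu : IsBoundedContL1 T u)
    (hconv : Tendsto (fun m => ⨆ t ∈ Icc (0 : ℝ) T,
        eLpNorm (fun x : Space d => interp (h m) (σ m) (U m) (x, t) - u (x, t)) 1 volume)
      atTop (𝓝 0)) :
    (fun x => u (x, 0)) =ᵐ[volume] u₀ := by
  have h0T : (0 : ℝ) ∈ Icc (0 : ℝ) T := ⟨le_rfl, hT.le⟩
  have hui := hu.integrable 0 h0T
  refine ae_eq_of_integral_contDiff_smul_eq hui.locallyIntegrable hu₀ fun ψ hψ hψc => ?_
  simp only [smul_eq_mul]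
  obtain ⟨L, hL⟩ := ContDiff.lipschitzWith_of_hasCompactSupport hψc hψ (by simp)
  obtain ⟨B, hB⟩ := hψc.exists_bound_of_continuous hψ.continuous
  have hint0 : ∀ m x, interp (h m) (σ m) (U m) (x, (0 : ℝ)) = U m 0 (cellIndex (h m) x) :=
    fun m x => by simp [interp]; rfl
  have c1 : Tendsto (fun m => ∫⁻ x, ‖U m 0 (cellIndex (h m) x) - u (x, 0)‖ₑ) atTop (𝓝 0) := by
    refine tendsto_of_tendsto_of_tendsto_of_le_of_le tendsto_const_nhds hconv (fun _ => zero_le)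
      fun m => ?_
    have := le_iSup₂ (f := fun t (_ : t ∈ Icc (0 : ℝ) T) =>
      eLpNorm (fun x : Space d => interp (h m) (σ m) (U m) (x, t) - u (x, t)) 1 volume) 0 h0T
    simpa only [eLpNorm_one_eq_lintegral_enorm, hint0] using this
  have hm : ∀ m, Measurable fun x => U m 0 (cellIndex (h m) x) := fun m =>
    (measurable_of_countable _).comp (measurable_cellIndex (h m))
  have hfin : ∀ᶠ m in atTop, Integrable fun x => U m 0 (cellIndex (h m) x) := by
    filter_upwards [c1.eventually_lt_const (show (0 : ℝ≥0∞) < 1 by simp)] with m hlt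
    have : Integrable fun x => U m 0 (cellIndex (h m) x) - u (x, 0) :=
      ⟨(hm m).aestronglyMeasurable.sub hui.1, hlt.trans ENNReal.one_lt_top⟩
    exact (this.add hui).congr (ae_of_all _ fun x => by simp)
  have t1 : Tendsto (fun m => ∫ x, ψ x * U m 0 (cellIndex (h m) x)) atTop
      (𝓝 (∫ x, ψ x * u (x, 0))) := by
    have bm : ∀ {w : Space d → ℝ}, Integrable w → Integrable fun x => ψ x * w x := fun hw =>
      hw.bdd_mul hψ.continuous.aestronglyMeasurable (ae_of_all _ hB)
    refine tendsto_integral_of_L1 _ (bm hui).1 (hfin.mono fun m hm => bm hm) ?_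
    have c2 := ENNReal.Tendsto.const_mul (a := ENNReal.ofReal B) c1 (Or.inr ENNReal.ofReal_ne_top)
    rw [mul_zero] at c2
    refine tendsto_of_tendsto_of_tendsto_of_le_of_le tendsto_const_nhds c2 (fun _ => zero_le)
      fun m => ?_
    rw [← lintegral_const_mul' _ _ ENNReal.ofReal_ne_top]
    refine lintegral_mono fun x => ?_
    rw [← mul_sub, enorm_mul]
    refine mul_le_mul_left ?_ _
    rw [← ofReal_norm]
    exact ENNReal.ofReal_le_ofReal (hB x)
  have t2 : Tendsto (fun m => ∫ x, ψ x * U m 0 (cellIndex (h m) x)) atTop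
      (𝓝 (∫ x, ψ x * u₀ x)) := by
    rw [tendsto_iff_norm_sub_tendsto_zero]
    refine squeeze_zero' (Eventually.of_forall fun _ => norm_nonneg _) ?_
      (g := fun m => (∫ x in Metric.cthickening d (tsupport ψ), |u₀ x|) * (L * (d * h m))) ?_
    · filter_upwards [hh0.eventually_le_const one_pos] with m hm1
      exact abs_integral_average_sub_le (hh m) hm1 hu₀ hL hψc (hU m)
    · have := ((hh0.const_mul (d : ℝ)).const_mul (L : ℝ)).const_mul
        (∫ x in Metric.cthickening d (tsupport ψ), |u₀ x|)
      simpa using this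
  exact tendsto_nhds_unique t1 t2

end FracConvDiff

end

/-! ### Conclusion -/

open FracConvDiff in
theorem mainTheorem3
    (d : ℕ) (hd : 1 ≤ d)
    (c lam T : ℝ) (hc : 0 < c) (hlam0 : 0 < lam) (hlam2 : lam < 2) (hT : 0 < T)
    (f : ℝ → Space d) (Lf : ℝ≥0) (hf : LipschitzWith Lf f)
    (A : ℝ → ℝ) (LA : ℝ≥0) (hA : LipschitzWith LA A) (hAmono : Monotone A) (hA0 : A 0 = 0)
    (u₀ : Space d → ℝ) (hu₀ : LocallyIntegrable u₀)
    -- numerical fluxes, with a Lipschitz constant common to the whole sequence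
    (F : ℕ → Fin d → ℝ → ℝ → ℝ) (LF : ℝ≥0)
    (hF : ∀ m l, IsNumericalFlux LF (fun v => f v l) (F m l))
    -- grids with `N Δt = T`, `Δx → 0` and the CFL condition
    (Δx Δt : ℕ → ℝ) (N : ℕ → ℕ) (hΔx : ∀ m, 0 < Δx m) (hΔt : ∀ m, 0 < Δt m)
    (hN : ∀ m, N m * Δt m = T) (hΔx0 : Tendsto Δx atTop (𝓝 0))
    (hCFL : ∀ m, CFL d c lam LF LA (Δx m) (Δt m))
    -- solutions of the scheme, uniformly bounded on `Q_T`
    (U : ℕ → ℕ → (Fin d → ℤ) → ℝ)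
    (hU : ∀ m, IsSchemeSolution c lam A (F m) u₀ (Δx m) (Δt m) (N m) (U m))
    (hbdd : ∃ M : ℝ, ∀ m, ∀ᵐ p ∂(volume.restrict (cylinder d T)),
      |interp (Δx m) (Δt m) (U m) p| ≤ M)
    -- convergence in `C([0,T]; L^1)`
    (u : Space d × ℝ → ℝ) (hu : IsBoundedContL1 T u)
    (hconv : Tendsto (fun m => ⨆ t ∈ Icc (0 : ℝ) T,
        eLpNorm (fun x : Space d => interp (Δx m) (Δt m) (U m) (x, t) - u (x, t)) 1 volume)
      atTop (𝓝 0)) :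
    IsEntropySolution c lam T f A u₀ u := by
  obtain ⟨M₀, hM₀⟩ := hbdd
  obtain ⟨w, M₁, hw, hwM, hwu⟩ := hu.exists_representative
  set M := max M₀ M₁
  have hM : 0 ≤ M := ((abs_nonneg _).trans (hwM 0)).trans (le_max_right _ _)
  have hwM' : ∀ p, |w p| ≤ M := fun p => (hwM p).trans (le_max_right _ _)
  have hUM : ∀ m, ∀ n < N m, ∀ α, |U m n α| ≤ M := fun m n hn α =>
    (abs_le_of_ae_interp_le (hΔx m) (hΔt m) (hN m) (hM₀ m) n hn α).trans (le_max_left _ _)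
  -- The time step of the discrete inequality: `Δt` itself when the CFL condition forces it to `0`,
  -- otherwise any null sequence, because the scheme is stationary and the condition is void.
  obtain ⟨τ, hτ, hτ0, hτc, hsch⟩ : ∃ τ : ℕ → ℝ, (∀ m, 0 < τ m) ∧ Tendsto τ atTop (𝓝 0) ∧
      (∀ m, CFL d c lam LF LA (Δx m) (τ m)) ∧
      ∀ m, IsSchemeFun c lam A (F m) (Δx m) (τ m) T M (cutInterp (Δx m) (Δt m) T (U m)) := by
    by_cases hne : LF ≠ 0 ∨ LA ≠ 0
    · exact ⟨Δt, hΔt, tendsto_timeStep hd hc hlam0 hΔx hΔx0 hΔt hCFL hne, hCFL, fun m =>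
        (hU m).isSchemeFun hlam0 hA (hΔx m) (hΔt m) hT (hN m) (hUM m) hM⟩
    · simp only [ne_eq, not_or, not_not] at hne
      obtain ⟨rfl, rfl⟩ := hne
      refine ⟨fun m => 1 / ((m : ℝ) + 1), fun m => by positivity,
        tendsto_one_div_add_atTop_nhds_zero_nat, fun m => by simp [CFL], fun m =>
        (hU m).isSchemeFun_of_stationary hA (hF m) (hΔt m) hT (hN m) (hUM m) hM (by positivity)⟩
  have hcs := convergesSlicewise_cutInterp hu hwu hconv hτ hτ0
  refine ⟨hu, fun k r hr φ hφ => ?_,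
    initial_ae_eq hT hu₀ hΔx hΔx0 (fun m => (hU m).init) hu hconv⟩
  -- The estimates concern the representative `w`; the integrand for `u` agrees with it almost
  -- everywhere on the cylinder.
  have hcongr := entropyIntegrand_congr (c := c) (lam := lam) (r := r) (f := f) (A := A) (k := k)
    (φ := φ) hwu
  constructor
  · exact ((integrable_entropyIntegrand hd hc hlam0 hlam2 hr hf hA hw hwM hφ k).integrableOn).congr
      hcongr
  · rw [← integral_congr_ae hcongr]
    exact entropy_inequality_of_forall_level_null hd hc hlam0 hlam2 hr hf hA hw hwM hφ
      (fun k hk => entropy_inequality_of_level_null hd hc hlam0 hlam2 hA hAmono hF hΔx hΔx0 hτ hτ0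
        hτc hsch hw hwM' hcs hk hr hφ) k
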